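/- Let $m\ge 1$ be an integer and consider the plane curve $x=z+1/z$, $y=z^m/m$. Let $\omega^g_n(z_1,\dots,z_n)$ ($g\ge 0$, $n\ge 1$) be its Eynard--Orantin invariants: $\omega^0_1=y\,dx$, $\omega^0_2=B(z_1,z_2)=\frac{dz_1dz_2}{(z_1-z_2)^2}$, and, whenever $2g-2+(n+1)>0$, $$\omega^g_{n+1}(z_0,z_S)=\sum_{\alpha=\pm1}\mathop{\mathrm{Res}}_{z=\alpha}K(z_0,z)\Big[\omega^{g-1}_{n+2}(z,\hat z,z_S)+\sum_{g_1+g_2=g,\ I\sqcup J=S}\omega^{g_1}_{|I|+1}(z,z_I)\,\omega^{g_2}_{|J|+1}(\hat z,z_J)\Big],$$ where $S=\{1,\dots,n\}$, $\hat z=1/z$, $K(z_0,z)=\dfrac{-\int_{\hat z}^{z}B(z_0,\cdot)}{2(y(z)-y(\hat z))\,dx(z)}$, $\omega^{-1}_{n+2}=0$, and the inner sum omits the terms containing a factor $\omega^0_1$. For $n\ge1$ and $2g-2+n>0$ there is a unique function $N^g_n:\mathbb Z^n\to\mathbb C$ that is a quasi-polynomial (given by a polynomial in $b_1,\dots,b_n$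 on each parity class of $(b_1,\dots,b_n)$) such that near $z_1=\dots=z_n=0$ $$\omega^g_n(z_1,\dots,z_n)=\frac{d}{dz_1}\cdots\frac{d}{dz_n}\sum_{b_i>0}N^g_n(b_1,\dots,b_n)\,z_1^{b_1}\cdots z_n^{b_n}\,dz_1\cdots dz_n .$$ For all $g\ge 0$, $n\ge1$ with $2g-2+n>0$ and all integers $b_1,\dots,b_n\ge0$, these quasi-polynomials satisfy the following, where $N^g_n(b)|_{b_j=k}$ denotes the value with $b_j$ replaced by $k$: $$N^g_{n+1}(m,b_1,\dots,b_n)=\sum_{j=1}^n\ \sum_{\substack{1\le k\le b_j\\ k\not\equiv b_j\ (2)}}k\,N^g_n(b_1,\dots,b_n)|_{b_j=k},$$ $$(m+1)N^g_{n+1}(m+1,b_1,\dots,b_n)+(m-1)N^g_{n+1}(m-1,b_1,\dots,b_n)=2m\sum_{j=1}^n\ \sum_{\substack{1\le k\le b_j\\ k\equiv b_j\ (2)}}k\,N^g_n(b_1,\dots,b_n)|_{b_j=k}-m\sum_{j=1}^nb_jN^g_n(b_1,\dots,b_n),$$ $$(m-2)N^g_{n+1}(m-2,b_1,\dots,b_n)-2mN^g_{n+1}(m,b_1,\dots,b_n)+(m+2)N^g_{n+1}(m+2,b_1,\dots,b_n)=m\sum_{j=1}^n\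 \sum_{k=1\pm b_j}k\,N^g_n(b_1,\dots,b_n)|_{b_j=k},$$ where the last inner sum consists of the two terms $k=1+b_j$ and $k=1-b_j$ (also when $b_j=0$), and $$N^g_{n+1}(m+1,b_1,\dots,b_n)-N^g_{n+1}(m-1,b_1,\dots,b_n)=m(2g-2+n)N^g_n(b_1,\dots,b_n).$$ -/

import Mathlib

noncomputable section

namespace EynardOrantin

/-- The residue at an isolated singularity `a` of the 1-form `f(w) dw`: the limit (in fact the
eventual value) of `(2πi)⁻¹ ∮_{|w-a|=r} f(w) dw` as the radius `r > 0` shrinks to `0`. -/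
def residue (f : ℂ → ℂ) (a : ℂ) : ℂ :=
  Filter.limUnder (nhdsWithin (0 : ℝ) (Set.Ioi 0)) fun r : ℝ =>
    (2 * (Real.pi : ℂ) * Complex.I)⁻¹ * ∮ w in C(a, r), f w

/-- The meromorphic function `x(z) = z + 1/z`; its branch points are `z = 1` and `z = -1`,
and its local involution is `z ↦ 1/z`. -/
def xfun (z : ℂ) : ℂ := z + z⁻¹

/-- The density `x'(z)` of `dx = x'(z) dz`. -/
def dx (z : ℂ) : ℂ := 1 - (z ^ 2)⁻¹

/-- The function `dx` is indeed the derivative of `x(z) = z + 1/z`. -/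
theorem hasDerivAt_xfun {z : ℂ} (hz : z ≠ 0) : HasDerivAt xfun (dx z) z := by
  have h := (hasDerivAt_id z).add (hasDerivAt_inv hz)
  rw [← sub_eq_add_neg] at h
  exact h

/-- The density of the Bergmann kernel `B(z, w) = dz dw / (z - w)²` of the Riemann sphere. -/
def bergmann (z w : ℂ) : ℂ := ((z - w) ^ 2)⁻¹

/-- A primitive of `w ↦ B(z₀, w)`. -/
def bergmannPrimitive (z₀ w : ℂ) : ℂ := (z₀ - w)⁻¹

/-- The function `bergmannPrimitive z₀` is indeed a primitive of `B(z₀, ·)`. -/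
theorem hasDerivAt_bergmannPrimitive {z₀ w : ℂ} (h : z₀ ≠ w) :
    HasDerivAt (bergmannPrimitive z₀) (bergmann z₀ w) w := by
  have h1 : HasDerivAt (fun w : ℂ => z₀ - w) (-1) w := by
    simpa using (hasDerivAt_id w).const_sub z₀
  have h2 := h1.inv (sub_ne_zero.mpr h)
  rw [neg_neg, one_div] at h2
  exact h2

/-- The density (of `dz₀ / dw`) of the recursion kernel
`K(z₀, w) = - ∫_{ŵ}^{w} B(z₀, ·) / (2 (y(w) - y(ŵ)) dx(w))`, where `ŵ = 1/w`. -/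
def kernel (y : ℂ → ℂ) (z₀ w : ℂ) : ℂ :=
  -(bergmannPrimitive z₀ w - bergmannPrimitive z₀ w⁻¹) / (2 * (y w - y w⁻¹) * dx w)

/-- The restriction `z_I` of a tuple `z = (z_1, …, z_n)` to a subset `I` of the indices,
listed in increasing order. -/
def restrict {n : ℕ} (z : Fin n → ℂ) (I : Finset (Fin n)) : Fin I.card → ℂ :=
  fun i => z (I.orderEmbOfFin rfl i)

/-- The Eynard-Orantin invariants of the plane curve `x = z + 1/z`, `y = y(z)`:
`omegaForm y g n (z_1, …, z_n)` is the density of the multidifferential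
`ω^g_n(z_1, …, z_n)` with respect to `dz_1 ⋯ dz_n`.

`ω^0_1 = y dx`, `ω^0_2 = B`, and for `2g - 2 + (n + 1) > 0`
`ω^g_{n+1}(z_0, z_S) = ∑_{α = ±1} Res_{w = α} K(z_0, w) [ω^{g-1}_{n+2}(w, ŵ, z_S)`
`  + ∑ ω^{g₁}_{|I|+1}(w, z_I) ω^{g₂}_{|J|+1}(ŵ, z_J)]`,
the inner sum being over `g₁ + g₂ = g` and `I ⊔ J = S` without the terms that contain `ω^0_1`.
The factor `-(w^2)⁻¹` comes from `dŵ = -dw / w²`.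
The value at `n = 0` is a placeholder that is never used. -/
def omegaForm (y : ℂ → ℂ) : (g n : ℕ) → (Fin n → ℂ) → ℂ
  | _, 0, _ => 0
  | g, n + 1, z =>
    if g = 0 ∧ n = 0 then y (z 0) * dx (z 0)
    else if h2 : g = 0 ∧ n = 1 then bergmann (z 0) (z ⟨1, by omega⟩)
    else
      ∑ α ∈ ({1, -1} : Finset ℂ), residue (fun w =>
        kernel y (z 0) w * (-(w ^ 2)⁻¹) *
          ((if _hg : 0 < g then
              omegaForm y (g - 1) (n + 2) (Fin.cons w (Fin.cons w⁻¹ (Fin.tail z)))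
            else 0) +
            ∑ g₁ : Fin (g + 1), ∑ I : Finset (Fin n),
              if _h : ¬ ((g₁ : ℕ) = 0 ∧ I.card = 0) ∧ ¬ (g - (g₁ : ℕ) = 0 ∧ Iᶜ.card = 0) then
                omegaForm y g₁ (I.card + 1) (Fin.cons w (restrict (Fin.tail z) I)) *
                omegaForm y (g - (g₁ : ℕ)) (Iᶜ.card + 1)
                  (Fin.cons w⁻¹ (restrict (Fin.tail z) Iᶜ))
              else 0)) α
termination_by g n => 2 * g + n
decreasing_by
  · omega
  · have h1 := g₁.isLt
    have h2 : I.card + Iᶜ.card = n := by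
      simp
    omega
  · have h1 := g₁.isLt
    have h2 : I.card + Iᶜ.card = n := by
      simp
    omega

/-- A function on `ℤⁿ` is a quasi-polynomial (depending on parity) if on each parity class of
`(b_1, …, b_n)` it is given by a polynomial in `b_1, …, b_n`. -/
def IsQuasiPolynomial {n : ℕ} (N : (Fin n → ℤ) → ℂ) : Prop :=
  ∃ P : (Fin n → ZMod 2) → MvPolynomial (Fin n) ℂ,
    ∀ b : Fin n → ℤ,
      N b = MvPolynomial.eval (fun i => (b i : ℂ)) (P fun i => (b i : ZMod 2))

/-- `N` is the quasi-polynomial `N^g_n` of the curve `x = z + 1/z`, `y = y(z)`: near `z = 0`,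
`ω^g_n(z_1, …, z_n) = ∑_{b_i > 0} N(b_1, …, b_n) ∏ b_i z_i^{b_i - 1} dz_1 ⋯ dz_n`.
The summation index below is `b_i - 1`. -/
def IsInvariantQuasiPolynomial (y : ℂ → ℂ) (g n : ℕ) (N : (Fin n → ℤ) → ℂ) : Prop :=
  IsQuasiPolynomial N ∧
    ∀ᶠ z in nhds (0 : Fin n → ℂ),
      HasSum (fun c : Fin n → ℕ =>
        N (fun i => (c i : ℤ) + 1) * ∏ i, (((c i : ℂ) + 1) * z i ^ c i)) (omegaForm y g n z)

/-- The function `y(z) = z^m / m`. -/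
def ymon (m : ℕ) (z : ℂ) : ℂ := z ^ m / (m : ℂ)

end EynardOrantin

end

/-! ### Differential operators on polynomials in the times. -/

noncomputable section

namespace EynardOrantin

open MvPolynomial

/-! All invariants are packed into one generating function, and the four identities come from linear
equations that it satisfies. In the coordinate `w = β e^s` at a branch point `β` the involution is
`s ↦ -s`, so a form that is odd under it has, relative to `ds = dw / w`, a density that is a Laurent
series in `x = s ^ 2`. The forms `bVec · (α, k)`, the even Taylor coefficients at `α` of the
Bergmann kernel, serve as a basis; `eL β i` is the expansion at `β` of the `i`-th one. A variable `X
i` is attached to each index.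

Existence of the generating function. The operators `vir corr α j` are the coefficients of `x ^
(-j)`, `j ≥ 0`, in the normally ordered square of a free field with two-point function `corr`. They
satisfy Virasoro relations (`vir_comm`), and these are the integrability conditions of the system `D
Z (n + 1) = vir c α j (Z n)`, where `D` is the derivative along `dvec V α j` and `V` expands `(y(w)
- y(1/w)) (w - 1/w) / s ^ 2`. A Poincaré lemma solves the system (`exists_partition_function`), and
`F = log Z` satisfies a quadratic recursion (`exists_isFreeEnergy`). A residue against the kernel
only sees the coefficients of `x ^ (-j)` with `j ≥ 0` of the bracket (`residue_kernel`), so this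
recursion is the topological recursion: `ω^g_n` at `z` is the derivative of `F (2g - 2 + n)` at the
origin along the directions `bVec (z i)` (`jetFormula`). Near `z = 0` one has `bVec z = ∑ b z^(b-1)
sVec b`, where `sVec b` lists the coefficients of `α ^ b cosh (b s)`. Hence `N(b_1, …, b_n)` is the
derivative along `sVec b_1, …, sVec b_n`, which is visibly quasi-polynomial.

String equations. The recursion relations are added up with weights that compute the sum over both
branch points of residues against `(w^a + w^(-a)) / (w - 1/w)`. For `a ≤ 2` this weight times two
basis forms has no pole away from `±1`, so by the residue theorem the second order and quadratic
terms cancel (`sum_hypS_eL_mul_eL`). The residue theorem itself is proved algebraically, by partial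
fractions in `psiL` (`Glob.sum_coeff`). On the left the directions `sVec (m ± a)` remain, on the
right the sums `hypRes (b ± a)`, and `hypRes (b + 1) - hypRes (b - 1) = b sVec b` turns these into
the sums over `k`. The values `a = 0` and `a = 1` give the first two identities, and `a = 2` minus
`a = 0` the third.

Dilaton equation. By homogeneity of the recursion, the derivative along `dilVec V`, the coefficients
of `x V / 2`, sends `F (n + 1)` to `n F n` up to a constant (`dilaton`); for `y = z^m / m` this
direction is `(sVec (m + 1) - sVec (m - 1)) / m`. -/

/-- Indices `(α, k)` of the times: a branch point `α = ±1` and an order `k`. -/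
abbrev Idx := ℤˣ × ℕ

/-- Polynomials in the times. -/
abbrev Poly := MvPolynomial Idx ℂ

/-- The derivation with constant coefficients `d`. -/
def vecD (d : Idx → ℂ) : Derivation ℂ Poly Poly := mkDerivation ℂ fun i => C (d i)

/-- The derivation with polynomial coefficients `a`. -/
def fieldD (a : Idx → Poly) : Derivation ℂ Poly Poly := mkDerivation ℂ a

/-- The gradient of a polynomial. -/
def grad : Derivation ℂ Poly (Idx →₀ Poly) :=
  mkDerivation ℂ fun i => Finsupp.single i (1 : Poly)

/-- The second order operator `∑ M i j ∂ᵢ ∂ⱼ`. -/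
def lap (M : Idx → Idx → ℂ) : Poly →ₗ[ℂ] Poly :=
  (Finsupp.lsum ℂ fun i => (vecD (M i) : Poly →ₗ[ℂ] Poly)) ∘ₗ (grad : Poly →ₗ[ℂ] (Idx →₀ Poly))

/-- The bilinear form `∑ M i j ∂ᵢ p ∂ⱼ q`. -/
def gam (M : Idx → Idx → ℂ) (p q : Poly) : Poly :=
  (grad p).sum fun i r => r * vecD (M i) q

@[simp] theorem vecD_X (d : Idx → ℂ) (i : Idx) : vecD d (X i) = C (d i) := mkDerivation_X _ _ _

@[simp] theorem fieldD_X (a : Idx → Poly) (i : Idx) : fieldD a (X i) = a i := mkDerivation_X _ _ _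

@[simp] theorem grad_X (i : Idx) : grad (X i) = Finsupp.single i 1 := mkDerivation_X _ _ _

@[simp] theorem vecD_C (d : Idx → ℂ) (a : ℂ) : vecD d (C a) = 0 := derivation_C _ _

theorem vecD_C_mul (d : Idx → ℂ) (a : ℂ) (p : Poly) : vecD d (C a * p) = C a * vecD d p := by
  simp [Derivation.leibniz]

theorem pderiv_eq_vecD (i : Idx) : pderiv (R := ℂ) i = vecD (Pi.single i 1) := by
  refine derivation_ext fun j => ?_
  rw [pderiv_X, vecD_X, Pi.single_apply, Pi.single_apply]
  split_ifs <;> simp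

theorem grad_apply (p : Poly) (i : Idx) : grad p i = pderiv i p := by
  have h : ∀ i, (Finsupp.lapply (R := Poly) i).compDer grad = pderiv (R := ℂ) i := by
    intro i
    refine derivation_ext fun j => ?_
    simp [pderiv_X, Finsupp.single_apply, Pi.single_apply, eq_comm]
  have := DFunLike.congr_fun (h i) p
  simpa using this

theorem vecD_add (d e : Idx → ℂ) : vecD (d + e) = vecD d + vecD e :=
  derivation_ext fun i => by simp

theorem vecD_smul (a : ℂ) (d : Idx → ℂ) : vecD (a • d) = a • vecD d :=
  derivation_ext fun i => by simp [MvPolynomial.smul_eq_C_mul]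

theorem vecD_zero : vecD 0 = 0 := derivation_ext fun i => by simp

theorem vecD_sum {τ : Type*} (s : Finset τ) (d : τ → Idx → ℂ) (p : Poly) :
    vecD (∑ t ∈ s, d t) p = ∑ t ∈ s, vecD (d t) p := by
  classical
  induction s using Finset.induction_on with
  | empty => simp [vecD_zero]
  | insert a s ha ih => rw [Finset.sum_insert ha, Finset.sum_insert ha, vecD_add]; simp [ih]

theorem vecD_comm (d e : Idx → ℂ) (p : Poly) : vecD d (vecD e p) = vecD e (vecD d p) := by
  have h : ⁅vecD d, vecD e⁆ = 0 := derivation_ext fun i => by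
    simp [Derivation.commutator_apply]
  have := DFunLike.congr_fun h p
  rw [Derivation.commutator_apply] at this
  exact sub_eq_zero.mp this

theorem pderiv_vecD (i : Idx) (d : Idx → ℂ) (p : Poly) :
    pderiv i (vecD d p) = vecD d (pderiv i p) := by
  rw [pderiv_eq_vecD, vecD_comm]

theorem fieldD_eq_sum (a : Idx → Poly) (p : Poly) (S : Finset Idx)
    (hS : ∀ i ∉ S, pderiv i p = 0) : fieldD a p = ∑ i ∈ S, a i * pderiv i p := by
  have h : ∀ p, fieldD a p = (grad p).sum fun i r => a i * r := by
    let L : (Idx →₀ Poly) →ₗ[Poly] Poly := Finsupp.lsum ℂ fun i => LinearMap.mulLeft Poly (a i)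
    have h2 : L.compDer grad = fieldD a := derivation_ext fun j => by
      simp [L]
    intro p
    rw [← h2]
    simp [L]
    rfl
  rw [h, Finsupp.sum_of_support_subset (s := S)]
  · exact Finset.sum_congr rfl fun i _ => by rw [grad_apply]
  · intro i hi
    by_contra hc
    exact (Finsupp.mem_support_iff.mp hi) (by rw [grad_apply, hS i hc])
  · simp

theorem vecD_eq_fieldD (d : Idx → ℂ) : vecD d = fieldD fun i => C (d i) := rfl

theorem vecD_eq_sum (d : Idx → ℂ) (p : Poly) (S : Finset Idx)
    (hS : ∀ i ∉ S, pderiv i p = 0) : vecD d p = ∑ i ∈ S, C (d i) * pderiv i p := by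
  rw [vecD_eq_fieldD, fieldD_eq_sum _ _ S hS]

theorem vecD_fieldD (d : Idx → ℂ) (a : Idx → Poly) (p : Poly) :
    vecD d (fieldD a p) = fieldD a (vecD d p) + fieldD (fun i => vecD d (a i)) p := by
  have h : ⁅vecD d, fieldD a⁆ = fieldD fun i => vecD d (a i) := derivation_ext fun i => by
    simp [Derivation.commutator_apply]
  have := DFunLike.congr_fun h p
  rw [Derivation.commutator_apply] at this
  rw [← this]; ring

theorem lap_eq_finsupp (M : Idx → Idx → ℂ) (p : Poly) :
    lap M p = (grad p).sum fun i r => vecD (M i) r := by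
  simp [lap]

theorem lap_eq_sum (M : Idx → Idx → ℂ) (p : Poly) (S : Finset Idx)
    (hS : ∀ i ∉ S, pderiv i p = 0) : lap M p = ∑ i ∈ S, vecD (M i) (pderiv i p) := by
  rw [lap_eq_finsupp, Finsupp.sum_of_support_subset (s := S)]
  · exact Finset.sum_congr rfl fun i _ => by rw [grad_apply]
  · intro i hi
    by_contra hc
    exact (Finsupp.mem_support_iff.mp hi) (by rw [grad_apply, hS i hc])
  · simp

theorem gam_eq_sum (M : Idx → Idx → ℂ) (p q : Poly) (S : Finset Idx)
    (hS : ∀ i ∉ S, pderiv i p = 0) : gam M p q = ∑ i ∈ S, pderiv i p * vecD (M i) q := by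
  rw [gam, Finsupp.sum_of_support_subset (s := S)]
  · exact Finset.sum_congr rfl fun i _ => by rw [grad_apply]
  · intro i hi
    by_contra hc
    exact (Finsupp.mem_support_iff.mp hi) (by rw [grad_apply, hS i hc])
  · simp

theorem pderiv_eq_zero_of_notMem {S : Finset Idx} {p : Poly} (h : p.vars ⊆ S) (i : Idx)
    (hi : i ∉ S) : pderiv i p = 0 :=
  pderiv_eq_zero_of_notMem_vars fun hc => hi (h hc)

theorem lap_double_sum (M : Idx → Idx → ℂ) (p : Poly) (S : Finset Idx)
    (hS : ∀ i ∉ S, pderiv i p = 0) :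
    lap M p = ∑ i ∈ S, ∑ j ∈ S, C (M i j) * pderiv j (pderiv i p) := by
  rw [lap_eq_sum M p S hS]
  refine Finset.sum_congr rfl fun i _ => vecD_eq_sum _ _ S fun j hj => ?_
  rw [pderiv_eq_vecD i, pderiv_vecD, hS j hj, map_zero]

theorem gam_double_sum (M : Idx → Idx → ℂ) (p q : Poly) (S : Finset Idx)
    (hp : ∀ i ∉ S, pderiv i p = 0) (hq : ∀ i ∉ S, pderiv i q = 0) :
    gam M p q = ∑ i ∈ S, ∑ j ∈ S, C (M i j) * (pderiv i p * pderiv j q) := by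
  rw [gam_eq_sum M p q S hp]
  refine Finset.sum_congr rfl fun i _ => ?_
  rw [vecD_eq_sum _ _ S hq, Finset.mul_sum]
  exact Finset.sum_congr rfl fun j _ => by ring

theorem gam_comm (M : Idx → Idx → ℂ) (hM : ∀ i j, M i j = M j i) (p q : Poly) :
    gam M p q = gam M q p := by
  classical
  have hp := pderiv_eq_zero_of_notMem (Finset.subset_union_left (s₁ := p.vars) (s₂ := q.vars))
  have hq := pderiv_eq_zero_of_notMem (Finset.subset_union_right (s₁ := p.vars) (s₂ := q.vars))
  rw [gam_double_sum M p q _ hp hq, gam_double_sum M q p _ hq hp, Finset.sum_comm]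
  refine Finset.sum_congr rfl fun i _ => Finset.sum_congr rfl fun j _ => ?_
  rw [hM]; ring

theorem lap_mul (M : Idx → Idx → ℂ) (hM : ∀ i j, M i j = M j i) (p q : Poly) :
    lap M (p * q) = p * lap M q + q * lap M p + 2 * gam M p q := by
  classical
  have hp := pderiv_eq_zero_of_notMem (Finset.subset_union_left (s₁ := p.vars) (s₂ := q.vars))
  have hq := pderiv_eq_zero_of_notMem (Finset.subset_union_right (s₁ := p.vars) (s₂ := q.vars))
  have hpq : ∀ i ∉ p.vars ∪ q.vars, pderiv i (p * q) = 0 := fun i hi => by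
    rw [pderiv_mul, hp i hi, hq i hi]; simp
  rw [two_mul]
  nth_rewrite 2 [gam_comm M hM]
  rw [lap_eq_sum M _ _ hpq, lap_eq_sum M _ _ hp, lap_eq_sum M _ _ hq, gam_eq_sum M p q _ hp,
    gam_eq_sum M q p _ hq, Finset.mul_sum, Finset.mul_sum, ← Finset.sum_add_distrib,
    ← Finset.sum_add_distrib, ← Finset.sum_add_distrib]
  refine Finset.sum_congr rfl fun i _ => ?_
  rw [pderiv_mul, map_add, Derivation.leibniz, Derivation.leibniz]
  simp only [smul_eq_mul]
  ring

theorem gam_X (M : Idx → Idx → ℂ) (i : Idx) (p : Poly) : gam M (X i) p = vecD (M i) p := by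
  simp [gam]

@[simp] theorem lap_X (M : Idx → Idx → ℂ) (i : Idx) : lap M (X i) = 0 := by
  have : vecD (M i) (1 : Poly) = 0 := Derivation.map_one_eq_zero _
  simp [lap, this]

@[simp] theorem lap_C (M : Idx → Idx → ℂ) (a : ℂ) : lap M (C a) = 0 := by
  have : grad (C a) = 0 := derivation_C _ _
  simp [lap, this]

theorem lap_X_mul (M : Idx → Idx → ℂ) (hM : ∀ i j, M i j = M j i) (i : Idx) (p : Poly) :
    lap M (X i * p) = X i * lap M p + 2 * vecD (M i) p := by
  rw [lap_mul M hM, lap_X, gam_X]; ring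

theorem vecD_lap (M : Idx → Idx → ℂ) (d : Idx → ℂ) (p : Poly) :
    vecD d (lap M p) = lap M (vecD d p) := by
  have hS := pderiv_eq_zero_of_notMem (Finset.Subset.refl p.vars)
  rw [lap_eq_sum M p _ hS, lap_eq_sum M (vecD d p) p.vars fun i hi => by
    rw [pderiv_vecD, hS i hi, map_zero], map_sum]
  exact Finset.sum_congr rfl fun i _ => by rw [vecD_comm, pderiv_vecD]

theorem vecD_gam (M : Idx → Idx → ℂ) (d : Idx → ℂ) (p q : Poly) :
    vecD d (gam M p q) = gam M (vecD d p) q + gam M p (vecD d q) := by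
  have hS := pderiv_eq_zero_of_notMem (Finset.Subset.refl p.vars)
  rw [gam_eq_sum M p q _ hS, gam_eq_sum M p _ _ hS, gam_eq_sum M (vecD d p) q p.vars fun i hi => by
    rw [pderiv_vecD, hS i hi, map_zero], map_sum, ← Finset.sum_add_distrib]
  refine Finset.sum_congr rfl fun i _ => ?_
  rw [Derivation.leibniz, pderiv_vecD, vecD_comm (M i) d]
  simp only [smul_eq_mul]
  ring

theorem eq_C_of_pderiv_eq_zero (p : Poly) (h : ∀ i, pderiv i p = 0) :
    p = C (constantCoeff p) := by
  classical
  ext m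
  rw [coeff_C]
  split_ifs with hm
  · rw [← hm, constantCoeff_eq]
  · obtain ⟨i, hi⟩ : ∃ i, m i ≠ 0 := by
      by_contra! hc
      exact hm (Finsupp.ext fun i => (hc i).symm)
    have h1 := coeff_pderiv (i := i) p (m - Finsupp.single i 1)
    rw [h i, coeff_zero] at h1
    have h2 : m - Finsupp.single i 1 + Finsupp.single i 1 = m :=
      tsub_add_cancel_of_le (by
        intro j
        rw [Finsupp.single_apply]
        split_ifs with hj
        · subst hj; omega
        · omega)
    rw [h2] at h1
    rcases mul_eq_zero.mp h1.symm with h3 | h3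
    · exact h3
    · exact absurd h3 (Nat.cast_add_one_ne_zero _)

end EynardOrantin

end

/-! ### The free field, its Virasoro operators and their commutation relations. -/

noncomputable section

namespace EynardOrantin

open MvPolynomial

/-- The coefficient of `x ^ n` at the branch point `α` of the basic odd forms. -/
def modeVec (c : Idx → Idx → ℂ) (α : ℤˣ) : ℤ → Idx → ℂ
  | .ofNat n => c (α, n)
  | .negSucc k => Pi.single (α, k) (2 * (k : ℂ) + 1)

/-- The coefficient of `x ^ n` at the branch point `α` of the tautological field. -/
def modeLin (α : ℤˣ) : ℤ → Poly
  | .ofNat n => X (α, n)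
  | .negSucc _ => 0

/-- The modes of the free field. -/
def modeJ (c : Idx → Idx → ℂ) (α : ℤˣ) (n : ℤ) : Poly →ₗ[ℂ] Poly :=
  LinearMap.mulLeft ℂ (modeLin α n) + (vecD (modeVec c α n) : Poly →ₗ[ℂ] Poly)

/-- The multiplication part of the Virasoro operator. -/
def virQuad (α : ℤˣ) (j : ℕ) : Poly := if j = 0 then X (α, 0) ^ 2 else 0

/-- The constant part of the Virasoro operator. -/
def virConst (c : Idx → Idx → ℂ) (α : ℤˣ) (j : ℕ) : ℂ :=
  if j = 0 then c (α, 0) (α, 0) else if j = 1 then 1 / 4 else 0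

/-- The first order part of the Virasoro operator. -/
def virField (c : Idx → Idx → ℂ) (α : ℤˣ) (j : ℕ) (i : Idx) : Poly :=
  ∑ m ∈ Finset.range (i.2 + 2), C (2 * modeVec c α (-j - m) i) * X (α, m)

/-- The second order part of the Virasoro operator. -/
def virMat (c : Idx → Idx → ℂ) (α : ℤˣ) (j : ℕ) (i i' : Idx) : ℂ :=
  (if i.1 = α then (2 * (i.2 : ℂ) + 1) * modeVec c α (i.2 + 1 - j) i' else 0) +
    ∑ ν ∈ Finset.range (i'.2 + 2), c i (α, ν) * modeVec c α (-j - ν) i'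

/-- The Virasoro operator: the coefficient of `x ^ (-j)` in the normally ordered square of the
free field at `α`. -/
def vir (c : Idx → Idx → ℂ) (α : ℤˣ) (j : ℕ) : Poly →ₗ[ℂ] Poly :=
  LinearMap.mulLeft ℂ (virQuad α j + C (virConst c α j)) +
    (fieldD (virField c α j) : Poly →ₗ[ℂ] Poly) + lap (virMat c α j)

theorem vir_apply (c : Idx → Idx → ℂ) (α : ℤˣ) (j : ℕ) (p : Poly) :
    vir c α j p = (virQuad α j + C (virConst c α j)) * p + fieldD (virField c α j) p +
      lap (virMat c α j) p := rfl

theorem modeJ_apply (c : Idx → Idx → ℂ) (α : ℤˣ) (n : ℤ) (p : Poly) :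
    modeJ c α n p = modeLin α n * p + vecD (modeVec c α n) p := rfl

theorem modeVec_of_neg (c : Idx → Idx → ℂ) (α : ℤˣ) (n : ℤ) (hn : n < 0) (i : Idx) :
    modeVec c α n i = if i.1 = α ∧ (i.2 : ℤ) + 1 = -n then 2 * (i.2 : ℂ) + 1 else 0 := by
  obtain ⟨k, rfl⟩ := Int.eq_negSucc_of_lt_zero hn
  simp only [modeVec, Pi.single_apply]
  rcases i with ⟨β, l⟩
  by_cases h : l = k
  · subst h
    simp [Int.negSucc_eq, Prod.ext_iff]
  · rw [if_neg, if_neg]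
    · rw [Int.negSucc_eq]; rintro ⟨_, h2⟩; apply h; simp at h2; exact_mod_cast h2
    · simp [h]

theorem modeLin_natCast (α : ℤˣ) (n : ℕ) : modeLin α n = X (α, n) := rfl

theorem modeLin_of_neg (α : ℤˣ) (n : ℤ) (hn : n < 0) : modeLin α n = 0 := by
  obtain ⟨k, rfl⟩ := Int.eq_negSucc_of_lt_zero hn
  rfl

theorem modeVec_neg_sub (c : Idx → Idx → ℂ) (α : ℤˣ) (j m : ℕ) (i : Idx) :
    modeVec c α (-j - m) i = if j = 0 ∧ m = 0 then c (α, 0) i else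
      if i.1 = α ∧ i.2 + 1 = j + m then 2 * (i.2 : ℂ) + 1 else 0 := by
  split_ifs with h1 h2
  · obtain ⟨rfl, rfl⟩ := h1
    rfl
  · rw [modeVec_of_neg _ _ _ (by omega), if_pos ⟨h2.1, by omega⟩]
  · rw [modeVec_of_neg _ _ _ (by omega), if_neg]
    rintro ⟨h3, h4⟩
    exact h2 ⟨h3, by omega⟩

theorem modeVec_sub_natCast (c : Idx → Idx → ℂ) (α : ℤˣ) (n j : ℕ) (i : Idx) :
    modeVec c α (n - j) i = if j ≤ n then c (α, n - j) i else
      if i.1 = α ∧ i.2 + 1 + n = j then 2 * (i.2 : ℂ) + 1 else 0 := by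
  split_ifs with h1 h2
  · rw [show (n : ℤ) - j = ((n - j : ℕ) : ℤ) by omega]
    rfl
  · rw [modeVec_of_neg _ _ _ (by omega), if_pos ⟨h2.1, by omega⟩]
  · rw [modeVec_of_neg _ _ _ (by omega), if_neg]
    rintro ⟨h3, h4⟩
    exact h2 ⟨h3, by omega⟩

/-- A negative mode is a multiple of a single partial derivative, so only `m = i.2 + 1 - j`
survives, apart from the mode of index `0`, which occurs only for `j = m = 0`. -/
theorem sum_mul_modeVec_neg_sub (c : Idx → Idx → ℂ) (α : ℤˣ) (j : ℕ) (i : Idx) {A : Type*}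
    [CommRing A] [Algebra ℂ A] (f : ℕ → A) :
    ∑ m ∈ Finset.range (i.2 + 2), modeVec c α (-j - m) i • f m =
      (if j = 0 then c (α, 0) i • f 0 else 0) +
      if i.1 = α ∧ j ≤ i.2 + 1 then (2 * (i.2 : ℂ) + 1) • f (i.2 + 1 - j) else 0 := by
  have h : ∀ m ∈ Finset.range (i.2 + 2), modeVec c α (-j - m) i • f m =
      (if m = 0 then if j = 0 then c (α, 0) i • f 0 else 0 else 0) +
      if m = i.2 + 1 - j then
        (if i.1 = α ∧ j ≤ i.2 + 1 then (2 * (i.2 : ℂ) + 1) • f (i.2 + 1 - j) else 0) else 0 := by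
    intro m hm
    rw [modeVec_neg_sub]
    by_cases h1 : j = 0 ∧ m = 0
    · obtain ⟨rfl, rfl⟩ := h1
      simp
    · rw [if_neg h1]
      by_cases h2 : i.1 = α ∧ i.2 + 1 = j + m
      · have h3 : m = i.2 + 1 - j := by omega
        rw [if_pos h2, if_pos h3, if_pos (show i.1 = α ∧ j ≤ i.2 + 1 from ⟨h2.1, by omega⟩),
          ← ite_and, if_neg (fun h => h1 ⟨h.2, h.1⟩), zero_add, h3]
      · rw [if_neg h2, zero_smul]
        have : ¬ (m = i.2 + 1 - j ∧ i.1 = α ∧ j ≤ i.2 + 1) := by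
          rintro ⟨h3, h4, h5⟩
          exact h2 ⟨h4, by omega⟩
        rw [← ite_and, ← ite_and, if_neg this, if_neg (fun h => h1 ⟨h.2, h.1⟩), add_zero]
  rw [Finset.sum_congr rfl h, Finset.sum_add_distrib, Finset.sum_ite_eq', Finset.sum_ite_eq',
    if_pos (by simp), if_pos (show i.2 + 1 - j ∈ Finset.range (i.2 + 2) by
      rw [Finset.mem_range]; omega)]

/-- The definition treats the first index separately. Expanding each factor into a singular and a
regular part gives two mixed terms that are exchanged by swapping the indices, and two symmetric
ones. -/
theorem virMat_symm (c : Idx → Idx → ℂ) (hc : ∀ i j, c i j = c j i) (α : ℤˣ) (j : ℕ) (i i' : Idx) :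
    virMat c α j i i' = virMat c α j i' i := by
  have key : ∀ i i' : Idx, virMat c α j i i' =
      (if i.1 = α ∧ j ≤ i.2 + 1 then (2 * (i.2 : ℂ) + 1) * c (α, i.2 + 1 - j) i' else 0) +
      (if i'.1 = α ∧ j ≤ i'.2 + 1 then (2 * (i'.2 : ℂ) + 1) * c (α, i'.2 + 1 - j) i else 0) +
      (if j = 0 then c i (α, 0) * c i' (α, 0) else 0) +
      if i.1 = α ∧ i'.1 = α ∧ i'.2 + i.2 + 2 = j then (2 * (i.2 : ℂ) + 1) * (2 * i'.2 + 1)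
        else 0 := by
    intro i i'
    have h1 := sum_mul_modeVec_neg_sub c α j i' (fun ν => c i (α, ν))
    simp only [smul_eq_mul] at h1
    rw [virMat, Finset.sum_congr rfl fun ν _ => mul_comm _ _, h1]
    have h2 : modeVec c α ((i.2 : ℤ) + 1 - j) i' = if j ≤ i.2 + 1 then c (α, i.2 + 1 - j) i' else
        if i'.1 = α ∧ i'.2 + 1 + (i.2 + 1) = j then 2 * (i'.2 : ℂ) + 1 else 0 := by
      rw [← modeVec_sub_natCast]; push_cast; rfl
    rw [h2, hc i (α, i'.2 + 1 - j), hc (α, 0) i', mul_comm (c i' (α, 0))]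
    by_cases h3 : i.1 = α
    · by_cases h4 : j ≤ i.2 + 1
      · rw [if_pos h3, if_pos h4, if_pos (⟨h3, h4⟩ : i.1 = α ∧ j ≤ i.2 + 1),
          if_neg (show ¬ (i.1 = α ∧ i'.1 = α ∧ i'.2 + i.2 + 2 = j) by omega)]
        ring
      · rw [if_pos h3, if_neg h4, if_neg (show ¬ (i.1 = α ∧ j ≤ i.2 + 1) from fun h => h4 h.2)]
        by_cases h5 : i'.1 = α ∧ i'.2 + 1 + (i.2 + 1) = j
        · rw [if_pos h5, if_pos (show i.1 = α ∧ i'.1 = α ∧ i'.2 + i.2 + 2 = j from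
            ⟨h3, h5.1, by omega⟩)]
          ring
        · rw [if_neg h5, if_neg (show ¬ (i.1 = α ∧ i'.1 = α ∧ i'.2 + i.2 + 2 = j) from
            fun h => h5 ⟨h.2.1, by omega⟩)]
          ring
    · rw [if_neg h3, if_neg (show ¬ (i.1 = α ∧ j ≤ i.2 + 1) from fun h => h3 h.1),
        if_neg (show ¬ (i.1 = α ∧ i'.1 = α ∧ i'.2 + i.2 + 2 = j) from fun h => h3 h.1)]
      ring
  have h5 : (i.1 = α ∧ i'.1 = α ∧ i'.2 + i.2 + 2 = j) ↔
      (i'.1 = α ∧ i.1 = α ∧ i.2 + i'.2 + 2 = j) := by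
    rw [add_comm i.2 i'.2]; tauto
  rw [key, key]
  simp only [h5, mul_comm (c i (α, 0)), mul_comm (2 * (i.2 : ℂ) + 1) (2 * (i'.2 : ℂ) + 1)]
  ring

theorem vir_X_mul (c : Idx → Idx → ℂ) (hc : ∀ i j, c i j = c j i) (α : ℤˣ) (j : ℕ) (i : Idx)
    (p : Poly) : vir c α j (X i * p) = X i * vir c α j p + virField c α j i * p +
      2 * vecD (virMat c α j i) p := by
  rw [vir_apply, vir_apply, lap_X_mul _ (virMat_symm c hc α j), Derivation.leibniz, fieldD_X]
  simp only [smul_eq_mul]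
  ring

theorem vecD_vir (c : Idx → Idx → ℂ) (α : ℤˣ) (j : ℕ) (d : Idx → ℂ) (p : Poly) :
    vecD d (vir c α j p) = vir c α j (vecD d p) + vecD d (virQuad α j) * p +
      fieldD (fun i => vecD d (virField c α j i)) p := by
  rw [vir_apply, vir_apply, map_add, map_add, vecD_lap, vecD_fieldD, Derivation.leibniz, map_add,
    vecD_C]
  simp only [smul_eq_mul]
  ring

theorem vecD_virField (c : Idx → Idx → ℂ) (α : ℤˣ) (j : ℕ) (d : Idx → ℂ) (i : Idx) :
    vecD d (virField c α j i) =
      C (2 * ∑ m ∈ Finset.range (i.2 + 2), d (α, m) * modeVec c α (-j - m) i) := by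
  rw [virField, map_sum, Finset.mul_sum, map_sum]
  refine Finset.sum_congr rfl fun m _ => ?_
  rw [vecD_C_mul, vecD_X, ← C_mul]
  ring_nf

theorem vecD_virQuad (α : ℤˣ) (j : ℕ) (d : Idx → ℂ) :
    vecD d (virQuad α j) = if j = 0 then C (2 * d (α, 0)) * X (α, 0) else 0 := by
  rw [virQuad]
  split_ifs
  · rw [Derivation.leibniz_pow, vecD_X]
    simp only [C_mul, smul_eq_mul, nsmul_eq_mul, map_ofNat]
    push_cast
    ring
  · simp

/-- In the commutator with a nonnegative mode the contribution of `c` to the multiplication part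
cancels against the derivative of `virQuad`; what is left is the multiplication part of the mode
`i.2 + 1 - j`. -/
theorem virField_sub_quad (c : Idx → Idx → ℂ) (hc : ∀ i j, c i j = c j i) (α : ℤˣ) (j : ℕ)
    (i : Idx) :
    virField c α j i - vecD (c i) (virQuad α j) =
      if i.1 = α then C (2 * (2 * (i.2 : ℂ) + 1)) * modeLin α (i.2 + 1 - j) else 0 := by
  have h := sum_mul_modeVec_neg_sub c α j i (fun m => (2 : Poly) * X (α, m))
  have h1 : virField c α j i = ∑ m ∈ Finset.range (i.2 + 2),
      modeVec c α (-j - m) i • ((2 : Poly) * X (α, m)) := by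
    refine Finset.sum_congr rfl fun m _ => ?_
    rw [smul_eq_C_mul, C_mul, map_ofNat]; ring
  rw [h1, h, vecD_virQuad, hc i]
  have h2 : (c (α, 0) i • ((2 : Poly) * X (α, 0))) = C (2 * c (α, 0) i) * X (α, 0) := by
    rw [smul_eq_C_mul, C_mul, map_ofNat]; ring
  rw [h2, add_sub_cancel_left]
  by_cases h3 : i.1 = α
  · by_cases h4 : j ≤ i.2 + 1
    · rw [if_pos ⟨h3, h4⟩, if_pos h3, smul_eq_C_mul,
        show (i.2 : ℤ) + 1 - j = ((i.2 + 1 - j : ℕ) : ℤ) by omega, modeLin_natCast, C_mul, map_ofNat]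
      ring
    · rw [if_neg (fun h => h4 h.2), if_pos h3, modeLin_of_neg _ _ (by omega), mul_zero]
  · rw [if_neg (fun h => h3 h.1), if_neg h3]

/-- Modes commute up to scalars, so commuting a square of the field with one mode leaves a single
mode. The two cases reflect that negative modes have no multiplication part. -/
theorem vir_modeJ (c : Idx → Idx → ℂ) (hc : ∀ i j, c i j = c j i) (α β : ℤˣ) (j : ℕ) (n : ℤ)
    (p : Poly) :
    vir c α j (modeJ c β n p) - modeJ c β n (vir c α j p) =
      if α = β then (2 * (2 * (n : ℂ) + 1)) • modeJ c α (n + 1 - j) p else 0 := by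
  cases n with
  | ofNat n =>
    have h1 := virField_sub_quad c hc α j (β, n)
    -- The sum over `ν` in `virMat` and the derivative of `virField` both contain the contraction
    -- with `c (β, n)`, each with the factor `2`; they cancel and one mode remains.
    have h2 : 2 * vecD (virMat c α j (β, n)) p -
        fieldD (fun i => vecD (c (β, n)) (virField c α j i)) p =
        if β = α then C (2 * (2 * (n : ℂ) + 1)) * vecD (modeVec c α (n + 1 - j)) p else 0 := by
      have e1 : virMat c α j (β, n) =
          (if β = α then (2 * (n : ℂ) + 1) • modeVec c α (n + 1 - j) else 0) +
          fun i' => ∑ ν ∈ Finset.range (i'.2 + 2), c (β, n) (α, ν) * modeVec c α (-j - ν) i' := by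
        funext i'
        simp only [virMat, Pi.add_apply]
        split_ifs <;> simp
      have e2 : fieldD (fun i => vecD (c (β, n)) (virField c α j i)) = (2 : ℂ) •
          vecD fun i' => ∑ ν ∈ Finset.range (i'.2 + 2), c (β, n) (α, ν) * modeVec c α (-j - ν) i' := by
        refine derivation_ext fun i => ?_
        rw [fieldD_X, vecD_virField, Derivation.smul_apply, vecD_X, smul_eq_C_mul, C_mul]
      rw [e1, e2, vecD_add]
      split_ifs
      · rw [vecD_smul]
        simp only [Derivation.add_apply, Derivation.smul_apply, smul_eq_C_mul, C_mul, map_ofNat]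
        ring
      · rw [vecD_zero]
        simp only [Derivation.add_apply, Derivation.smul_apply, smul_eq_C_mul, map_ofNat,
          Derivation.zero_apply]
        ring
    have h3 : ∀ q, modeJ c β (Int.ofNat n) q = X (β, n) * q + vecD (c (β, n)) q := fun q => rfl
    rw [h3, h3, map_add, vir_X_mul c hc, vecD_vir]
    have h4 : vir c α j (vecD (c (β, n)) p) = vir c α j (vecD (c (β, n)) p) := rfl
    calc _ = (virField c α j (β, n) - vecD (c (β, n)) (virQuad α j)) * p +
          (2 * vecD (virMat c α j (β, n)) p -
            fieldD (fun i => vecD (c (β, n)) (virField c α j i)) p) := by ring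
      _ = _ := by
        rw [h1, h2]
        by_cases h : β = α
        · subst h
          simp only [if_true, modeJ_apply, smul_eq_C_mul, Int.ofNat_eq_natCast, Int.cast_natCast]
          ring
        · rw [if_neg h, if_neg h, if_neg (Ne.symm h)]; ring
  | negSucc k =>
    have h3 : ∀ q, modeJ c β (Int.negSucc k) q = vecD (Pi.single (β, k) (2 * (k : ℂ) + 1)) q :=
      fun q => by rw [modeJ_apply]; simp [modeLin, modeVec]
    simp only [h3]
    rw [vecD_vir, vecD_virQuad]
    have e2 : fieldD (fun i => vecD (Pi.single (β, k) (2 * (k : ℂ) + 1)) (virField c α j i)) p =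
        if α = β then C (2 * (2 * (k : ℂ) + 1)) * vecD (modeVec c α (-j - k)) p else 0 := by
      have : fieldD (fun i => vecD (Pi.single (β, k) (2 * (k : ℂ) + 1)) (virField c α j i)) =
          if α = β then (2 * (2 * (k : ℂ) + 1)) • vecD (modeVec c α (-j - k)) else 0 := by
        refine derivation_ext fun i => ?_
        rw [fieldD_X, vecD_virField]
        by_cases h : α = β
        · subst h
          rw [if_pos rfl, Derivation.smul_apply, vecD_X, smul_eq_C_mul, ← C_mul]
          congr 1
          simp only [Pi.single_apply, Prod.mk.injEq, true_and, ite_mul, zero_mul,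
            Finset.sum_ite_eq', Finset.mem_range]
          split_ifs with h5
          · ring
          · rw [modeVec_neg_sub, if_neg (by omega), if_neg (by omega)]; simp
        · rw [if_neg h]
          simp [h]
      rw [this]
      split_ifs
      · rw [Derivation.smul_apply, smul_eq_C_mul]
      · rfl
    rw [e2]
    by_cases h : α = β
    · subst h
      have h6 : Int.negSucc k + 1 - j = -j - k := by rw [Int.negSucc_eq]; ring
      rw [if_pos rfl, if_pos rfl, h6, modeJ_apply]
      have h7 : (if j = 0 then C (2 * (Pi.single (α, k) (2 * (k : ℂ) + 1) : Idx → ℂ) (α, 0)) *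
          (X (α, 0) : Poly) else 0) = C (2 * (2 * (k : ℂ) + 1)) * modeLin α (-j - k) := by
        by_cases h8 : j = 0 ∧ k = 0
        · obtain ⟨rfl, rfl⟩ := h8
          rw [if_pos rfl, show (-((0 : ℕ) : ℤ) - ((0 : ℕ) : ℤ)) = ((0 : ℕ) : ℤ) by simp,
            modeLin_natCast, Pi.single_eq_same]
        · rw [modeLin_of_neg _ _ (by omega), mul_zero]
          simp only [ite_eq_right_iff]
          intro h9
          have h10 : ((α, 0) : Idx) ≠ (α, k) := fun h => h8 ⟨h9, (congrArg Prod.snd h).symm⟩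
          rw [Pi.single_eq_of_ne h10]
          simp
      rw [h7, smul_eq_C_mul, show (2 * (2 * ((Int.negSucc k : ℤ) : ℂ) + 1)) =
        -(2 * (2 * (k : ℂ) + 1)) by rw [Int.negSucc_eq]; push_cast; ring, C_neg]
      ring
    · rw [if_neg h, if_neg h, Pi.single_apply,
        if_neg (show ¬ ((α, 0) : Idx) = (β, k) from fun h' => h (congrArg Prod.fst h'))]
      simp

theorem modeJ_negSucc (c : Idx → Idx → ℂ) (β : ℤˣ) (k : ℕ) (q : Poly) :
    modeJ c β (Int.negSucc k) q = C (2 * (k : ℂ) + 1) * pderiv (β, k) q := by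
  have : (Pi.single (β, k) (2 * (k : ℂ) + 1) : Idx → ℂ) = (2 * (k : ℂ) + 1) • Pi.single (β, k) 1 := by
    rw [← Pi.single_smul, smul_eq_mul, mul_one]
  rw [modeJ_apply, pderiv_eq_vecD]
  simp only [modeLin, modeVec, this, vecD_smul]
  simp [smul_eq_C_mul]

theorem two_mul_add_one_ne_zero (k : ℕ) : 2 * (k : ℂ) + 1 ≠ 0 := by
  have := Nat.cast_add_one_ne_zero (R := ℂ) (2 * k)
  simpa using this

/-- An operator that commutes with all modes of the free field is a scalar. -/
theorem eq_scalar_of_commute_modeJ (c : Idx → Idx → ℂ) (A : Poly →ₗ[ℂ] Poly)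
    (hA : ∀ β n p, A (modeJ c β n p) = modeJ c β n (A p)) (p : Poly) :
    A p = C (constantCoeff (A 1)) * p := by
  have h1 : ∀ i p, A (pderiv i p) = pderiv i (A p) := by
    rintro ⟨β, k⟩ p
    have := hA β (Int.negSucc k) p
    rw [modeJ_negSucc, modeJ_negSucc, ← smul_eq_C_mul, ← smul_eq_C_mul, map_smul] at this
    exact smul_right_injective _ (two_mul_add_one_ne_zero k) this
  have h2 : ∀ d p, A (vecD d p) = vecD d (A p) := by
    intro d p
    have hS := pderiv_eq_zero_of_notMem (Finset.Subset.refl p.vars)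
    rw [vecD_eq_sum d p _ hS, vecD_eq_sum d (A p) p.vars fun i hi => by
      rw [← h1, hS i hi, map_zero], map_sum]
    refine Finset.sum_congr rfl fun i _ => ?_
    rw [← h1, ← smul_eq_C_mul, ← smul_eq_C_mul, map_smul]
  -- Multiplication by a variable is a nonnegative mode minus a derivative, and derivatives are
  -- already known to commute with `A`. So `A` is multiplication by `A 1`, whose gradient vanishes.
  have h3 : ∀ i p, A (X i * p) = X i * A p := by
    rintro ⟨β, n⟩ p
    have := hA β n p
    rw [modeJ_apply, modeJ_apply, map_add, h2] at this
    exact add_right_cancel this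
  have h4 : ∀ p, A p = p * A 1 := by
    intro p
    induction p using MvPolynomial.induction_on with
    | C a => rw [show (C a : Poly) = a • 1 by rw [smul_eq_C_mul, mul_one], map_smul,
        smul_mul_assoc, one_mul]
    | add p q hp hq => rw [map_add, hp, hq, add_mul]
    | mul_X p i hp => rw [mul_comm, h3, hp]; ring
  rw [h4 p, mul_comm, eq_C_of_pderiv_eq_zero (A 1) fun i => by rw [← h1, pderiv_one, map_zero]]
  simp

theorem virMat_zero_zero (c : Idx → Idx → ℂ) (hc : ∀ i j, c i j = c j i) (α β : ℤˣ) (j : ℕ) :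
    virMat c α j (β, 0) (β, 0) =
      if j = 0 then c (β, 0) (α, 0) ^ 2 + (if α = β then 2 * c (α, 1) (α, 0) else 0)
      else if α = β then (if j = 1 then 2 * c (α, 0) (α, 0) else if j = 2 then 1 else 0) else 0 := by
  have h1 := sum_mul_modeVec_neg_sub c α j (β, 0) (fun ν => c (β, 0) (α, ν))
  simp only [smul_eq_mul] at h1
  rw [virMat, Finset.sum_congr rfl fun ν _ => mul_comm _ _, h1]
  have h2 := modeVec_sub_natCast c α 1 j (β, 0)
  simp only [Nat.cast_one, zero_add, Nat.cast_zero] at h2 ⊢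
  rw [h2]
  by_cases hab : α = β
  · subst hab
    match j with
    | 0 => simp [hc (α, 0) (α, 1)]; ring
    | 1 => simp; ring
    | 2 => simp
    | (n + 3) => simp
  · simp only [hab, Ne.symm hab, if_false, false_and]
    split_ifs <;> simp [hc (α, 0) (β, 0), pow_two]

/-- The only contraction in this vacuum expectation is between the square of `X (β, 0)` on the right
and the second order part on the left; first order parts have coefficients without constant term. -/
theorem constantCoeff_vir_vir_one (c : Idx → Idx → ℂ) (hc : ∀ i j, c i j = c j i) (α β : ℤˣ)
    (i j : ℕ) : constantCoeff (vir c α i (vir c β j 1)) =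
      virConst c α i * virConst c β j + (if j = 0 then 2 * virMat c α i (β, 0) (β, 0) else 0) := by
  have h1 : vir c β j 1 = virQuad β j + C (virConst c β j) := by
    rw [vir_apply, Derivation.map_one_eq_zero, show (1 : Poly) = C 1 from C_1.symm, lap_C]
    simp
  have h2 : ∀ p, constantCoeff (fieldD (virField c α i) p) = 0 := by
    intro p
    rw [fieldD_eq_sum _ p _ (pderiv_eq_zero_of_notMem (Finset.Subset.refl p.vars)), map_sum]
    refine Finset.sum_eq_zero fun k _ => ?_
    rw [map_mul, virField, map_sum]
    simp
  rw [h1, vir_apply, map_add, map_add, h2, map_add, lap_C, add_zero, add_zero]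
  have h3 : ∀ γ j, constantCoeff (virQuad γ j) = 0 := by
    intro γ j
    rw [virQuad]; split_ifs <;> simp
  rw [map_mul, map_add, map_add, h3, h3, virQuad]
  split_ifs with h
  · rw [pow_two, lap_X_mul _ (virMat_symm c hc α i), lap_X, vecD_X, show (2 : Poly) = C 2 from (map_ofNat C 2).symm]
    simp
  · simp

/-- The vacuum expectation of the Virasoro relation at one branch point. The case `i = 2`, `j = 0`
forces the value `1 / 4` in `virConst`. -/
theorem virasoro_vacuum (x y : ℂ) (i j : ℕ) :
    ((if i = 0 then x else if i = 1 then 1 / 4 else 0) *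
        (if j = 0 then x else if j = 1 then 1 / 4 else 0) +
        (if j = 0 then 2 * (if i = 0 then y else if i = 1 then 2 * x else if i = 2 then 1 else 0)
          else 0)) -
      ((if j = 0 then x else if j = 1 then 1 / 4 else 0) *
        (if i = 0 then x else if i = 1 then 1 / 4 else 0) +
        (if i = 0 then 2 * (if j = 0 then y else if j = 1 then 2 * x else if j = 2 then 1 else 0)
          else 0)) =
      (4 * ((i : ℂ) - j)) *
        (if i + j - 1 = 0 then x else if i + j - 1 = 1 then 1 / 4 else 0) := by
  rcases i with _ | _ | _ | i <;> rcases j with _ | _ | _ | j <;> norm_num <;>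
  first
    | omega
    | ring

/-- The Virasoro relations. -/
theorem vir_comm (c : Idx → Idx → ℂ) (hc : ∀ i j, c i j = c j i) (α β : ℤˣ) (i j : ℕ) (p : Poly) :
    vir c α i (vir c β j p) - vir c β j (vir c α i p) =
      if α = β then (4 * ((i : ℂ) - j)) • vir c α (i + j - 1) p else 0 := by
  -- The defect of the relation commutes with every mode, by `vir_modeJ` and the Jacobi identity, so
  -- it is a scalar. The scalar is read off from the constant coefficient of its value at `1`.
  let A : Poly →ₗ[ℂ] Poly := vir c α i ∘ₗ vir c β j - vir c β j ∘ₗ vir c α i -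
    if α = β then (4 * ((i : ℂ) - j)) • vir c α (i + j - 1) else 0
  have hAp : ∀ p, A p = vir c α i (vir c β j p) - vir c β j (vir c α i p) -
      if α = β then (4 * ((i : ℂ) - j)) • vir c α (i + j - 1) p else 0 := by
    intro p
    simp only [A, LinearMap.sub_apply, LinearMap.comp_apply]
    split_ifs <;> simp
  have hcomm : ∀ γ n p, A (modeJ c γ n p) = modeJ c γ n (A p) := by
    intro γ n p
    have e : ∀ (δ : ℤˣ) (k : ℕ) (n : ℤ) (q : Poly), vir c δ k (modeJ c γ n q) =
        modeJ c γ n (vir c δ k q) +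
          if δ = γ then (2 * (2 * (n : ℂ) + 1)) • modeJ c δ (n + 1 - k) q else 0 := by
      intro δ k n q
      rw [← vir_modeJ c hc]; ring
    rw [hAp, hAp]
    simp only [map_sub]
    by_cases h1 : α = γ
    · subst h1
      by_cases h2 : α = β
      · subst h2
        simp only [e, if_true, map_add, map_smul]
        -- For `i = j` everything vanishes; otherwise `i + j ≥ 1` and the natural subtraction in `i
        -- + j - 1` is not truncated.
        by_cases hij : i = j
        · subst hij
          simp only [sub_self, mul_zero, zero_smul]
        have h5 : n + 1 - ((i + j - 1 : ℕ) : ℤ) = n + 1 - j + 1 - i := by omega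
        have h6 : n + 1 - (j : ℤ) + 1 - i = n + 1 - i + 1 - j := by omega
        rw [h5, h6]
        push_cast
        module
      · simp only [e, if_true, if_neg h2, if_neg (Ne.symm h2), map_smul, map_add, add_zero, sub_zero,
          map_zero]
        abel
    · by_cases h2 : β = γ
      · subst h2
        simp only [e, if_true, if_neg h1, map_smul, map_add, add_zero, sub_zero,
          map_zero]
        abel
      · simp only [e, if_neg h1, if_neg h2, add_zero]
        split_ifs with h3
        · simp only [map_smul]
        · simp
  have h := eq_scalar_of_commute_modeJ c A hcomm p
  have h0 : constantCoeff (A 1) = 0 := by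
    rw [hAp, map_sub, map_sub, constantCoeff_vir_vir_one c hc, constantCoeff_vir_vir_one c hc]
    have h1 : ∀ k, constantCoeff (vir c α k 1) = virConst c α k := by
      intro k
      rw [vir_apply, Derivation.map_one_eq_zero, show (1 : Poly) = C 1 from C_1.symm, lap_C]
      rw [virQuad]
      split_ifs <;> simp
    have h2 : constantCoeff (if α = β then (4 * ((i : ℂ) - j)) • vir c α (i + j - 1) 1 else 0) =
        if α = β then (4 * ((i : ℂ) - j)) * virConst c α (i + j - 1) else 0 := by
      split_ifs
      · rw [← h1, constantCoeff_smul, smul_eq_mul]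
      · simp
    rw [h2, virMat_zero_zero c hc, virMat_zero_zero c hc]
    by_cases hab : α = β
    · subst hab
      simp only [if_true]
      exact sub_eq_zero.mpr (virasoro_vacuum _ _ i j)
    · simp only [if_neg hab, if_neg (Ne.symm hab)]
      by_cases h3 : i = 0 <;> by_cases h4 : j = 0 <;> simp [h3, h4, hc (β, 0) (α, 0)] <;> ring
  rw [h0, C_0, zero_mul, hAp] at h
  exact sub_eq_zero.mp h

end EynardOrantin

end

/-! ### Solving the Virasoro constraints order by order. -/

noncomputable section

namespace EynardOrantin

open MvPolynomial

/-- A strict bound for the orders of the times that occur in a polynomial. -/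
def bd (p : Poly) : ℕ := p.vars.sup (fun i => i.2) + 1

theorem pderiv_eq_zero_of_bd {p : Poly} {i : Idx} (h : bd p ≤ i.2) : pderiv i p = 0 := by
  refine pderiv_eq_zero_of_notMem_vars fun hi => ?_
  have := Finset.le_sup (f := fun i : Idx => i.2) hi
  simp only [bd] at h
  omega

/-- The indices of order less than `K`. -/
def box (K : ℕ) : Finset Idx := Finset.univ ×ˢ Finset.range K

theorem mem_box {K : ℕ} {i : Idx} : i ∈ box K ↔ i.2 < K := by
  simp only [box, Finset.mem_product, Finset.mem_univ, true_and, Finset.mem_range]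

theorem pderiv_eq_zero_of_notMem_box {p : Poly} {K : ℕ} (h : bd p ≤ K) (i : Idx) (hi : i ∉ box K) :
    pderiv i p = 0 :=
  pderiv_eq_zero_of_bd (h.trans (by rw [mem_box] at hi; omega))

/-- Closed polynomial `1`-forms with finitely many nonzero components are exact. -/
theorem poincare (E : Idx → Poly) (S : Finset Idx) (hS : ∀ i ∉ S, E i = 0)
    (hE : ∀ i j, pderiv i (E j) = pderiv j (E i)) : ∃ p : Poly, ∀ i, pderiv i p = E i := by
  classical
  let q : Poly := ∑ i ∈ S, X i * E i
  -- A potential satisfies Euler's identity with `q = ∑ x_i E_i`, so it is found by dividing each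
  -- monomial of `q` by its degree. The division by zero in degree `0` is harmless because `q` has
  -- no constant term.
  let p : Poly := ∑ m ∈ q.support, monomial m (coeff m q / (m.degree : ℂ))
  have hp : ∀ m, coeff m p = coeff m q / (m.degree : ℂ) := by
    intro m
    simp only [p, coeff_sum, coeff_monomial, Finset.sum_ite_eq', mem_support_iff]
    split_ifs with h
    · rfl
    · rw [not_not.mp h, zero_div]
  refine ⟨p, fun k => ?_⟩
  ext ν
  -- Closedness, coefficient by coefficient. Summing over `i` produces the degree of `ν + e_k` on
  -- the left.
  have hk : ∀ i, ((ν + Finsupp.single k 1 : Idx →₀ ℕ) i : ℂ) * coeff ν (E k) =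
      (ν k + 1) * coeff (ν + Finsupp.single k 1) (X i * E i) := by
    intro i
    rw [coeff_X_mul']
    by_cases hi : i = k
    · subst hi
      rw [if_pos (by simp)]
      simp
    · have h1 : (ν + Finsupp.single k 1 : Idx →₀ ℕ) i = ν i := by simp [Ne.symm hi]
      rw [h1]
      split_ifs with h2
      · rw [Finsupp.mem_support_iff, h1] at h2
        have h3 : ν + Finsupp.single k 1 - Finsupp.single i 1 =
            ν - Finsupp.single i 1 + Finsupp.single k 1 := by
          ext j
          simp only [Finsupp.coe_tsub, Finsupp.coe_add, Pi.sub_apply, Pi.add_apply,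
            Finsupp.single_apply]
          by_cases h4 : i = j
          · have h5 : ¬ k = j := fun h => hi (h4.trans h.symm)
            subst h4
            simp only [if_neg h5, if_true, Nat.add_zero]
          · simp only [if_neg h4, Nat.sub_zero]
        have h4 : ν - Finsupp.single i 1 + Finsupp.single i 1 = ν := by
          ext j
          simp only [Finsupp.coe_tsub, Finsupp.coe_add, Pi.sub_apply, Pi.add_apply,
            Finsupp.single_apply]
          split_ifs with h4
          · subst h4; omega
          · omega
        have h5 := congrArg (coeff (ν - Finsupp.single i 1)) (hE i k)
        rw [coeff_pderiv, coeff_pderiv, h4, ← h3] at h5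
        have h6 : ((ν - Finsupp.single i 1 : Idx →₀ ℕ) i : ℂ) + 1 = ν i := by
          have : (ν - Finsupp.single i 1 : Idx →₀ ℕ) i + 1 = ν i := by
            simp; omega
          exact_mod_cast this
        have h7 : (ν - Finsupp.single i 1 : Idx →₀ ℕ) k = ν k := by simp [hi]
        rw [h6, h7] at h5
        linear_combination h5
      · rw [Finsupp.mem_support_iff, h1, not_not] at h2
        simp [h2]
  have hq : coeff (ν + Finsupp.single k 1) q =
      ∑ i ∈ S ∪ (ν + Finsupp.single k 1).support, coeff (ν + Finsupp.single k 1) (X i * E i) := by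
    rw [← Finset.sum_subset (Finset.subset_union_left (s₁ := S))]
    · simp only [q, coeff_sum]
    · intro i _ hi
      rw [hS i hi, mul_zero, coeff_zero]
  have hdeg : ∑ i ∈ S ∪ (ν + Finsupp.single k 1).support, ((ν + Finsupp.single k 1 : Idx →₀ ℕ) i : ℂ) =
      ((ν + Finsupp.single k 1).degree : ℂ) := by
    rw [Finsupp.degree_apply, Nat.cast_sum]
    refine (Finset.sum_subset Finset.subset_union_right ?_).symm
    intro i _ hi
    rw [Finsupp.notMem_support_iff.mp hi, Nat.cast_zero]
  have hne : ((ν + Finsupp.single k 1).degree : ℂ) ≠ 0 := by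
    rw [map_add, Finsupp.degree_single, Nat.cast_add, Nat.cast_one]
    exact Nat.cast_add_one_ne_zero _
  rw [coeff_pderiv, hp, div_mul_eq_mul_div, div_eq_iff hne, ← hdeg, hq, mul_comm, Finset.mul_sum,
    Finset.mul_sum]
  refine Finset.sum_congr rfl fun i _ => ?_
  rw [← hk, mul_comm]

/-- The vector field along which the recursion determines the free energy. -/
def dvec (V : ℤˣ → ℕ → ℂ) (α : ℤˣ) (j : ℕ) (i : Idx) : ℂ :=
  if i.1 = α ∧ j ≤ i.2 then (2 * (i.2 : ℂ) + 1) * V α (i.2 - j) else 0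

theorem sum_mul_modeVec_dvec (c : Idx → Idx → ℂ) (V : ℤˣ → ℕ → ℂ) (α β : ℤˣ) (i j : ℕ) (l : Idx) :
    ∑ m ∈ Finset.range (l.2 + 2), dvec V α i (β, m) * modeVec c β (-j - m) l =
      if β = α then (if j = 0 ∧ i = 0 then c (α, 0) l * V α 0 else 0) +
        (if l.1 = α ∧ i + j ≤ l.2 + 1 then
          (2 * (l.2 : ℂ) + 1) * ((2 * ((l.2 : ℂ) + 1 - j) + 1) * V α (l.2 + 1 - (i + j))) else 0)
      else 0 := by
  have h := sum_mul_modeVec_neg_sub c β j l (fun m => dvec V α i (β, m))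
  simp only [smul_eq_mul] at h
  rw [Finset.sum_congr rfl fun m _ => mul_comm _ _, h]
  by_cases hab : β = α
  · subst hab
    rw [if_pos rfl]
    congr 1
    · rw [ite_and]
      by_cases hi : i = 0
      · simp [hi, dvec]
      · simp [hi, dvec]
    · by_cases h1 : l.1 = β ∧ i + j ≤ l.2 + 1
      · rw [if_pos h1, if_pos ⟨h1.1, by omega⟩, dvec, if_pos ⟨rfl, by simp only; omega⟩]
        simp only
        rw [Nat.cast_sub (by omega), show l.2 + 1 - j - i = l.2 + 1 - (i + j) by omega]
        push_cast
        ring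
      · rw [if_neg h1]
        split_ifs with h2
        · rw [dvec, if_neg, mul_zero]
          rintro ⟨-, h3⟩
          simp only at h3
          exact h1 ⟨h2.1, by omega⟩
        · rfl
  · simp [hab, dvec]

/-- The derivatives along `dvec` are the linear terms that a shift of the field by `V` would add to
`vir`, so they obey the same structure constants: in `sum_mul_modeVec_dvec` the factor `2 (l + 1 -
j) + 1`, antisymmetrised in `i` and `j`, gives `2 (i - j)`. -/
theorem vecD_dvec_vir (c : Idx → Idx → ℂ) (V : ℤˣ → ℕ → ℂ) (α β : ℤˣ) (i j : ℕ) (p : Poly) :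
    vecD (dvec V α i) (vir c β j p) - vecD (dvec V β j) (vir c α i p) =
      vir c β j (vecD (dvec V α i) p) - vir c α i (vecD (dvec V β j) p) +
        if α = β then (4 * ((i : ℂ) - j)) • vecD (dvec V α (i + j - 1)) p else 0 := by
  have e : ∀ (α β : ℤˣ) (i j : ℕ), fieldD (fun l => vecD (dvec V α i) (virField c β j l)) =
      (2 : ℂ) • vecD (fun l => ∑ m ∈ Finset.range (l.2 + 2),
        dvec V α i (β, m) * modeVec c β (-j - m) l) := by
    intro α β i j
    refine derivation_ext fun l => ?_
    rw [fieldD_X, vecD_virField, Derivation.smul_apply, vecD_X, smul_eq_C_mul, C_mul]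
  rw [vecD_vir, vecD_vir, e, e, vecD_virQuad, vecD_virQuad]
  by_cases h : α = β
  · subst h
    have e3 : (fun l : Idx => ∑ m ∈ Finset.range (l.2 + 2),
          dvec V α i (α, m) * modeVec c α (-j - m) l) =
        (fun l => ∑ m ∈ Finset.range (l.2 + 2), dvec V α j (α, m) * modeVec c α (-i - m) l) +
        (2 * ((i : ℂ) - j)) • dvec V α (i + j - 1) := by
      funext l
      simp only [sum_mul_modeVec_dvec, if_true, Pi.add_apply, Pi.smul_apply, smul_eq_mul,
        add_comm j i, and_comm (a := j = 0)]
      by_cases hij : i = 0 ∧ j = 0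
      · obtain ⟨rfl, rfl⟩ := hij
        simp
      · rw [if_neg hij]
        by_cases hl : l.1 = α ∧ i + j ≤ l.2 + 1
        · rw [if_pos hl, if_pos hl, dvec, if_pos ⟨hl.1, by omega⟩,
            show l.2 - (i + j - 1) = l.2 + 1 - (i + j) by omega]
          ring
        · rw [if_neg hl, if_neg hl, dvec, if_neg]
          · ring
          · rintro ⟨h1, h2⟩
            exact hl ⟨h1, by omega⟩
    have e4 : (if j = 0 then C (2 * dvec V α i (α, 0)) * (X (α, 0) : Poly) else 0) =
        if i = 0 then C (2 * dvec V α j (α, 0)) * (X (α, 0) : Poly) else 0 := by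
      by_cases hi : i = 0 <;> by_cases hj : j = 0 <;> simp [hi, hj, dvec]
    rw [e3, e4, vecD_add, vecD_smul, if_pos rfl]
    simp only [Derivation.add_apply, Derivation.smul_apply, smul_add, smul_smul]
    rw [show (2 : ℂ) * (2 * ((i : ℂ) - j)) = 4 * ((i : ℂ) - j) by ring]
    abel
  · have e3 : ∀ (α β : ℤˣ) (i j : ℕ), α ≠ β → (fun l : Idx => ∑ m ∈ Finset.range (l.2 + 2),
          dvec V α i (β, m) * modeVec c β (-j - m) l) = 0 := by
      intro α β i j h
      funext l
      rw [sum_mul_modeVec_dvec, if_neg (Ne.symm h)]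
      rfl
    rw [e3 _ _ _ _ h, e3 _ _ _ _ (Ne.symm h), vecD_zero, if_neg h]
    have e5 : ∀ (α β : ℤˣ) (i j : ℕ), α ≠ β →
        (if j = 0 then C (2 * dvec V α i (β, 0)) * (X (β, 0) : Poly) else 0) = 0 := by
      intro α β i j h
      simp [dvec, Ne.symm h]
    rw [e5 _ _ _ _ h, e5 _ _ _ _ (Ne.symm h)]
    simp

/-- Only finitely many constraints act on a given polynomial. The last terms to die are those with
two singular modes, which need `i.2 + i'.2 + 2 = j`; hence the bound by twice the order. -/
theorem exists_vir_eq_zero (c : Idx → Idx → ℂ) (p : Poly) :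
    ∃ J, ∀ α j, J ≤ j → vir c α j p = 0 := by
  refine ⟨2 * bd p + 2, fun α j hj => ?_⟩
  have hS := pderiv_eq_zero_of_notMem_box (le_refl (bd p))
  rw [vir_apply, fieldD_eq_sum _ _ _ hS, lap_double_sum _ _ _ hS, virQuad, virConst,
    if_neg (by omega), if_neg (by omega), if_neg (by omega)]
  have h1 : ∀ i ∈ box (bd p), virField c α j i * pderiv i p = 0 := by
    intro i hi
    rw [mem_box] at hi
    rw [virField, Finset.sum_eq_zero, zero_mul]
    intro m _
    rw [modeVec_neg_sub, if_neg (by omega), if_neg (by omega)]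
    simp
  have h2 : ∀ i ∈ box (bd p), ∀ i' ∈ box (bd p), virMat c α j i i' = 0 := by
    intro i hi i' hi'
    rw [mem_box] at hi hi'
    have h3 : modeVec c α ((i.2 : ℤ) + 1 - j) i' = 0 := by
      rw [modeVec_of_neg _ _ _ (by omega), if_neg (by omega)]
    rw [virMat, Finset.sum_eq_zero, h3]
    · simp
    · intro m _
      rw [modeVec_neg_sub, if_neg (by omega), if_neg (by omega), mul_zero]
  rw [Finset.sum_eq_zero h1, Finset.sum_eq_zero]
  · simp
  · intro i hi
    exact Finset.sum_eq_zero fun i' hi' => by rw [h2 i hi i' hi', C_0, zero_mul]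

theorem vecD_congr {d e : Idx → ℂ} {p : Poly} (h : ∀ i, pderiv i p ≠ 0 → d i = e i) :
    vecD d p = vecD e p := by
  have hS := pderiv_eq_zero_of_notMem (Finset.Subset.refl p.vars)
  rw [vecD_eq_sum _ _ _ hS, vecD_eq_sum _ _ _ hS]
  refine Finset.sum_congr rfl fun i _ => ?_
  by_cases hi : pderiv i p = 0
  · rw [hi, mul_zero, mul_zero]
  · rw [h i hi]

theorem sum_range_sum_range_eq {A : Type*} [AddCommMonoid A] (L : ℕ) (g : ℕ → ℕ → A)
    (hg : ∀ a b, L ≤ a + b → g a b = 0) :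
    ∑ a ∈ Finset.range L, ∑ b ∈ Finset.range L, g a b =
      ∑ n ∈ Finset.range L, ∑ x ∈ Finset.HasAntidiagonal.antidiagonal n, g x.1 x.2 := by
  rw [← Finset.sum_product' (Finset.range L) (Finset.range L) g,
    Finset.sum_sigma' (Finset.range L) (fun n => Finset.HasAntidiagonal.antidiagonal n) fun _ x => g x.1 x.2]
  symm
  refine Finset.sum_of_injOn (fun x => x.2) ?_ ?_ ?_ ?_
  · rintro ⟨n, a, b⟩ h1 ⟨n', a', b'⟩ h2 h3
    simp only [Finset.coe_sigma, Set.mem_sigma_iff, Finset.mem_coe, Finset.HasAntidiagonal.mem_antidiagonal] at h1 h2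
    simp only [Prod.mk.injEq] at h3
    obtain ⟨rfl, rfl⟩ := h3
    obtain rfl : n = n' := by omega
    rfl
  · rintro ⟨n, a, b⟩ h1
    simp only [Finset.coe_sigma, Set.mem_sigma_iff, Finset.mem_coe, Finset.HasAntidiagonal.mem_antidiagonal,
      Finset.mem_range] at h1
    simp only [Finset.coe_product, Set.mem_prod, Finset.mem_coe, Finset.mem_range]
    omega
  · rintro ⟨a, b⟩ h1 h2
    refine hg _ _ ?_
    by_contra hc
    exact h2 ⟨⟨a + b, a, b⟩, by simp; omega, rfl⟩
  · intro _ _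
    rfl

/-- The convolution inverse of the sequences `V`. -/
def IsConvInv (V U : ℤˣ → ℕ → ℂ) : Prop :=
  ∀ α n, ∑ x ∈ Finset.HasAntidiagonal.antidiagonal n, V α x.1 * U α x.2 = if n = 0 then 1 else 0

theorem sum_conv_mul {V U : ℤˣ → ℕ → ℂ} (h : IsConvInv V U) (α : ℤˣ) (L : ℕ) (f : ℕ → Poly)
    (hL : 0 < L) (hf : ∀ n, L ≤ n → f n = 0) :
    ∑ a ∈ Finset.range L, ∑ b ∈ Finset.range L, C (V α a * U α b) * f (a + b) = f 0 := by
  rw [sum_range_sum_range_eq L _ fun a b hab => by rw [hf _ hab, mul_zero]]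
  have : ∀ n ∈ Finset.range L, ∑ x ∈ Finset.HasAntidiagonal.antidiagonal n, C (V α x.1 * U α x.2) * f (x.1 + x.2) =
      if n = 0 then f 0 else 0 := by
    intro n _
    rw [Finset.sum_congr rfl (g := fun x => C (V α x.1 * U α x.2) * f n) fun x hx => by
      rw [Finset.HasAntidiagonal.mem_antidiagonal.mp hx], ← Finset.sum_mul, ← map_sum, h]
    split_ifs with hn
    · simp [hn]
    · simp
  rw [Finset.sum_congr rfl this]
  simp [hL]

/-- The directions `dvec` arise from the rescaled coordinate directions by convolution with `V`, so
convolution with its inverse recovers the latter. Orders from `L` on do not occur in `p`. -/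
theorem pderiv_eq_sum_dvec {V U : ℤˣ → ℕ → ℂ} (h : IsConvInv V U) (α : ℤˣ) (k L : ℕ) (p : Poly)
    (hp : bd p ≤ L) :
    C (2 * (k : ℂ) + 1) * pderiv (α, k) p =
      ∑ n ∈ Finset.range L, C (U α n) * vecD (dvec V α (k + n)) p := by
  have h1 : ∑ n ∈ Finset.range L, C (U α n) * vecD (dvec V α (k + n)) p =
      vecD (∑ n ∈ Finset.range L, U α n • dvec V α (k + n)) p := by
    rw [vecD_sum]
    refine Finset.sum_congr rfl fun n _ => ?_
    rw [vecD_smul, Derivation.smul_apply, smul_eq_C_mul]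
  have h2 : C (2 * (k : ℂ) + 1) * pderiv (α, k) p =
      vecD ((2 * (k : ℂ) + 1) • Pi.single (α, k) 1) p := by
    rw [vecD_smul, Derivation.smul_apply, smul_eq_C_mul, pderiv_eq_vecD]
  rw [h1, h2]
  refine vecD_congr fun i hi => ?_
  have hi2 : i.2 < L := by
    by_contra hc
    exact hi (pderiv_eq_zero_of_bd (hp.trans (not_lt.mp hc)))
  obtain ⟨β, l⟩ := i
  simp only at hi2
  simp only [Pi.smul_apply, Finset.sum_apply, smul_eq_mul, dvec]
  by_cases hab : β = α
  · subst hab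
    by_cases hkl : k ≤ l
    · have h3 := h β (l - k)
      rw [Finset.Nat.sum_antidiagonal_eq_sum_range_succ (fun a b => V β a * U β b),
        ← Finset.sum_range_reflect] at h3
      have h4 : ∑ n ∈ Finset.range L, U β n *
          (if β = β ∧ k + n ≤ l then (2 * (l : ℂ) + 1) * V β (l - (k + n)) else 0) =
          ∑ n ∈ Finset.range (l - k + 1), (2 * (l : ℂ) + 1) *
            (V β (l - k + 1 - 1 - n) * U β (l - k - (l - k + 1 - 1 - n))) := by
        have hsub : Finset.range (l - k + 1) ⊆ Finset.range L := by
          intro x; simp only [Finset.mem_range]; omega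
        rw [← Finset.sum_subset hsub]
        · refine Finset.sum_congr rfl fun n hn => ?_
          rw [Finset.mem_range] at hn
          rw [if_pos ⟨rfl, by omega⟩, show l - (k + n) = l - k + 1 - 1 - n by omega,
            show l - k - (l - k + 1 - 1 - n) = n by omega]
          ring
        · intro n _ hn
          rw [Finset.mem_range] at hn
          rw [if_neg (by omega), mul_zero]
      rw [h4, ← Finset.mul_sum, h3, Pi.single_apply]
      by_cases hlk : l = k
      · subst hlk; simp
      · rw [if_neg (fun hc => hlk (congrArg Prod.snd hc)), if_neg (by omega)]; simp
    · rw [Finset.sum_eq_zero, Pi.single_apply, if_neg (fun hc => by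
        have := congrArg Prod.snd hc; simp only at this; omega), mul_zero]
      intro n _
      rw [if_neg (by omega), mul_zero]
  · simp [hab]

/-- Write `D` for the derivatives along `dvec` and `L` for `vir`. By `vecD_dvec_vir`, `D_i L_j p -
D_j L_i p` equals `L_j D_i p - L_i D_j p + 4 (i - j) D_{i+j-1} p`. Substituting `D p = L q` makes it
vanish by the Virasoro relation on `q`, so the system for `r` is closed, hence solvable. -/
theorem exists_next {c : Idx → Idx → ℂ} (hc : ∀ i j, c i j = c j i) {V U : ℤˣ → ℕ → ℂ}
    (h : IsConvInv V U) (q p : Poly) (hqp : ∀ α j, vecD (dvec V α j) p = vir c α j q) :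
    ∃ r : Poly, ∀ α j, vecD (dvec V α j) r = vir c α j p := by
  obtain ⟨J, hJ⟩ := exists_vir_eq_zero c p
  have hclosed : ∀ α β i j, vecD (dvec V α i) (vir c β j p) = vecD (dvec V β j) (vir c α i p) := by
    intro α β i j
    rw [← sub_eq_zero, vecD_dvec_vir, hqp, hqp, vir_comm c hc]
    by_cases hab : α = β
    · subst hab
      simp only [if_true, hqp, add_comm j i]
      rw [← add_smul, show 4 * ((j : ℂ) - i) + 4 * ((i : ℂ) - j) = 0 by ring, zero_smul]
    · simp [hab, Ne.symm hab]
  let L : ℕ := J + 1 + (box J).sup fun i => bd (vir c i.1 i.2 p)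
  have hL : ∀ α j, bd (vir c α j p) ≤ L := by
    intro α j
    by_cases hj : j < J
    · have := Finset.le_sup (f := fun i : Idx => bd (vir c i.1 i.2 p))
        (show ((α, j) : Idx) ∈ box J from mem_box.mpr hj)
      simp only at this
      simp only [L]
      omega
    · rw [hJ α j (not_lt.mp hj)]
      simp only [bd, vars_0, Finset.sup_empty, bot_eq_zero, L]
      omega
  -- The gradient that `r` must have, by inversion of the convolution with `V`.
  let E : Idx → Poly := fun i => C (2 * (i.2 : ℂ) + 1)⁻¹ *
    ∑ n ∈ Finset.range L, C (U i.1 n) * vir c i.1 (i.2 + n) p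
  have hmul : ∀ i : Idx, C (2 * (i.2 : ℂ) + 1) * E i =
      ∑ n ∈ Finset.range L, C (U i.1 n) * vir c i.1 (i.2 + n) p := by
    intro i
    simp only [E]
    rw [← mul_assoc, ← C_mul, mul_inv_cancel₀ (two_mul_add_one_ne_zero _), C_1, one_mul]
  have hE : ∀ i j, pderiv i (E j) = pderiv j (E i) := by
    have e : ∀ i j : Idx, C (2 * (i.2 : ℂ) + 1) * (C (2 * (j.2 : ℂ) + 1) * pderiv i (E j)) =
        ∑ m ∈ Finset.range L, ∑ n ∈ Finset.range L, C (U i.1 m * U j.1 n) *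
          vecD (dvec V i.1 (i.2 + m)) (vir c j.1 (j.2 + n) p) := by
      intro i j
      have e1 : C (2 * (j.2 : ℂ) + 1) * pderiv i (E j) = ∑ n ∈ Finset.range L, C (U j.1 n) *
          pderiv i (vir c j.1 (j.2 + n) p) := by
        rw [← pderiv_C_mul, hmul, map_sum]
        exact Finset.sum_congr rfl fun n _ => pderiv_C_mul
      rw [e1, Finset.mul_sum, Finset.sum_comm]
      refine Finset.sum_congr rfl fun n _ => ?_
      rw [mul_left_comm, pderiv_eq_sum_dvec h i.1 i.2 L _ (hL _ _), Finset.mul_sum]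
      refine Finset.sum_congr rfl fun m _ => ?_
      rw [C_mul]; ring
    intro i j
    have hne : ∀ k : ℕ, (C (2 * (k : ℂ) + 1) : Poly) ≠ 0 := fun k => by
      rw [Ne, C_eq_zero]; exact two_mul_add_one_ne_zero k
    refine mul_left_cancel₀ (hne j.2) (mul_left_cancel₀ (hne i.2) ?_)
    rw [e i j, mul_left_comm, e j i, Finset.sum_comm]
    refine Finset.sum_congr rfl fun m _ => Finset.sum_congr rfl fun n _ => ?_
    rw [hclosed, mul_comm (U i.1 n)]
  have hEz : ∀ i ∉ box L, E i = 0 := by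
    intro i hi
    rw [mem_box] at hi
    simp only [E]
    rw [Finset.sum_eq_zero, mul_zero]
    intro n _
    rw [hJ _ _ (by simp only [L] at hi; omega), mul_zero]
  obtain ⟨r, hr⟩ := poincare E (box L) hEz hE
  refine ⟨r, fun α j => ?_⟩
  -- Conversely, convolving the gradient with `V` again gives back the prescribed values.
  have e2 : ∑ a ∈ Finset.range L, ∑ b ∈ Finset.range L, C (V α a * U α b) *
      vir c α (j + (a + b)) p = vir c α j p :=
    sum_conv_mul h α L (fun n => vir c α (j + n) p) (by simp only [L]; omega)
      fun n hn => hJ _ _ (by simp only [L] at hn; omega)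
  rw [vecD_eq_sum _ _ (box (j + L)) fun i hi => by
    rw [hr, hEz]; rw [mem_box] at hi ⊢; omega]
  rw [box, Finset.sum_product, Finset.sum_eq_single α]
  · rw [Finset.sum_range_add, Finset.sum_eq_zero, zero_add, ← e2]
    · refine Finset.sum_congr rfl fun a _ => ?_
      rw [hr, dvec, if_pos ⟨rfl, by simp⟩, mul_comm (2 * _ + 1 : ℂ), C_mul, mul_assoc, hmul,
        Finset.mul_sum]
      refine Finset.sum_congr rfl fun b _ => ?_
      rw [show ((α, j + a) : Idx).2 - j = a by simp, C_mul, mul_assoc, add_assoc]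
    · intro l hl
      rw [Finset.mem_range] at hl
      rw [dvec, if_neg (by simp; omega), C_0, zero_mul]
  · intro β _ hβ
    refine Finset.sum_eq_zero fun l _ => ?_
    rw [dvec, if_neg (by simp [hβ]), C_0, zero_mul]
  · exact fun h => absurd (Finset.mem_univ _) h

/-- The state of the iteration is a pair of consecutive coefficients, since `exists_next` needs the
equation at the previous order; the pair `(0, 1)` satisfies it trivially. -/
theorem exists_partition_function {c : Idx → Idx → ℂ} (hc : ∀ i j, c i j = c j i)
    {V U : ℤˣ → ℕ → ℂ} (h : IsConvInv V U) : ∃ Z : ℕ → Poly, Z 0 = 1 ∧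
      ∀ n α j, vecD (dvec V α j) (Z (n + 1)) = vir c α j (Z n) := by
  let T := {x : Poly × Poly // ∀ α j, vecD (dvec V α j) x.2 = vir c α j x.1}
  let step : T → T := fun x => ⟨(x.1.2, (exists_next hc h _ _ x.2).choose),
    (exists_next hc h _ _ x.2).choose_spec⟩
  let x0 : T := ⟨(0, 1), fun α j => by simp⟩
  let s : ℕ → T := fun n => step^[n] x0
  have hs : ∀ n, s (n + 1) = step (s n) := fun n => Function.iterate_succ_apply' _ _ _
  refine ⟨fun n => (s n).1.2, rfl, fun n α j => ?_⟩
  have h1 := (s (n + 1)).2 α j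
  rw [h1, hs n]

end EynardOrantin

end

/-! ### The logarithm of the partition function and its quadratic recursion. -/

noncomputable section

namespace EynardOrantin

open MvPolynomial

/-- The coefficientwise extension of a linear operator to power series. -/
def liftPS (φ : Poly →ₗ[ℂ] Poly) (f : PowerSeries Poly) : PowerSeries Poly :=
  PowerSeries.mk fun n => φ (PowerSeries.coeff n f)

@[simp] theorem coeff_liftPS (φ : Poly →ₗ[ℂ] Poly) (f : PowerSeries Poly) (n : ℕ) :
    PowerSeries.coeff n (liftPS φ f) = φ (PowerSeries.coeff n f) := PowerSeries.coeff_mk _ _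

theorem liftPS_mul (D : Derivation ℂ Poly Poly) (f g : PowerSeries Poly) :
    liftPS D (f * g) = f * liftPS D g + g * liftPS D f := by
  ext1 n
  rw [coeff_liftPS, mul_comm g, map_add, PowerSeries.coeff_mul, PowerSeries.coeff_mul,
    PowerSeries.coeff_mul, Derivation.coeFn_coe, map_sum, ← Finset.sum_add_distrib]
  refine Finset.sum_congr rfl fun x _ => ?_
  rw [Derivation.leibniz, coeff_liftPS, coeff_liftPS]
  simp only [smul_eq_mul, Derivation.coeFn_coe]
  ring

theorem liftPS_derivative (φ : Poly →ₗ[ℂ] Poly) (f : PowerSeries Poly) :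
    PowerSeries.derivative Poly (liftPS φ f) = liftPS φ (PowerSeries.derivative Poly f) := by
  ext1 n
  rw [coeff_liftPS, PowerSeries.coeff_derivative, PowerSeries.coeff_derivative, coeff_liftPS]
  have : ((n : Poly) + 1) = C ((n : ℂ) + 1) := by simp
  rw [this, mul_comm, ← smul_eq_C_mul, mul_comm, ← smul_eq_C_mul, map_smul]

/-- Uniqueness for a linear differential equation. It stands in for all manipulations of
exponentials: `F = log Z` enters only through `Z' = F' Z`. -/
theorem eq_zero_of_derivative_eq_mul (f Q : PowerSeries Poly)
    (h : PowerSeries.derivative Poly Q = f * Q) (h0 : PowerSeries.coeff 0 Q = 0) : Q = 0 := by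
  have : ∀ n, ∀ k ≤ n, PowerSeries.coeff k Q = 0 := by
    intro n
    induction n with
    | zero => intro k hk; rw [Nat.le_zero.mp hk, h0]
    | succ n ih =>
      intro k hk
      rcases Nat.lt_or_ge k (n + 1) with hk' | hk'
      · exact ih k (by omega)
      obtain rfl : k = n + 1 := by omega
      have h1 := congrArg (PowerSeries.coeff n) h
      rw [PowerSeries.coeff_derivative, PowerSeries.coeff_mul, Finset.sum_eq_zero] at h1
      · rcases mul_eq_zero.mp h1 with h2 | h2
        · exact h2
        · exact absurd h2 (Nat.cast_add_one_ne_zero n)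
      · intro x hx
        rw [ih x.2 (by have := Finset.HasAntidiagonal.mem_antidiagonal.mp hx; omega), mul_zero]
  ext1 n
  rw [this n n le_rfl, map_zero]

/-- The logarithm of a power series with constant coefficient `1`. -/
theorem exists_log (Z : PowerSeries Poly) (hZ : PowerSeries.coeff 0 Z = 1) :
    ∃ F : PowerSeries Poly, PowerSeries.coeff 0 F = 0 ∧
      PowerSeries.derivative Poly Z = PowerSeries.derivative Poly F * Z := by
  let G := PowerSeries.derivative Poly Z * PowerSeries.invOfUnit Z 1
  refine ⟨PowerSeries.mk fun n => C (n : ℂ)⁻¹ * PowerSeries.coeff (n - 1) G, by simp, ?_⟩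
  have h1 : PowerSeries.derivative Poly
      (PowerSeries.mk fun n => C (n : ℂ)⁻¹ * PowerSeries.coeff (n - 1) G) = G := by
    ext1 n
    rw [PowerSeries.coeff_derivative, PowerSeries.coeff_mk, Nat.add_sub_cancel]
    have : ((n : Poly) + 1) = C ((n : ℂ) + 1) := by simp
    rw [this, Nat.cast_add, Nat.cast_one, mul_right_comm, ← C_mul,
      inv_mul_cancel₀ (Nat.cast_add_one_ne_zero n), C_1, one_mul]
  rw [h1]
  have h2 : Z * PowerSeries.invOfUnit Z 1 = 1 :=
    PowerSeries.mul_invOfUnit Z 1 (by simpa using hZ)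
  simp only [G]
  rw [mul_assoc, mul_comm _ Z, h2, mul_one]

/-- The difference `Q` of the two sides satisfies `Q' = F' Q` and vanishes at order `0`. -/
theorem liftPS_exp (D : Derivation ℂ Poly Poly) (Z F : PowerSeries Poly)
    (hZ : PowerSeries.coeff 0 Z = 1) (hF : PowerSeries.coeff 0 F = 0)
    (h : PowerSeries.derivative Poly Z = PowerSeries.derivative Poly F * Z) :
    liftPS D Z = Z * liftPS D F := by
  rw [← sub_eq_zero]
  refine eq_zero_of_derivative_eq_mul (PowerSeries.derivative Poly F) _ ?_ ?_
  · rw [map_sub, liftPS_derivative, h, Derivation.leibniz, liftPS_derivative, liftPS_mul, h]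
    simp only [smul_eq_mul]
    ring
  · rw [map_sub, coeff_liftPS, hZ, PowerSeries.coeff_mul]
    simp [hF]

/-- For `Z = e^F` each second derivative is `Z` times `F_ij + F_i F_j`. Up to a given order only
finitely many times occur, which allows a sum over a finite box. -/
theorem coeff_lap_exp (M : Idx → Idx → ℂ) (Z F : PowerSeries Poly)
    (hZ : PowerSeries.coeff 0 Z = 1) (hF : PowerSeries.coeff 0 F = 0)
    (h : PowerSeries.derivative Poly Z = PowerSeries.derivative Poly F * Z) :
    liftPS (lap M) Z = Z * PowerSeries.mk fun n => lap M (PowerSeries.coeff n F) +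
      ∑ x ∈ Finset.HasAntidiagonal.antidiagonal n, gam M (PowerSeries.coeff x.1 F) (PowerSeries.coeff x.2 F) := by
  ext1 N
  let S : Finset Idx := box ((Finset.range (N + 1)).sup
    fun k => bd (PowerSeries.coeff k Z) + bd (PowerSeries.coeff k F))
  have hb : ∀ k ≤ N, bd (PowerSeries.coeff k Z) + bd (PowerSeries.coeff k F) ≤
      (Finset.range (N + 1)).sup
        fun k => bd (PowerSeries.coeff k Z) + bd (PowerSeries.coeff k F) := fun k hk =>
    Finset.le_sup (f := fun k => bd (PowerSeries.coeff k Z) + bd (PowerSeries.coeff k F))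
      (Finset.mem_range.mpr (by omega))
  have hSZ : ∀ k ≤ N, ∀ i ∉ S, pderiv i (PowerSeries.coeff k Z) = 0 := fun k hk =>
    pderiv_eq_zero_of_notMem_box ((Nat.le_add_right _ _).trans (hb k hk))
  have hSF : ∀ k ≤ N, ∀ i ∉ S, pderiv i (PowerSeries.coeff k F) = 0 := fun k hk =>
    pderiv_eq_zero_of_notMem_box ((Nat.le_add_left _ _).trans (hb k hk))
  let P : Idx → PowerSeries Poly → PowerSeries Poly := fun i =>
    liftPS (pderiv (R := ℂ) i : Derivation ℂ Poly Poly)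
  have hP : ∀ i j, P j (P i Z) = Z * (P j (P i F) + P i F * P j F) := by
    intro i j
    simp only [P]
    rw [liftPS_exp (pderiv i) Z F hZ hF h, liftPS_mul, liftPS_exp (pderiv j) Z F hZ hF h]
    ring
  have h1 : PowerSeries.coeff N (liftPS (lap M) Z) = PowerSeries.coeff N
      (Z * ∑ i ∈ S, ∑ j ∈ S, PowerSeries.C (C (M i j)) * (P j (P i F) + P i F * P j F)) := by
    rw [coeff_liftPS, lap_double_sum _ _ S (hSZ N le_rfl), Finset.mul_sum, map_sum]
    refine Finset.sum_congr rfl fun i _ => ?_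
    rw [Finset.mul_sum, map_sum]
    refine Finset.sum_congr rfl fun j _ => ?_
    rw [mul_left_comm, ← hP, PowerSeries.coeff_C_mul]
    simp only [P, coeff_liftPS, Derivation.coeFn_coe]
  rw [h1, PowerSeries.coeff_mul, PowerSeries.coeff_mul]
  refine Finset.sum_congr rfl fun x hx => ?_
  have hx2 : x.2 ≤ N := by have := Finset.HasAntidiagonal.mem_antidiagonal.mp hx; omega
  congr 1
  have hg : ∑ y ∈ Finset.HasAntidiagonal.antidiagonal x.2,
      gam M (PowerSeries.coeff y.1 F) (PowerSeries.coeff y.2 F) =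
      ∑ i ∈ S, ∑ j ∈ S, ∑ y ∈ Finset.HasAntidiagonal.antidiagonal x.2, C (M i j) *
        (pderiv i (PowerSeries.coeff y.1 F) * pderiv j (PowerSeries.coeff y.2 F)) := by
    have hy : ∀ y ∈ Finset.HasAntidiagonal.antidiagonal x.2,
        gam M (PowerSeries.coeff y.1 F) (PowerSeries.coeff y.2 F) = ∑ i ∈ S, ∑ j ∈ S, C (M i j) *
          (pderiv i (PowerSeries.coeff y.1 F) * pderiv j (PowerSeries.coeff y.2 F)) := by
      intro y hy
      have hy' := Finset.HasAntidiagonal.mem_antidiagonal.mp hy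
      exact gam_double_sum M _ _ S (hSF y.1 (by omega)) (hSF y.2 (by omega))
    rw [Finset.sum_congr rfl hy, Finset.sum_comm]
    refine Finset.sum_congr rfl fun i _ => ?_
    rw [Finset.sum_comm]
  rw [PowerSeries.coeff_mk, lap_double_sum _ _ S (hSF _ hx2), hg, ← Finset.sum_add_distrib, map_sum]
  refine Finset.sum_congr rfl fun i _ => ?_
  rw [← Finset.sum_add_distrib, map_sum]
  refine Finset.sum_congr rfl fun j _ => ?_
  rw [PowerSeries.coeff_C_mul, map_add, mul_add, PowerSeries.coeff_mul, Finset.mul_sum]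
  simp only [P, coeff_liftPS, Derivation.coeFn_coe]

/-- The quadratic recursion for the free energy. -/
def IsFreeEnergy (c : Idx → Idx → ℂ) (V : ℤˣ → ℕ → ℂ) (F : ℕ → Poly) : Prop :=
  F 0 = 0 ∧ ∀ n α j, vecD (dvec V α j) (F (n + 1)) =
    (if n = 0 then virQuad α j + C (virConst c α j) else 0) + fieldD (virField c α j) (F n) +
      lap (virMat c α j) (F n) +
      ∑ x ∈ Finset.HasAntidiagonal.antidiagonal n, gam (virMat c α j) (F x.1) (F x.2)

/-- The constraints on `Z` are divided by `Z`. The shift from `n` to `n + 1` is multiplication by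
the series variable, and the inhomogeneous term survives only at order `0`. -/
theorem exists_isFreeEnergy {c : Idx → Idx → ℂ} (hc : ∀ i j, c i j = c j i)
    {V U : ℤˣ → ℕ → ℂ} (h : IsConvInv V U) : ∃ F : ℕ → Poly, IsFreeEnergy c V F := by
  obtain ⟨Z, hZ0, hZ⟩ := exists_partition_function hc h
  have hZc : PowerSeries.coeff 0 (PowerSeries.mk Z) = 1 := by simp [hZ0]
  obtain ⟨F, hF0, hF⟩ := exists_log (PowerSeries.mk Z) hZc
  refine ⟨fun n => PowerSeries.coeff n F, hF0, fun n α j => ?_⟩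
  have hne : PowerSeries.mk Z ≠ 0 := by
    intro h0
    rw [h0] at hZc
    simp at hZc
  obtain ⟨A, hA⟩ : ∃ A, A = virQuad α j + C (virConst c α j) := ⟨_, rfl⟩
  have e1 : liftPS (vecD (dvec V α j)) (PowerSeries.mk Z) = PowerSeries.X *
      (PowerSeries.C A * PowerSeries.mk Z + liftPS (fieldD (virField c α j)) (PowerSeries.mk Z) +
        liftPS (lap (virMat c α j)) (PowerSeries.mk Z)) := by
    ext1 k
    rw [coeff_liftPS, PowerSeries.coeff_mk]
    rcases k with _ | k
    · rw [hZ0]; simp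
    · rw [PowerSeries.coeff_succ_X_mul, Derivation.coeFn_coe, hZ, vir_apply, ← hA, map_add, map_add,
        PowerSeries.coeff_C_mul, coeff_liftPS, coeff_liftPS, PowerSeries.coeff_mk]
      rfl
  rw [liftPS_exp _ _ F hZc hF0 hF, liftPS_exp _ _ F hZc hF0 hF, coeff_lap_exp _ _ F hZc hF0 hF] at e1
  have h1 : PowerSeries.mk Z * liftPS (vecD (dvec V α j)) F = PowerSeries.mk Z *
      (PowerSeries.X * (PowerSeries.C A +
        liftPS (fieldD (virField c α j)) F + PowerSeries.mk fun n =>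
          lap (virMat c α j) (PowerSeries.coeff n F) +
            ∑ x ∈ Finset.HasAntidiagonal.antidiagonal n,
            gam (virMat c α j) (PowerSeries.coeff x.1 F) (PowerSeries.coeff x.2 F))) := by
    rw [e1]; ring
  have h2 := congrArg (PowerSeries.coeff (n + 1)) (mul_left_cancel₀ hne h1)
  rw [coeff_liftPS, PowerSeries.coeff_succ_X_mul, map_add, map_add, coeff_liftPS,
    PowerSeries.coeff_mk, PowerSeries.coeff_C, hA] at h2
  simp only [Derivation.coeFn_coe] at h2
  rw [h2]
  ring

end EynardOrantin

end

/-! ### Jets at the origin, the genus expansion and the dilaton equation. -/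

noncomputable section

namespace EynardOrantin

open MvPolynomial

/-- Commutation lets iterated derivatives be indexed by multisets, so the symmetry of the invariants
in their arguments comes for free. -/
instance : LeftCommutative fun (d : Idx → ℂ) (p : Poly) => vecD d p :=
  ⟨fun d e p => vecD_comm d e p⟩

/-- The iterated derivative along a multiset of directions. -/
def iterD (s : Multiset (Idx → ℂ)) (p : Poly) : Poly := s.foldr (fun d p => vecD d p) p

/-- The iterated derivative at the origin. -/
def jet (s : Multiset (Idx → ℂ)) (p : Poly) : ℂ := constantCoeff (iterD s p)

@[simp] theorem iterD_zero (p : Poly) : iterD 0 p = p := rfl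

theorem iterD_cons (d : Idx → ℂ) (s : Multiset (Idx → ℂ)) (p : Poly) :
    iterD (d ::ₘ s) p = vecD d (iterD s p) := Multiset.foldr_cons _ _ _ _

theorem vecD_iterD (d : Idx → ℂ) (s : Multiset (Idx → ℂ)) (p : Poly) :
    vecD d (iterD s p) = iterD s (vecD d p) := by
  induction s using Multiset.induction_on with
  | empty => rfl
  | cons e s ih => rw [iterD_cons, iterD_cons, vecD_comm, ih]

theorem jet_cons (d : Idx → ℂ) (s : Multiset (Idx → ℂ)) (p : Poly) :
    jet (d ::ₘ s) p = jet s (vecD d p) := by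
  rw [jet, iterD_cons, vecD_iterD, jet]

theorem jet_zero (p : Poly) : jet 0 p = constantCoeff p := rfl

theorem iterD_add (s : Multiset (Idx → ℂ)) (p q : Poly) :
    iterD s (p + q) = iterD s p + iterD s q := by
  induction s using Multiset.induction_on with
  | empty => rfl
  | cons e s ih => rw [iterD_cons, iterD_cons, iterD_cons, ih, map_add]

theorem iterD_C_mul (s : Multiset (Idx → ℂ)) (a : ℂ) (p : Poly) :
    iterD s (C a * p) = C a * iterD s p := by
  induction s using Multiset.induction_on with
  | empty => rfl
  | cons e s ih => rw [iterD_cons, iterD_cons, ih, vecD_C_mul]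

/-- `jet s` as a linear functional. -/
def jetL (s : Multiset (Idx → ℂ)) : Poly →ₗ[ℂ] ℂ where
  toFun := jet s
  map_add' p q := by rw [jet, iterD_add, map_add]; rfl
  map_smul' a p := by
    rw [jet, smul_eq_C_mul, iterD_C_mul, map_mul, constantCoeff_C]; rfl

theorem jet_add (s : Multiset (Idx → ℂ)) (p q : Poly) : jet s (p + q) = jet s p + jet s q :=
  map_add (jetL s) p q

theorem jet_sum {τ : Type*} (s : Multiset (Idx → ℂ)) (S : Finset τ) (p : τ → Poly) :
    jet s (∑ t ∈ S, p t) = ∑ t ∈ S, jet s (p t) := map_sum (jetL s) p S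

theorem jet_C_mul (s : Multiset (Idx → ℂ)) (a : ℂ) (p : Poly) : jet s (C a * p) = a * jet s p := by
  rw [jet, iterD_C_mul, map_mul, constantCoeff_C]; rfl

theorem jet_map_zero (s : Multiset (Idx → ℂ)) : jet s 0 = 0 := map_zero (jetL s)

theorem jet_C (s : Multiset (Idx → ℂ)) (a : ℂ) (hs : s ≠ 0) : jet s (C a) = 0 := by
  obtain ⟨d, hd⟩ := Multiset.exists_mem_of_ne_zero hs
  obtain ⟨t, rfl⟩ := Multiset.exists_cons_of_mem hd
  rw [jet_cons, vecD_C, jet_map_zero]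

theorem jet_X (s : Multiset (Idx → ℂ)) (i : Idx) (hs : Multiset.card s ≠ 1) : jet s (X i) = 0 := by
  induction s using Multiset.induction_on with
  | empty => simp [jet_zero]
  | cons d t _ =>
    rw [jet_cons, vecD_X, jet_C]
    rintro rfl
    simp at hs

/-- The Leibniz rule. -/
theorem iterD_mul (s : Multiset (Idx → ℂ)) (p q : Poly) :
    iterD s (p * q) = (s.antidiagonal.map fun x => iterD x.1 p * iterD x.2 q).sum := by
  induction s using Multiset.induction_on with
  | empty => simp
  | cons d s ih =>
    rw [iterD_cons, ih, Multiset.antidiagonal_cons, map_multiset_sum, Multiset.map_map,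
      Multiset.map_add, Multiset.sum_add, Multiset.map_map, Multiset.map_map,
      ← Multiset.sum_map_add]
    refine congrArg Multiset.sum (Multiset.map_congr rfl fun x _ => ?_)
    simp only [Function.comp_apply, Prod.map_fst, Prod.map_snd, id_eq, iterD_cons,
      Derivation.leibniz, smul_eq_mul]
    ring

theorem jet_mul_eq_zero (s : Multiset (Idx → ℂ)) (p q : Poly)
    (h : ∀ s₁ s₂, s₁ + s₂ = s → jet s₁ p = 0 ∨ jet s₂ q = 0) : jet s (p * q) = 0 := by
  rw [jet, iterD_mul, map_multiset_sum, Multiset.map_map]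
  refine Multiset.sum_eq_zero fun y hy => ?_
  obtain ⟨x, hx, rfl⟩ := Multiset.mem_map.mp hy
  simp only [Function.comp_apply, map_mul]
  rcases h x.1 x.2 (Multiset.mem_antidiagonal.mp hx) with h1 | h1
  · rw [jet] at h1; rw [h1, zero_mul]
  · rw [jet] at h1; rw [h1, mul_zero]

/-- The Leibniz rule for directions indexed by a finite set. -/
theorem iterD_mul_finset {τ : Type*} [DecidableEq τ] (φ : τ → Idx → ℂ) (S : Finset τ) (p q : Poly) :
    iterD (S.val.map φ) (p * q) =
      ∑ I ∈ S.powerset, iterD (I.val.map φ) p * iterD ((S \ I).val.map φ) q := by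
  induction S using Finset.induction_on with
  | empty => simp
  | insert a S ha ih =>
    rw [Finset.insert_val_of_notMem ha, Multiset.map_cons, iterD_cons, ih, map_sum,
      Finset.sum_powerset_insert ha, ← Finset.sum_add_distrib]
    refine Finset.sum_congr rfl fun I hI => ?_
    rw [Finset.mem_powerset] at hI
    have h1 : insert a S \ I = insert a (S \ I) :=
      Finset.insert_sdiff_of_notMem _ fun h => ha (hI h)
    have h2 : insert a S \ insert a I = S \ I := by
      rw [Finset.insert_sdiff_insert, Finset.sdiff_insert_of_notMem ha]
    rw [h1, h2, Finset.insert_val_of_notMem fun h => ha (hI h),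
      Finset.insert_val_of_notMem fun h => ha (Finset.mem_sdiff.mp h).1, Multiset.map_cons,
      Multiset.map_cons, iterD_cons, iterD_cons, Derivation.leibniz]
    simp only [smul_eq_mul]
    ring

theorem jet_mul_finset {τ : Type*} [DecidableEq τ] (φ : τ → Idx → ℂ) (S : Finset τ) (p q : Poly) :
    jet (S.val.map φ) (p * q) =
      ∑ I ∈ S.powerset, jet (I.val.map φ) p * jet ((S \ I).val.map φ) q := by
  rw [jet, iterD_mul_finset, map_sum]
  exact Finset.sum_congr rfl fun I _ => map_mul _ _ _

theorem jet_X_mul {τ : Type*} [DecidableEq τ] (φ : τ → Idx → ℂ) (S : Finset τ) (i : Idx) (q : Poly) :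
    jet (S.val.map φ) (X i * q) = ∑ j ∈ S, φ j i * jet ((S.erase j).val.map φ) q := by
  have h : iterD (S.val.map φ) (X i * q) = X i * iterD (S.val.map φ) q +
      ∑ j ∈ S, C (φ j i) * iterD ((S.erase j).val.map φ) q := by
    induction S using Finset.induction_on with
    | empty => simp
    | insert a S ha ih =>
      rw [Finset.insert_val_of_notMem ha, Multiset.map_cons, iterD_cons, iterD_cons, ih, map_add,
        Derivation.leibniz, vecD_X, Finset.sum_insert ha, Finset.erase_insert ha, map_sum]
      simp only [smul_eq_mul]
      rw [add_assoc, mul_comm (iterD _ q)]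
      congr 2
      refine Finset.sum_congr rfl fun j hj => ?_
      have hja : j ≠ a := fun h => ha (h ▸ hj)
      rw [Finset.erase_insert_of_ne (Ne.symm hja),
        Finset.insert_val_of_notMem fun h => ha (Finset.mem_of_mem_erase h), Multiset.map_cons,
        iterD_cons, vecD_C_mul]
  rw [jet, h, map_add, map_mul, constantCoeff_X, zero_mul, zero_add, map_sum]
  refine Finset.sum_congr rfl fun j _ => ?_
  rw [map_mul, constantCoeff_C]; rfl

theorem vecD_eq_sum_dvec {V U : ℤˣ → ℕ → ℂ} (h : IsConvInv V U) (d : Idx → ℂ) (p : Poly) (L : ℕ)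
    (hL : bd p ≤ L) : vecD d p = ∑ i ∈ box L, C (d i / (2 * (i.2 : ℂ) + 1)) *
      ∑ n ∈ Finset.range L, C (U i.1 n) * vecD (dvec V i.1 (i.2 + n)) p := by
  rw [vecD_eq_sum d p _ (pderiv_eq_zero_of_notMem_box hL)]
  refine Finset.sum_congr rfl fun i _ => ?_
  rw [← pderiv_eq_sum_dvec h i.1 i.2 L p hL, ← mul_assoc, ← C_mul,
    div_mul_cancel₀ _ (two_mul_add_one_ne_zero _)]

theorem eq_C_of_vecD_dvec {V U : ℤˣ → ℕ → ℂ} (h : IsConvInv V U) (p : Poly)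
    (hp : ∀ α j, vecD (dvec V α j) p = 0) : p = C (constantCoeff p) := by
  refine eq_C_of_pderiv_eq_zero p fun i => ?_
  rw [pderiv_eq_vecD, vecD_eq_sum_dvec h _ _ _ le_rfl]
  simp [hp]

/-- Only genus `g ≥ 0` contributes to the jets of the free energy. -/
theorem jet_freeEnergy_eq_zero {c : Idx → Idx → ℂ} {V U : ℤˣ → ℕ → ℂ} (h : IsConvInv V U)
    {F : ℕ → Poly} (hF : IsFreeEnergy c V F) (n : ℕ) (s : Multiset (Idx → ℂ)) (hs : s ≠ 0)
    (hn : n + 2 < Multiset.card s ∨ (Multiset.card s + n) % 2 = 1) : jet s (F n) = 0 := by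
  induction n using Nat.strong_induction_on generalizing s with
  | _ n ih =>
  rcases n with _ | n
  · rw [hF.1, jet_map_zero]
  obtain ⟨d, hd⟩ := Multiset.exists_mem_of_ne_zero hs
  obtain ⟨t, rfl⟩ := Multiset.exists_cons_of_mem hd
  rw [Multiset.card_cons] at hn
  -- A partial derivative counts as one further direction.
  have hpd : ∀ k < n + 1, ∀ (i : Idx) (u : Multiset (Idx → ℂ)), (k + 2 < Multiset.card u + 1 ∨
      (Multiset.card u + 1 + k) % 2 = 1) → jet u (pderiv i (F k)) = 0 := by
    intro k hk i u hu
    rw [pderiv_eq_vecD, ← jet_cons]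
    exact ih k hk _ (Multiset.cons_ne_zero) (by rwa [Multiset.card_cons])
  -- Directions `dvec` suffice, since every direction is a combination of them on a given
  -- polynomial. Each term of the recursion preserves the count: a factor `X` uses up one direction
  -- while a derivative restores it, `lap` adds two directions, and in `gam` the total index `n` and
  -- `card t + 2` directions are split between two factors, one of which must violate its own bound
  -- or parity.
  have key : ∀ α j, jet t (vecD (dvec V α j) (F (n + 1))) = 0 := by
    intro α j
    have hS := pderiv_eq_zero_of_notMem_box (le_refl (bd (F n)))
    rw [hF.2, jet_add, jet_add, jet_add, jet_sum, fieldD_eq_sum _ _ _ hS, lap_double_sum _ _ _ hS]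
    have h1 : jet t (if n = 0 then virQuad α j + C (virConst c α j) else 0) = 0 := by
      split_ifs with h0
      · subst h0
        have ht : t ≠ 0 := by
          rintro rfl
          simp at hn
        rw [jet_add, jet_C _ _ ht, add_zero, virQuad]
        split_ifs
        · rw [pow_two]
          refine jet_mul_eq_zero _ _ _ fun s₁ s₂ h12 => ?_
          by_cases hs1 : Multiset.card s₁ = 1
          · right
            refine jet_X _ _ fun hs2 => ?_
            rw [← h12, Multiset.card_add, hs1, hs2] at hn
            omega
          · exact Or.inl (jet_X _ _ hs1)
        · rw [jet_map_zero]
      · rw [jet_map_zero]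
    have h2 : jet t (∑ i ∈ box (bd (F n)), virField c α j i * pderiv i (F n)) = 0 := by
      rw [jet_sum]
      refine Finset.sum_eq_zero fun i _ => ?_
      rw [virField, Finset.sum_mul, jet_sum]
      refine Finset.sum_eq_zero fun m _ => ?_
      rw [mul_assoc, jet_C_mul, jet_mul_eq_zero, mul_zero]
      intro s₁ s₂ h12
      by_cases hs1 : Multiset.card s₁ = 1
      · right
        refine hpd n (by omega) i s₂ ?_
        rw [← h12, Multiset.card_add, hs1] at hn
        omega
      · exact Or.inl (jet_X _ _ hs1)
    have h3 : jet t (∑ i ∈ box (bd (F n)), ∑ i' ∈ box (bd (F n)),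
        C (virMat c α j i i') * pderiv i' (pderiv i (F n))) = 0 := by
      rw [jet_sum]
      refine Finset.sum_eq_zero fun i _ => ?_
      rw [jet_sum]
      refine Finset.sum_eq_zero fun i' _ => ?_
      rw [jet_C_mul, pderiv_eq_vecD i', ← jet_cons, hpd n (by omega), mul_zero]
      rw [Multiset.card_cons]
      omega
    have h4 : ∑ x ∈ Finset.HasAntidiagonal.antidiagonal n,
        jet t (gam (virMat c α j) (F x.1) (F x.2)) = 0 := by
      refine Finset.sum_eq_zero fun x hx => ?_
      have hx' := Finset.HasAntidiagonal.mem_antidiagonal.mp hx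
      rw [gam_double_sum _ _ _ (box (bd (F x.1) + bd (F x.2)))
        (pderiv_eq_zero_of_notMem_box (Nat.le_add_right _ _))
        (pderiv_eq_zero_of_notMem_box (Nat.le_add_left _ _)), jet_sum]
      refine Finset.sum_eq_zero fun i _ => ?_
      rw [jet_sum]
      refine Finset.sum_eq_zero fun i' _ => ?_
      rw [jet_C_mul, jet_mul_eq_zero, mul_zero]
      intro s₁ s₂ h12
      rw [← h12, Multiset.card_add] at hn
      by_cases hs1 : x.1 + 2 < Multiset.card s₁ + 1 ∨ (Multiset.card s₁ + 1 + x.1) % 2 = 1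
      · exact Or.inl (hpd x.1 (by omega) i s₁ hs1)
      · exact Or.inr (hpd x.2 (by omega) i' s₂ (by omega))
    rw [h1, h2, h3, h4]
    simp
  rw [jet_cons, vecD_eq_sum_dvec h _ _ _ le_rfl, jet_sum]
  refine Finset.sum_eq_zero fun i _ => ?_
  rw [jet_C_mul, jet_sum, Finset.sum_eq_zero, mul_zero]
  intro m _
  rw [jet_C_mul, key, mul_zero]

/-- The dilaton direction. -/
def dilVec (V : ℤˣ → ℕ → ℂ) (i : Idx) : ℂ := if i.2 = 0 then 0 else V i.1 (i.2 - 1) / 2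

/-- Shifting the field by `x V / 2` changes its square by `x V` times the field, whose coefficients
are the linear terms `dvec`. As `dilVec` vanishes at order `0`, the regular mode at `j = 0` does not
interfere. -/
theorem fieldD_vecD_dilVec (c : Idx → Idx → ℂ) (V : ℤˣ → ℕ → ℂ) (α : ℤˣ) (j : ℕ) :
    fieldD (fun i => vecD (dilVec V) (virField c α j i)) = vecD (dvec V α j) := by
  refine derivation_ext fun i => ?_
  have h := sum_mul_modeVec_neg_sub c α j i (fun m => dilVec V (α, m))
  simp only [smul_eq_mul] at h
  rw [fieldD_X, vecD_virField, vecD_X, Finset.sum_congr rfl fun m _ => mul_comm _ _, h]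
  congr 1
  simp only [dilVec, if_true, mul_zero, ite_self, zero_add, dvec]
  by_cases h1 : i.1 = α ∧ j ≤ i.2
  · rw [if_pos h1, if_pos ⟨h1.1, by omega⟩, if_neg (by omega),
      show i.2 + 1 - j - 1 = i.2 - j by omega]
    ring
  · rw [if_neg h1]
    split_ifs with h2 h3
    · ring
    · exact absurd ⟨h2.1, by omega⟩ h1
    · ring

theorem fieldD_C_mul_add_C (a : Idx → Poly) (x y : ℂ) (p : Poly) :
    fieldD a (C x * p + C y) = C x * fieldD a p := by
  rw [map_add, Derivation.leibniz]; simp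

theorem lap_C_mul_add_C (M : Idx → Idx → ℂ) (x y : ℂ) (p : Poly) :
    lap M (C x * p + C y) = C x * lap M p := by
  rw [map_add, lap_C, ← smul_eq_C_mul, map_smul, smul_eq_C_mul, add_zero]

theorem gam_C_mul_add_C_right (M : Idx → Idx → ℂ) (x y : ℂ) (p q : Poly) :
    gam M q (C x * p + C y) = C x * gam M q p := by
  rw [gam_eq_sum M _ _ _ (pderiv_eq_zero_of_notMem (Finset.Subset.refl q.vars)),
    gam_eq_sum M _ _ _ (pderiv_eq_zero_of_notMem (Finset.Subset.refl q.vars)), Finset.mul_sum]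
  refine Finset.sum_congr rfl fun i _ => ?_
  rw [map_add, vecD_C_mul, vecD_C]; ring

theorem gam_zero_right (M : Idx → Idx → ℂ) (p : Poly) : gam M p 0 = 0 := by
  simp [gam]

/-- The dilaton equation. -/
theorem dilaton {c : Idx → Idx → ℂ} (hc : ∀ i j, c i j = c j i) {V U : ℤˣ → ℕ → ℂ}
    (h : IsConvInv V U) {F : ℕ → Poly} (hF : IsFreeEnergy c V F) (n : ℕ) :
    ∃ κ : ℂ, vecD (dilVec V) (F (n + 1)) = C (n : ℂ) * F n + C κ := by
  induction n using Nat.strong_induction_on with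
  | _ n ih =>
  -- The derivatives along `dvec` determine a polynomial up to a constant, which is why `κ` appears.
  -- The dilaton derivative of the recursion yields one copy of the derivative of `F n` from
  -- `virField`; the induction hypothesis supplies the other copies.
  suffices hs : ∀ α j, vecD (dvec V α j) (vecD (dilVec V) (F (n + 1)) - C (n : ℂ) * F n) = 0 by
    refine ⟨constantCoeff (vecD (dilVec V) (F (n + 1)) - C (n : ℂ) * F n), ?_⟩
    rw [← sub_eq_iff_eq_add']
    exact eq_C_of_vecD_dvec h _ hs
  intro α j
  have hq : vecD (dilVec V) (if n = 0 then virQuad α j + C (virConst c α j) else 0) = 0 := by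
    split_ifs
    · rw [map_add, vecD_C, vecD_virQuad]
      simp [dilVec]
    · simp
  have hg : ∀ p q, gam (virMat c α j) p q = gam (virMat c α j) q p :=
    gam_comm _ (virMat_symm c hc α j)
  rw [map_sub, vecD_C_mul, vecD_comm, hF.2, map_add, map_add, map_add, hq, vecD_fieldD,
    fieldD_vecD_dilVec, vecD_lap, map_sum,
    Finset.sum_congr rfl fun x _ => vecD_gam _ _ (F x.1) (F x.2), Finset.sum_add_distrib]
  rcases n with _ | n
  · simp [hF.1, gam_zero_right]
  obtain ⟨κ, hκ⟩ := ih n (by omega)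
  have h1 : ∑ x ∈ Finset.HasAntidiagonal.antidiagonal (n + 1),
      gam (virMat c α j) (F x.1) (vecD (dilVec V) (F x.2)) =
      ∑ x ∈ Finset.HasAntidiagonal.antidiagonal n,
        C (x.2 : ℂ) * gam (virMat c α j) (F x.1) (F x.2) := by
    rw [Finset.Nat.antidiagonal_succ', Finset.sum_cons, Finset.sum_map, hF.1, map_zero,
      gam_zero_right, zero_add]
    refine Finset.sum_congr rfl fun x hx => ?_
    have hx' := Finset.HasAntidiagonal.mem_antidiagonal.mp hx
    obtain ⟨κ', hκ'⟩ := ih x.2 (by omega)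
    simp only [Function.Embedding.prodMap, Function.Embedding.coeFn_mk, Prod.map_fst, Prod.map_snd,
      Function.Embedding.refl_apply, Nat.succ_eq_add_one]
    rw [hκ', gam_C_mul_add_C_right]
  have h2 : ∑ x ∈ Finset.HasAntidiagonal.antidiagonal (n + 1),
      gam (virMat c α j) (vecD (dilVec V) (F x.1)) (F x.2) =
      ∑ x ∈ Finset.HasAntidiagonal.antidiagonal n,
        C (x.1 : ℂ) * gam (virMat c α j) (F x.1) (F x.2) := by
    rw [Finset.Nat.antidiagonal_succ, Finset.sum_cons, Finset.sum_map, hF.1, map_zero,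
      hg, gam_zero_right, zero_add]
    refine Finset.sum_congr rfl fun x hx => ?_
    have hx' := Finset.HasAntidiagonal.mem_antidiagonal.mp hx
    obtain ⟨κ', hκ'⟩ := ih x.1 (by omega)
    simp only [Function.Embedding.prodMap, Function.Embedding.coeFn_mk, Prod.map_fst, Prod.map_snd,
      Function.Embedding.refl_apply, Nat.succ_eq_add_one]
    rw [hκ', hg, gam_C_mul_add_C_right, hg]
  -- Differentiating either factor of a quadratic term multiplies it by its own index; the indices
  -- add up to `n`.
  have h3 : ∑ x ∈ Finset.HasAntidiagonal.antidiagonal n,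
        C (x.1 : ℂ) * gam (virMat c α j) (F x.1) (F x.2) +
      ∑ x ∈ Finset.HasAntidiagonal.antidiagonal n,
        C (x.2 : ℂ) * gam (virMat c α j) (F x.1) (F x.2) =
      C (n : ℂ) * ∑ x ∈ Finset.HasAntidiagonal.antidiagonal n,
        gam (virMat c α j) (F x.1) (F x.2) := by
    rw [← Finset.sum_add_distrib, Finset.mul_sum]
    refine Finset.sum_congr rfl fun x hx => ?_
    rw [← Finset.HasAntidiagonal.mem_antidiagonal.mp hx, ← add_mul, ← C_add, Nat.cast_add]
  have h4 := hF.2 n α j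
  rw [h1, h2, h3, hκ, fieldD_C_mul_add_C, lap_C_mul_add_C]
  have h5 : C (n : ℂ) * vecD (dvec V α j) (F (n + 1)) = C (n : ℂ) * (fieldD (virField c α j) (F n) +
      lap (virMat c α j) (F n) + ∑ x ∈ Finset.HasAntidiagonal.antidiagonal n,
        gam (virMat c α j) (F x.1) (F x.2)) := by
    rw [h4]
    by_cases hn : n = 0
    · subst hn; simp
    · rw [if_neg hn]; ring
  rw [Nat.cast_add, Nat.cast_one, C_add, C_1]
  linear_combination -h5

end EynardOrantin

end

/-! ### Laurent expansions in `x = s ^ 2` of even functions of `s`. -/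

noncomputable section

namespace EynardOrantin

open Filter Topology

theorem hasSum_congr {τ : Type*} {f g : τ → ℂ} {a b : ℂ} (h : HasSum f a) (hfg : ∀ k, g k = f k)
    (hab : b = a) : HasSum g b := by
  rw [hab, show g = f from funext hfg]
  exact h

/-- `P` is the Taylor series of `G` at the origin. -/
def PSum (P : PowerSeries ℂ) (G : ℂ → ℂ) : Prop :=
  ∀ᶠ x in 𝓝 (0 : ℂ), HasSum (fun k : ℕ => PowerSeries.coeff k P * x ^ k) (G x)

theorem psum_iff (P : PowerSeries ℂ) (G : ℂ → ℂ) :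
    PSum P G ↔ HasFPowerSeriesAt G
      (FormalMultilinearSeries.ofScalars ℂ fun k => PowerSeries.coeff k P) 0 := by
  rw [hasFPowerSeriesAt_iff]
  simp only [PSum, zero_add, FormalMultilinearSeries.coeff_ofScalars, smul_eq_mul, mul_comm]

theorem PSum.analyticAt {P : PowerSeries ℂ} {G : ℂ → ℂ} (h : PSum P G) : AnalyticAt ℂ G 0 :=
  ⟨_, (psum_iff P G).mp h⟩

theorem psum_of_analyticAt {G : ℂ → ℂ} (h : AnalyticAt ℂ G 0) :
    PSum (PowerSeries.mk fun n => iteratedDeriv n G 0 / n.factorial) G := by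
  rw [psum_iff]
  simpa using h.hasFPowerSeriesAt

/-- The identity theorem; agreement off the origin suffices, so junk values at poles never matter.
-/
theorem PSum.unique {P Q : PowerSeries ℂ} {G H : ℂ → ℂ} (hP : PSum P G) (hQ : PSum Q H)
    (h : ∀ᶠ x in 𝓝[≠] (0 : ℂ), G x = H x) : P = Q := by
  have h1 : ∀ᶠ x in 𝓝 (0 : ℂ), G x = H x :=
    (hP.analyticAt.frequently_eq_iff_eventually_eq hQ.analyticAt).mp h.frequently
  have h2 := ((psum_iff P G).mp hP).eq_formalMultilinearSeries_of_eventually ((psum_iff Q H).mp hQ) h1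
  ext k
  simpa using congrArg (fun p => p.coeff k) h2

theorem PSum.add {P Q : PowerSeries ℂ} {G H : ℂ → ℂ} (hP : PSum P G) (hQ : PSum Q H) :
    PSum (P + Q) (fun x => G x + H x) := by
  filter_upwards [hP, hQ] with x h1 h2
  simpa [add_mul] using h1.add h2

theorem PSum.mul {P Q : PowerSeries ℂ} {G H : ℂ → ℂ} (hP : PSum P G) (hQ : PSum Q H) :
    PSum (P * Q) (fun x => G x * H x) := by
  filter_upwards [hP, hQ] with x h1 h2
  have e : (fun k : ℕ => PowerSeries.coeff k (P * Q) * x ^ k) = fun k =>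
      ∑ p ∈ Finset.HasAntidiagonal.antidiagonal k,
        (PowerSeries.coeff p.1 P * x ^ p.1) * (PowerSeries.coeff p.2 Q * x ^ p.2) := by
    funext k
    rw [PowerSeries.coeff_mul, Finset.sum_mul]
    refine Finset.sum_congr rfl fun p hp => ?_
    rw [← Finset.HasAntidiagonal.mem_antidiagonal.mp hp, pow_add]
    ring
  have s1 := h1.summable.norm
  have s2 := h2.summable.norm
  rw [e, ← h1.tsum_eq, ← h2.tsum_eq,
    tsum_mul_tsum_eq_tsum_sum_antidiagonal_of_summable_norm s1 s2]
  exact (summable_norm_sum_mul_antidiagonal_of_summable_norm s1 s2).of_norm.hasSum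

theorem psum_C (a : ℂ) : PSum (PowerSeries.C a) (fun _ => a) := by
  refine Eventually.of_forall fun x => ?_
  have := hasSum_single (f := fun k : ℕ => PowerSeries.coeff k (PowerSeries.C a) * x ^ k) 0
    fun k hk => by simp [PowerSeries.coeff_C, hk]
  simpa using this

theorem psum_X_pow (n : ℕ) : PSum (PowerSeries.X ^ n) (fun x => x ^ n) := by
  refine Eventually.of_forall fun x => ?_
  have := hasSum_single (f := fun k : ℕ => PowerSeries.coeff k (PowerSeries.X ^ n : PowerSeries ℂ) * x ^ k) n
    fun k hk => by simp [PowerSeries.coeff_X_pow, hk]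
  simpa [PowerSeries.coeff_X_pow] using this

theorem PSum.apply_zero {P : PowerSeries ℂ} {G : ℂ → ℂ} (hP : PSum P G) :
    G 0 = PowerSeries.constantCoeff P := by
  have h := hP.self_of_nhds
  have := hasSum_single (f := fun k : ℕ => PowerSeries.coeff k P * (0 : ℂ) ^ k) 0
    fun k hk => by simp [hk]
  simpa using h.unique this

theorem PSum.inv {P : PowerSeries ℂ} {G : ℂ → ℂ} (hP : PSum P G)
    (h0 : PowerSeries.constantCoeff P ≠ 0) : PSum P⁻¹ (fun x => (G x)⁻¹) := by
  have hG0 : G 0 ≠ 0 := by rwa [hP.apply_zero]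
  have h1 := psum_of_analyticAt (hP.analyticAt.inv hG0)
  have h2 := hP.mul h1
  have h3 := h2.unique (psum_C 1) (by
    filter_upwards [(hP.analyticAt.continuousAt.eventually_ne hG0).filter_mono
      nhdsWithin_le_nhds] with x hx
    simp only [Pi.inv_apply]
    rw [mul_inv_cancel₀ hx])
  rw [map_one, mul_comm, ← PowerSeries.eq_inv_iff_mul_eq_one h0] at h3
  rw [h3] at h1
  exact h1

theorem tendsto_sq_punctured : Tendsto (fun s : ℂ => s ^ 2) (𝓝[≠] 0) (𝓝[≠] 0) := by
  refine tendsto_nhdsWithin_of_tendsto_nhds_of_eventually_within _ ?_ ?_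
  · have : Tendsto (fun s : ℂ => s ^ 2) (𝓝 0) (𝓝 0) := by
      have h : Continuous fun s : ℂ => s ^ 2 := by fun_prop
      simpa using h.tendsto 0
    exact this.mono_left nhdsWithin_le_nhds
  · filter_upwards [self_mem_nhdsWithin] with s hs
    exact pow_ne_zero 2 hs

/-- Every small `x` is the square of a small `s`. -/
theorem eventually_of_sq {p : ℂ → Prop} (h : ∀ᶠ s in 𝓝[≠] (0 : ℂ), p (s ^ 2)) :
    ∀ᶠ x in 𝓝[≠] (0 : ℂ), p x := by
  rw [eventually_nhdsWithin_iff, Metric.eventually_nhds_iff] at h ⊢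
  obtain ⟨ε, hε, h⟩ := h
  refine ⟨ε ^ 2, by positivity, fun x hx hx0 => ?_⟩
  obtain ⟨s, rfl⟩ := IsAlgClosed.exists_pow_nat_eq x (n := 2) (by norm_num)
  refine h ?_ fun hs => hx0 ?_
  · rw [dist_zero_right] at hx ⊢
    rw [norm_pow] at hx
    exact lt_of_pow_lt_pow_left₀ 2 hε.le hx
  · simp only [Set.mem_singleton_iff] at hs ⊢
    rw [hs]; norm_num

theorem exists_psum_of_sq {P : PowerSeries ℂ} {f : ℂ → ℂ}
    (h : ∀ᶠ s in 𝓝 (0 : ℂ), HasSum (fun k : ℕ => PowerSeries.coeff k P * (s ^ 2) ^ k) (f s)) :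
    ∃ G, PSum P G ∧ ∀ᶠ s in 𝓝 (0 : ℂ), f s = G (s ^ 2) := by
  refine ⟨fun x => ∑' k : ℕ, PowerSeries.coeff k P * x ^ k, ?_, ?_⟩
  · rw [Metric.eventually_nhds_iff] at h
    obtain ⟨ε, hε, h⟩ := h
    refine Metric.eventually_nhds_iff.mpr ⟨ε ^ 2, by positivity, fun {x} hx => ?_⟩
    obtain ⟨s, rfl⟩ := IsAlgClosed.exists_pow_nat_eq x (n := 2) (by norm_num)
    refine (h ?_).summable.hasSum
    rw [dist_zero_right] at hx ⊢
    rw [norm_pow] at hx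
    exact lt_of_pow_lt_pow_left₀ 2 hε.le hx
  · filter_upwards [h] with s hs
    exact hs.tsum_eq.symm

/-- Power series as Laurent series. -/
abbrev ps : PowerSeries ℂ →+* LaurentSeries ℂ := HahnSeries.ofPowerSeries ℤ ℂ

/-- The monomial `x ^ n`. -/
abbrev xpow (n : ℤ) : LaurentSeries ℂ := HahnSeries.single n (1 : ℂ)

theorem xpow_mul_xpow (a b : ℤ) : xpow a * xpow b = xpow (a + b) := by
  rw [HahnSeries.single_mul_single, one_mul]

theorem xpow_zero : xpow 0 = 1 := rfl

theorem coeff_xpow_mul (a n : ℤ) (A : LaurentSeries ℂ) :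
    (xpow a * A).coeff n = A.coeff (n - a) := by
  have := HahnSeries.coeff_single_mul_add (r := (1 : ℂ)) (x := A) (a := n - a) (b := a)
  rwa [sub_add_cancel, one_mul] at this

theorem ps_X_pow (n : ℕ) : ps (PowerSeries.X ^ n) = xpow n :=
  HahnSeries.ofPowerSeries_X_pow n

theorem coeff_ps_natCast (P : PowerSeries ℂ) (n : ℕ) : (ps P).coeff n = PowerSeries.coeff n P :=
  HahnSeries.ofPowerSeries_apply_coeff P n

theorem coeff_ps_neg (P : PowerSeries ℂ) (n : ℤ) (hn : n < 0) : (ps P).coeff n = 0 := by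
  rw [PowerSeries.coeff_coe, if_pos hn]

/-- The Laurent series `A` in `x = s ^ 2` is the expansion of the even function `f` of `s` at the
origin. -/
def HasExp (f : ℂ → ℂ) (A : LaurentSeries ℂ) : Prop :=
  ∃ (N : ℕ) (P : PowerSeries ℂ) (G : ℂ → ℂ), PSum P G ∧ A = xpow (-N) * ps P ∧
    ∀ᶠ s in 𝓝[≠] (0 : ℂ), (s ^ 2) ^ N * f s = G (s ^ 2)

theorem HasExp.congr {f g : ℂ → ℂ} {A : LaurentSeries ℂ} (hf : HasExp f A)
    (h : ∀ᶠ s in 𝓝[≠] (0 : ℂ), g s = f s) : HasExp g A := by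
  obtain ⟨N, P, G, h1, h2, h3⟩ := hf
  refine ⟨N, P, G, h1, h2, ?_⟩
  filter_upwards [h, h3] with s h4 h5
  rw [h4, h5]

theorem PSum.hasExp {P : PowerSeries ℂ} {G : ℂ → ℂ} (h : PSum P G) :
    HasExp (fun s => G (s ^ 2)) (ps P) :=
  ⟨0, P, G, h, by simp, by simp⟩

theorem HasExp.mul {f g : ℂ → ℂ} {A B : LaurentSeries ℂ} (hf : HasExp f A) (hg : HasExp g B) :
    HasExp (fun s => f s * g s) (A * B) := by
  obtain ⟨N, P, G, h1, h2, h3⟩ := hf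
  obtain ⟨M, Q, H, h4, h5, h6⟩ := hg
  refine ⟨N + M, P * Q, _, h1.mul h4, ?_, ?_⟩
  · rw [h2, h5, map_mul, Nat.cast_add, neg_add, ← xpow_mul_xpow]
    ring
  · filter_upwards [h3, h6] with s h7 h8
    rw [← h7, ← h8]
    ring

theorem HasExp.add {f g : ℂ → ℂ} {A B : LaurentSeries ℂ} (hf : HasExp f A) (hg : HasExp g B) :
    HasExp (fun s => f s + g s) (A + B) := by
  obtain ⟨N, P, G, h1, h2, h3⟩ := hf
  obtain ⟨M, Q, H, h4, h5, h6⟩ := hg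
  refine ⟨N + M, PowerSeries.X ^ M * P + PowerSeries.X ^ N * Q, _,
    ((psum_X_pow M).mul h1).add ((psum_X_pow N).mul h4), ?_, ?_⟩
  · rw [h2, h5, map_add, map_mul, map_mul, ps_X_pow, ps_X_pow, mul_add, ← mul_assoc, ← mul_assoc,
      xpow_mul_xpow, xpow_mul_xpow]
    congr 3 <;> push_cast <;> ring_nf
  · filter_upwards [h3, h6] with s h7 h8
    rw [← h7, ← h8]
    ring

theorem hasExp_const (a : ℂ) : HasExp (fun _ => a) (HahnSeries.C a) := by
  have := (psum_C a).hasExp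
  rwa [ps, HahnSeries.ofPowerSeries_C] at this

theorem HasExp.const_mul {f : ℂ → ℂ} {A : LaurentSeries ℂ} (a : ℂ) (hf : HasExp f A) :
    HasExp (fun s => a * f s) (HahnSeries.C a * A) := (hasExp_const a).mul hf

theorem HasExp.neg {f : ℂ → ℂ} {A : LaurentSeries ℂ} (hf : HasExp f A) :
    HasExp (fun s => -f s) (-A) := by
  have := hf.const_mul (-1)
  simpa using this

theorem HasExp.sub {f g : ℂ → ℂ} {A B : LaurentSeries ℂ} (hf : HasExp f A) (hg : HasExp g B) :
    HasExp (fun s => f s - g s) (A - B) := by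
  simpa [sub_eq_add_neg] using hf.add hg.neg

theorem hasExp_zero : HasExp (fun _ => 0) 0 := by
  simpa using hasExp_const 0

theorem hasExp_one : HasExp (fun _ => 1) 1 := by
  simpa using hasExp_const 1

theorem HasExp.pow {f : ℂ → ℂ} {A : LaurentSeries ℂ} (hf : HasExp f A) (n : ℕ) :
    HasExp (fun s => f s ^ n) (A ^ n) := by
  induction n with
  | zero => simpa using hasExp_one
  | succ n ih => simpa [pow_succ] using ih.mul hf

theorem hasExp_sum {τ : Type*} (S : Finset τ) {f : τ → ℂ → ℂ} {A : τ → LaurentSeries ℂ}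
    (h : ∀ t ∈ S, HasExp (f t) (A t)) : HasExp (fun s => ∑ t ∈ S, f t s) (∑ t ∈ S, A t) := by
  classical
  induction S using Finset.induction_on with
  | empty => simpa using hasExp_zero
  | insert a S ha ih =>
    simp only [Finset.sum_insert ha]
    exact (h a (Finset.mem_insert_self _ _)).add
      (ih fun t ht => h t (Finset.mem_insert_of_mem ht))

theorem HasExp.unique {f : ℂ → ℂ} {A B : LaurentSeries ℂ} (hA : HasExp f A) (hB : HasExp f B) :
    A = B := by
  obtain ⟨N, P, G, h1, h2, h3⟩ := hA.sub hB
  have hP : P = PowerSeries.C 0 := h1.unique (psum_C 0) <| eventually_of_sq <| by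
    filter_upwards [h3] with s hs
    rw [← hs]; ring
  rw [hP, map_zero, map_zero, mul_zero] at h2
  exact sub_eq_zero.mp h2

theorem hasExp_xpow (n : ℕ) : HasExp (fun s => (s ^ 2) ^ n) (xpow n) := by
  have := (psum_X_pow n).hasExp
  rwa [ps_X_pow] at this

theorem hasExp_xpow_neg (n : ℕ) : HasExp (fun s => ((s ^ 2) ^ n)⁻¹) (xpow (-n)) := by
  refine ⟨n, 1, _, by simpa using psum_C 1, by simp, ?_⟩
  filter_upwards [self_mem_nhdsWithin] with s hs
  exact mul_inv_cancel₀ (pow_ne_zero _ (pow_ne_zero _ hs))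

/-- Removal of the singularity: the witness may carry a superfluous power `x ^ N`, which divides its
series. Defining `G` by the sum of `P` gives the right value at the origin, where `f` is
unconstrained. -/
theorem HasExp.exists_psum {f : ℂ → ℂ} {P : PowerSeries ℂ} (h : HasExp f (ps P)) :
    ∃ G, PSum P G ∧ ∀ᶠ s in 𝓝[≠] (0 : ℂ), f s = G (s ^ 2) := by
  obtain ⟨N, Q, H, h1, h2, h3⟩ := h
  have hQ : Q = PowerSeries.X ^ N * P := by
    have : ps Q = ps (PowerSeries.X ^ N * P) := by
      rw [map_mul, ps_X_pow, h2, ← mul_assoc, xpow_mul_xpow, add_neg_cancel, xpow_zero, one_mul]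
    exact HahnSeries.ofPowerSeries_injective this
  refine ⟨fun x => ∑' k : ℕ, PowerSeries.coeff k P * x ^ k, ?_, ?_⟩
  all_goals
    have key : ∀ᶠ x in 𝓝[≠] (0 : ℂ),
        HasSum (fun k : ℕ => PowerSeries.coeff k P * x ^ k) ((x ^ N)⁻¹ * H x) := by
      filter_upwards [h1.filter_mono nhdsWithin_le_nhds, self_mem_nhdsWithin] with x hx hx0
      rw [← hasSum_nat_add_iff' N, Finset.sum_eq_zero, sub_zero] at hx
      · have := hx.mul_left (x ^ N)⁻¹
        refine this.congr_fun fun k => ?_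
        rw [hQ, PowerSeries.coeff_X_pow_mul, pow_add]
        have : x ^ N ≠ 0 := pow_ne_zero _ hx0
        field_simp
      · intro i hi
        rw [hQ, PowerSeries.coeff_X_pow_mul', if_neg (by simpa using hi), zero_mul]
  · have h0 : HasSum (fun k : ℕ => PowerSeries.coeff k P * (0 : ℂ) ^ k)
        (∑' k : ℕ, PowerSeries.coeff k P * (0 : ℂ) ^ k) := by
      refine Summable.hasSum (summable_of_ne_finset_zero (s := {0}) fun k hk => ?_)
      simp at hk
      simp [hk]
    rw [eventually_nhdsWithin_iff] at key
    filter_upwards [key] with x hx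
    by_cases hx0 : x = 0
    · rw [hx0]; exact h0
    · exact (hx hx0).summable.hasSum
  · filter_upwards [tendsto_sq_punctured.eventually key, h3, self_mem_nhdsWithin] with s hs hs3 hs0
    rw [hs.tsum_eq, ← hs3, inv_mul_cancel_left₀ (pow_ne_zero _ (pow_ne_zero _ hs0))]

theorem HasExp.inv {f : ℂ → ℂ} {P : PowerSeries ℂ} (h : HasExp f (ps P))
    (h0 : PowerSeries.constantCoeff P ≠ 0) : HasExp (fun s => (f s)⁻¹) (ps P⁻¹) := by
  obtain ⟨G, h1, h2⟩ := h.exists_psum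
  refine (h1.inv h0).hasExp.congr ?_
  filter_upwards [h2] with s hs
  rw [hs]

/-- The even part of an analytic function. -/
theorem hasExp_even_part {f : ℂ → ℂ} (hf : AnalyticAt ℂ f 0) :
    HasExp (fun s => (f s + f (-s)) / 2)
      (ps (PowerSeries.mk fun k => iteratedDeriv (2 * k) f 0 / (2 * k).factorial)) := by
  have h1 := psum_of_analyticAt hf
  have hn : Tendsto (fun s : ℂ => -s) (𝓝 0) (𝓝 0) := by
    have := (continuous_neg (G := ℂ)).tendsto 0
    rwa [neg_zero] at this
  obtain ⟨G, hG, hG2⟩ := exists_psum_of_sq (f := fun s => (f s + f (-s)) / 2)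
    (P := PowerSeries.mk fun k => iteratedDeriv (2 * k) f 0 / (2 * k).factorial) (by
      filter_upwards [h1, hn.eventually h1] with s hs hs'
      have h2 := (hs.add hs').mul_right (1 / 2 : ℂ)
      rw [← Function.Injective.hasSum_iff (g := fun k : ℕ => 2 * k)
        (fun a b hab => by simpa using hab)] at h2
      · refine hasSum_congr h2 ?_ ?_
        · intro k
          simp only [Function.comp_apply, PowerSeries.coeff_mk, pow_mul, neg_sq]
          ring
        · ring
      · intro k hk
        have hodd : Odd k := by
          rw [← Nat.not_even_iff_odd]
          rintro ⟨l, rfl⟩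
          exact hk ⟨l, by simp; ring⟩
        rw [hodd.neg_pow]; ring)
  refine hG.hasExp.congr ?_
  exact hG2.filter_mono nhdsWithin_le_nhds

/-- The odd part of an analytic function. -/
theorem hasExp_odd_part {f : ℂ → ℂ} (hf : AnalyticAt ℂ f 0) :
    HasExp (fun s => (f s - f (-s)) / 2 / s)
      (ps (PowerSeries.mk fun k => iteratedDeriv (2 * k + 1) f 0 / (2 * k + 1).factorial)) := by
  have h1 := psum_of_analyticAt hf
  have hn : Tendsto (fun s : ℂ => -s) (𝓝 0) (𝓝 0) := by
    have := (continuous_neg (G := ℂ)).tendsto 0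
    rwa [neg_zero] at this
  have key : ∀ᶠ s in 𝓝[≠] (0 : ℂ), HasSum (fun k : ℕ => PowerSeries.coeff k
      (PowerSeries.mk fun k => iteratedDeriv (2 * k + 1) f 0 / (2 * k + 1).factorial) * (s ^ 2) ^ k)
      ((f s - f (-s)) / 2 / s) := by
    filter_upwards [h1.filter_mono nhdsWithin_le_nhds,
      (hn.eventually h1).filter_mono nhdsWithin_le_nhds, self_mem_nhdsWithin] with s hs hs' hs0
    have hs0' : s ≠ 0 := hs0
    have h2 := (hs.sub hs').mul_right (1 / (2 * s) : ℂ)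
    rw [← Function.Injective.hasSum_iff (g := fun k : ℕ => 2 * k + 1)
      (fun a b hab => by simpa using hab)] at h2
    · refine hasSum_congr h2 ?_ ?_
      · intro k
        simp only [Function.comp_apply, PowerSeries.coeff_mk, pow_succ, pow_mul]
        field_simp
        ring
      · field_simp
    · intro k hk
      have heven : Even k := by
        rw [← Nat.not_odd_iff_even]
        rintro ⟨l, rfl⟩
        exact hk ⟨l, rfl⟩
      rw [heven.neg_pow]; ring
  -- The quotient by `s` is filled in at `s = 0`, since the squaring lemma needs the series to
  -- converge to the function there as well.
  obtain ⟨G, hG, hG2⟩ := exists_psum_of_sq (f := fun s => if s = 0 then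
      iteratedDeriv 1 f 0 else (f s - f (-s)) / 2 / s)
    (P := PowerSeries.mk fun k => iteratedDeriv (2 * k + 1) f 0 / (2 * k + 1).factorial) (by
      rw [eventually_nhdsWithin_iff] at key
      filter_upwards [key] with s hs
      by_cases hs0 : s = 0
      · rw [if_pos hs0, hs0]
        have := hasSum_single (f := fun k : ℕ => PowerSeries.coeff k (PowerSeries.mk fun k =>
          iteratedDeriv (2 * k + 1) f 0 / (2 * k + 1).factorial) * ((0 : ℂ) ^ 2) ^ k) 0
          fun k hk => by simp [hk]
        simpa using this
      · rw [if_neg hs0]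
        exact hs hs0)
  refine hG.hasExp.congr ?_
  filter_upwards [hG2.filter_mono nhdsWithin_le_nhds, self_mem_nhdsWithin] with s hs hs0
  have hs0' : s ≠ 0 := hs0
  rw [← hs, if_neg hs0']

end EynardOrantin

end

/-! ### Residues computed in the logarithmic coordinate. -/

noncomputable section

namespace EynardOrantin

open Filter Topology

/-- The circle integrals around `a` of small radius exist and are given by the residue `c`. -/
def HasRes (g : ℂ → ℂ) (a c : ℂ) : Prop :=
  ∀ᶠ r in 𝓝[>] (0 : ℝ), CircleIntegrable g a r ∧
    (∮ w in C(a, r), g w) = 2 * (Real.pi : ℂ) * Complex.I * c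

theorem HasRes.residue_eq {g : ℂ → ℂ} {a c : ℂ} (h : HasRes g a c) : residue g a = c := by
  refine Tendsto.limUnder_eq (tendsto_const_nhds.congr' ?_)
  filter_upwards [h] with r hr
  rw [hr.2, inv_mul_cancel_left₀ Complex.two_pi_I_ne_zero]

theorem eventually_sphere {p : ℂ → Prop} {a : ℂ} (h : ∀ᶠ w in 𝓝[≠] a, p w) :
    ∀ᶠ r in 𝓝[>] (0 : ℝ), ∀ w ∈ Metric.sphere a |r|, p w := by
  rw [eventually_nhdsWithin_iff, Metric.eventually_nhds_iff] at h
  obtain ⟨ε, hε, h⟩ := h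
  filter_upwards [Ioo_mem_nhdsGT hε] with r hr w hw
  rw [mem_sphere_iff_norm, abs_of_pos hr.1] at hw
  refine h (by rw [dist_eq_norm, hw]; exact hr.2) fun hwa => ?_
  rw [Set.mem_singleton_iff] at hwa
  rw [hwa, sub_self, norm_zero] at hw
  exact hr.1.ne hw

theorem HasRes.congr {f g : ℂ → ℂ} {a c : ℂ} (hf : HasRes f a c) (h : ∀ᶠ w in 𝓝[≠] a, g w = f w) :
    HasRes g a c := by
  filter_upwards [hf, eventually_sphere h, self_mem_nhdsWithin] with r hr hr2 hr0
  have hr0' : (0 : ℝ) < r := hr0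
  rw [abs_of_pos hr0'] at hr2
  refine ⟨(circleIntegrable_congr ?_).mpr hr.1, ?_⟩
  · rw [abs_of_pos hr0']
    exact hr2
  · rw [← hr.2]
    exact circleIntegral.integral_congr hr0'.le hr2

theorem HasRes.add {f g : ℂ → ℂ} {a c d : ℂ} (hf : HasRes f a c) (hg : HasRes g a d) :
    HasRes (fun w => f w + g w) a (c + d) := by
  filter_upwards [hf, hg] with r hr hr2
  refine ⟨hr.1.add hr2.1, ?_⟩
  rw [circleIntegral.integral_add hr.1 hr2.1, hr.2, hr2.2, mul_add]

theorem HasRes.const_mul {f : ℂ → ℂ} {a c : ℂ} (b : ℂ) (hf : HasRes f a c) :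
    HasRes (fun w => b * f w) a (b * c) := by
  filter_upwards [hf] with r hr
  refine ⟨hr.1.const_smul (a := b), ?_⟩
  rw [circleIntegral.integral_const_mul, hr.2]
  ring

theorem hasRes_zero (a : ℂ) : HasRes (fun _ => 0) a 0 := by
  refine Eventually.of_forall fun r => ⟨circleIntegrable_const 0 a r, ?_⟩
  simp [circleIntegral]

theorem hasRes_sum {τ : Type*} (S : Finset τ) {f : τ → ℂ → ℂ} {a : ℂ} {c : τ → ℂ}
    (h : ∀ t ∈ S, HasRes (f t) a (c t)) : HasRes (fun w => ∑ t ∈ S, f t w) a (∑ t ∈ S, c t) := by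
  classical
  induction S using Finset.induction_on with
  | empty => simpa using hasRes_zero a
  | insert b S hb ih =>
    simp only [Finset.sum_insert hb]
    exact (h b (Finset.mem_insert_self _ _)).add
      (ih fun t ht => h t (Finset.mem_insert_of_mem ht))

theorem hasRes_deriv {F g : ℂ → ℂ} {a : ℂ} (h : ∀ᶠ w in 𝓝[≠] a, HasDerivAt F (g w) w)
    (hg : ∀ᶠ w in 𝓝[≠] a, ContinuousAt g w) : HasRes g a 0 := by
  filter_upwards [eventually_sphere h, eventually_sphere hg] with r hr hr2
  refine ⟨ContinuousOn.circleIntegrable' fun w hw => (hr2 w hw).continuousWithinAt, ?_⟩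
  rw [mul_zero]
  exact circleIntegral.integral_eq_zero_of_hasDerivWithinAt' fun w hw =>
    (hr w hw).hasDerivWithinAt

theorem hasRes_simple_pole {φ : ℂ → ℂ} {a : ℂ} (hφ : AnalyticAt ℂ φ a) :
    HasRes (fun w => (w - a)⁻¹ * φ w) a (φ a) := by
  obtain ⟨ε, hε, h⟩ := Metric.eventually_nhds_iff.mp hφ.eventually_analyticAt
  filter_upwards [Ioo_mem_nhdsGT hε] with r hr
  have hd : ∀ w ∈ Metric.closedBall a r, AnalyticAt ℂ φ w := fun w hw =>
    h (lt_of_le_of_lt hw hr.2)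
  constructor
  · refine ContinuousOn.circleIntegrable hr.1.le fun w hw => ContinuousAt.continuousWithinAt ?_
    have hwa : w - a ≠ 0 := by
      intro h0
      rw [mem_sphere_iff_norm, h0, norm_zero] at hw
      exact hr.1.ne hw
    exact ((continuousAt_id.sub continuousAt_const).inv₀ hwa).mul
      (hd w (Metric.sphere_subset_closedBall hw)).continuousAt
  · have := DifferentiableOn.circleIntegral_sub_inv_smul (f := φ) (c := a) (R := r) (w := a)
      (fun w hw => (hd w hw).differentiableAt.differentiableWithinAt)
      (Metric.mem_ball_self hr.1)
    simpa only [smul_eq_mul] using this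

theorem hasRes_of_analyticAt {φ : ℂ → ℂ} {a : ℂ} (hφ : AnalyticAt ℂ φ a) : HasRes φ a 0 := by
  have h := hasRes_simple_pole (φ := fun w => (w - a) * φ w) (a := a) (by fun_prop)
  rw [sub_self, zero_mul] at h
  refine h.congr ?_
  filter_upwards [self_mem_nhdsWithin] with w hw
  rw [inv_mul_cancel_left₀ (sub_ne_zero.mpr hw)]

/-- The sign `β` as a complex number. -/
abbrev sgn (β : ℤˣ) : ℂ := ((β : ℤ) : ℂ)

theorem sgn_mul_self (β : ℤˣ) : sgn β * sgn β = 1 := by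
  rcases Int.units_eq_one_or β with rfl | rfl <;> simp [sgn]

theorem sgn_ne_zero (β : ℤˣ) : sgn β ≠ 0 := left_ne_zero_of_mul_eq_one (sgn_mul_self β)

theorem sgn_inv (β : ℤˣ) : (sgn β)⁻¹ = sgn β :=
  inv_eq_of_mul_eq_one_left (sgn_mul_self β)

theorem sgn_sq (β : ℤˣ) : sgn β ^ 2 = 1 := by rw [pow_two, sgn_mul_self]

theorem sgn_mul (α β : ℤˣ) : sgn (α * β) = sgn α * sgn β := by simp [sgn]

/-- The local coordinate at the branch point `β`. -/
def coordLog (β : ℤˣ) (w : ℂ) : ℂ := Complex.log (sgn β * w)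

theorem coordLog_self (β : ℤˣ) : coordLog β (sgn β) = 0 := by
  rw [coordLog, sgn_mul_self, Complex.log_one]

theorem eventually_mem_slitPlane (β : ℤˣ) : ∀ᶠ w in 𝓝 (sgn β), sgn β * w ∈ Complex.slitPlane := by
  have h : ContinuousAt (fun w => sgn β * w) (sgn β) := by fun_prop
  refine h.eventually_mem (Complex.isOpen_slitPlane.mem_nhds ?_)
  rw [sgn_mul_self]
  exact Complex.one_mem_slitPlane

theorem hasDerivAt_coordLog (β : ℤˣ) {w : ℂ} (hw : sgn β * w ∈ Complex.slitPlane) :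
    HasDerivAt (coordLog β) w⁻¹ w := by
  have h := ((hasDerivAt_id w).const_mul (sgn β)).clog hw
  have hb := sgn_ne_zero β
  have hw0 : w ≠ 0 := right_ne_zero_of_mul (Complex.slitPlane_ne_zero hw)
  refine HasDerivAt.congr_deriv (f := coordLog β) h ?_
  simp only [id]
  field_simp

theorem analyticAt_coordLog (β : ℤˣ) : AnalyticAt ℂ (coordLog β) (sgn β) := by
  have : AnalyticAt ℂ (fun w => sgn β * w) (sgn β) := by fun_prop
  refine this.clog ?_
  rw [sgn_mul_self]
  exact Complex.one_mem_slitPlane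

theorem sgn_mul_exp_coordLog (β : ℤˣ) {w : ℂ} (hw : sgn β * w ∈ Complex.slitPlane) :
    sgn β * Complex.exp (coordLog β w) = w := by
  rw [coordLog, Complex.exp_log (Complex.slitPlane_ne_zero hw), ← mul_assoc, sgn_mul_self, one_mul]

theorem tendsto_coordLog (β : ℤˣ) : Tendsto (coordLog β) (𝓝[≠] (sgn β)) (𝓝[≠] 0) := by
  refine tendsto_nhdsWithin_of_tendsto_nhds_of_eventually_within _ ?_ ?_
  · have := (analyticAt_coordLog β).continuousAt.tendsto
    rw [coordLog_self] at this
    exact this.mono_left nhdsWithin_le_nhds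
  · filter_upwards [self_mem_nhdsWithin,
      (eventually_mem_slitPlane β).filter_mono nhdsWithin_le_nhds] with w hw hw2 h0
    rw [Set.mem_singleton_iff] at h0
    have := sgn_mul_exp_coordLog β hw2
    rw [h0, Complex.exp_zero, mul_one] at this
    exact hw this.symm

/-- The form is `ds / s`: the coordinate has a simple zero at the branch point with derivative `1 /
w`, so the remaining factor has value `1` there. -/
theorem hasRes_coordLog_inv (β : ℤˣ) : HasRes (fun w => (coordLog β w)⁻¹ * w⁻¹) (sgn β) 1 := by
  set D := dslope (coordLog β) (sgn β) with hD
  have hDan : AnalyticAt ℂ D (sgn β) := by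
    obtain ⟨p, hp⟩ := analyticAt_coordLog β
    exact hp.has_fpower_series_dslope_fslope.analyticAt
  have hDa : D (sgn β) = (sgn β)⁻¹ := by
    rw [hD, dslope_same]
    exact (hasDerivAt_coordLog β (eventually_mem_slitPlane β).self_of_nhds).deriv
  have hD0 : sgn β * D (sgn β) = 1 := by rw [hDa, mul_inv_cancel₀ (sgn_ne_zero β)]
  have h := hasRes_simple_pole (φ := fun w => (w * D w)⁻¹) (a := sgn β)
    ((analyticAt_id.mul hDan).inv (by simp [hD0]))
  simp only [hD0, inv_one] at h
  refine h.congr ?_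
  filter_upwards [self_mem_nhdsWithin] with w hw
  have h2 : coordLog β w = (w - sgn β) * D w := by
    have := sub_smul_dslope (coordLog β) (sgn β) w
    rw [coordLog_self, sub_zero, smul_eq_mul] at this
    exact this.symm
  rw [h2, mul_inv, mul_inv]
  ring

/-- `ds / s ^ (n + 2)` has a primitive. -/
theorem hasRes_coordLog_pow (β : ℤˣ) (n : ℕ) :
    HasRes (fun w => ((coordLog β w) ^ (n + 2))⁻¹ * w⁻¹) (sgn β) 0 := by
  have hev : ∀ᶠ w in 𝓝[≠] (sgn β), coordLog β w ≠ 0 ∧ w ≠ 0 ∧ HasDerivAt (coordLog β) w⁻¹ w := by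
    filter_upwards [(tendsto_coordLog β).eventually self_mem_nhdsWithin,
      (eventually_mem_slitPlane β).filter_mono nhdsWithin_le_nhds] with w hw hw2
    exact ⟨hw, right_ne_zero_of_mul (Complex.slitPlane_ne_zero hw2), hasDerivAt_coordLog β hw2⟩
  refine hasRes_deriv (F := fun w => -((n : ℂ) + 1)⁻¹ * ((coordLog β w) ^ (n + 1))⁻¹) ?_ ?_
  · filter_upwards [hev] with w hw
    have h := ((hw.2.2.fun_pow (n + 1)).fun_inv (pow_ne_zero _ hw.1)).const_mul (-((n : ℂ) + 1)⁻¹)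
    refine h.congr_deriv ?_
    have h1 := hw.1
    have h2 := hw.2.1
    have h3 : (n : ℂ) + 1 ≠ 0 := Nat.cast_add_one_ne_zero n
    push_cast
    field_simp
    ring
  · filter_upwards [hev] with w hw
    exact ((hw.2.2.continuousAt.pow _).inv₀ (pow_ne_zero _ hw.1)).mul
      (continuousAt_id.inv₀ hw.2.1)

theorem PSum.exists_tail {P : PowerSeries ℂ} {G : ℂ → ℂ} (h : PSum P G) (N : ℕ) :
    ∃ H : ℂ → ℂ, AnalyticAt ℂ H 0 ∧ ∀ᶠ x in 𝓝 (0 : ℂ),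
      G x = ∑ k ∈ Finset.range N, PowerSeries.coeff k P * x ^ k + x ^ N * H x := by
  induction N with
  | zero => exact ⟨G, h.analyticAt, by simp⟩
  | succ N ih =>
    obtain ⟨H, hH, hG⟩ := ih
    have hHan : AnalyticAt ℂ (dslope H 0) 0 := by
      obtain ⟨p, hp⟩ := hH
      exact hp.has_fpower_series_dslope_fslope.analyticAt
    have hc : H 0 = PowerSeries.coeff N P := by
      have h1 : PSum (∑ k ∈ Finset.range N, PowerSeries.C (PowerSeries.coeff k P) * PowerSeries.X ^ k +
          PowerSeries.X ^ N * PowerSeries.mk fun n => iteratedDeriv n H 0 / n.factorial)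
          (fun x => ∑ k ∈ Finset.range N, PowerSeries.coeff k P * x ^ k + x ^ N * H x) := by
        refine PSum.add ?_ ((psum_X_pow N).mul (psum_of_analyticAt hH))
        generalize hS : Finset.range N = S
        clear hS
        induction S using Finset.induction_on with
        | empty => simpa using psum_C 0
        | insert b S hb ih =>
          simp only [Finset.sum_insert hb]
          exact ((psum_C _).mul (psum_X_pow _)).add ih
      have h2 := h.unique h1 (hG.filter_mono nhdsWithin_le_nhds)
      have h3 := congrArg (PowerSeries.coeff N) h2
      rw [map_add, map_sum, Finset.sum_eq_zero, zero_add, PowerSeries.coeff_X_pow_mul',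
        if_pos le_rfl] at h3
      · simpa using h3.symm
      · intro k hk
        rw [PowerSeries.coeff_C_mul_X_pow, if_neg (Finset.mem_range.mp hk).ne']
    refine ⟨dslope H 0, hHan, ?_⟩
    filter_upwards [hG] with x hx
    have h2 : H x = H 0 + x * dslope H 0 x := by
      have := sub_smul_dslope H 0 x
      rw [sub_zero, smul_eq_mul] at this
      rw [this]; ring
    rw [hx, Finset.sum_range_succ, h2, hc]
    ring

/-- The residue of a form that is odd in the local coordinate `s`. -/
theorem residue_eq_coeff (β : ℤˣ) {g h : ℂ → ℂ} {A : LaurentSeries ℂ} (hh : HasExp h A)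
    (hg : ∀ᶠ s in 𝓝[≠] (0 : ℂ), g (sgn β * Complex.exp s) * (sgn β * Complex.exp s) = s * h s) :
    residue g (sgn β) = A.coeff (-1) := by
  obtain ⟨N, P, G, hP, hA, hG⟩ := hh
  obtain ⟨H, hH, hGH⟩ := hP.exists_tail N
  have hcoef : A.coeff (-1) = ∑ k ∈ Finset.range N,
      PowerSeries.coeff k P * if k + 1 = N then 1 else 0 := by
    rw [hA, coeff_xpow_mul]
    rcases N with _ | N
    · rw [coeff_ps_neg _ _ (by simp)]; simp
    · rw [show (-1 : ℤ) - -((N + 1 : ℕ) : ℤ) = (N : ℕ) by push_cast; ring, coeff_ps_natCast]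
      simp
  have hL0 : AnalyticAt ℂ (coordLog β) (sgn β) := analyticAt_coordLog β
  have hφ : AnalyticAt ℂ (fun w => coordLog β w * H (coordLog β w ^ 2) * w⁻¹) (sgn β) := by
    have h1 : AnalyticAt ℂ (fun w => H (coordLog β w ^ 2)) (sgn β) := by
      refine AnalyticAt.fun_comp ?_ (hL0.pow 2)
      simp only [coordLog_self]
      simpa using hH
    exact (hL0.mul h1).mul (analyticAt_id.inv (sgn_ne_zero β))
  -- The form `s h(s) ds` consists of the odd powers `s ^ -(2 (N - 1 - k) + 1)` and an analytic
  -- remainder; only the simple pole, at `k = N - 1`, has a residue.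
  have hres : HasRes (fun w => ∑ k ∈ Finset.range N, PowerSeries.coeff k P *
      ((coordLog β w ^ (2 * (N - 1 - k) + 1))⁻¹ * w⁻¹) +
      coordLog β w * H (coordLog β w ^ 2) * w⁻¹) (sgn β) (A.coeff (-1)) := by
    rw [hcoef, ← add_zero (∑ k ∈ Finset.range N, _)]
    refine (hasRes_sum _ fun k hk => ?_).add (hasRes_of_analyticAt hφ)
    refine HasRes.const_mul _ ?_
    rw [Finset.mem_range] at hk
    split_ifs with h1
    · rw [show 2 * (N - 1 - k) + 1 = 1 by omega]
      simpa using hasRes_coordLog_inv β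
    · rw [show 2 * (N - 1 - k) + 1 = (2 * (N - 1 - k) - 1) + 2 by omega]
      exact hasRes_coordLog_pow β _
  refine (hres.congr ?_).residue_eq
  have hLt := tendsto_coordLog β
  filter_upwards [hLt.eventually hg, hLt.eventually hG,
    hLt.eventually (tendsto_sq_punctured.eventually (hGH.filter_mono nhdsWithin_le_nhds)),
    (eventually_mem_slitPlane β).filter_mono nhdsWithin_le_nhds,
    hLt.eventually self_mem_nhdsWithin] with w h1 h2 h3 h4 h5
  have h5' : coordLog β w ≠ 0 := h5
  have hw0 : w ≠ 0 := right_ne_zero_of_mul (Complex.slitPlane_ne_zero h4)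
  rw [sgn_mul_exp_coordLog β h4] at h1
  rw [h3] at h2
  generalize coordLog β w = L at *
  have h6 : h L = ∑ k ∈ Finset.range N, PowerSeries.coeff k P * ((L ^ 2) ^ (N - k))⁻¹ + H (L ^ 2) := by
    refine mul_left_cancel₀ (pow_ne_zero N (pow_ne_zero 2 h5')) ?_
    rw [h2, mul_add, Finset.mul_sum]
    congr 1
    refine Finset.sum_congr rfl fun k hk => ?_
    have : (L ^ 2) ^ N = (L ^ 2) ^ k * (L ^ 2) ^ (N - k) := by
      rw [← pow_add, Nat.add_sub_cancel' (Finset.mem_range.mp hk).le]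
    rw [this]
    field_simp
  rw [eq_div_of_mul_eq hw0 h1, h6, mul_add, add_div, Finset.mul_sum, Finset.sum_div]
  congr 1
  refine Finset.sum_congr rfl fun k hk => ?_
  have : (L ^ 2) ^ (N - k) = L * L ^ (2 * (N - 1 - k) + 1) := by
    rw [← pow_succ', ← pow_mul]
    congr 1
    have := Finset.mem_range.mp hk
    omega
  rw [this]
  field_simp

end EynardOrantin

end

/-! ### The basis forms with poles at the branch points. -/

noncomputable section

namespace EynardOrantin

open Filter Topology

/-- The expansion of `cosh (b * s)`. -/
def cosS (b : ℂ) : PowerSeries ℂ := PowerSeries.mk fun k => b ^ (2 * k) / (2 * k).factorial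

/-- The expansion of `sinh (b * s) / s`. -/
def sinS (b : ℂ) : PowerSeries ℂ := PowerSeries.mk fun k => b ^ (2 * k + 1) / (2 * k + 1).factorial

theorem hasExp_cosh (b : ℂ) : HasExp (fun s => Complex.cosh (b * s)) (ps (cosS b)) := by
  obtain ⟨G, hG, hG2⟩ := exists_psum_of_sq (P := cosS b) (f := fun s => Complex.cosh (b * s))
    (Eventually.of_forall fun s => hasSum_congr (Complex.hasSum_cosh (b * s)) (fun k => by
      rw [cosS, PowerSeries.coeff_mk, mul_pow, pow_mul s]; ring) rfl)
  exact hG.hasExp.congr (hG2.filter_mono nhdsWithin_le_nhds)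

theorem hasExp_sinh (b : ℂ) : HasExp (fun s => Complex.sinh (b * s) / s) (ps (sinS b)) := by
  have key : ∀ s : ℂ, s ≠ 0 → HasSum (fun k : ℕ => PowerSeries.coeff k (sinS b) * (s ^ 2) ^ k)
      (Complex.sinh (b * s) / s) := fun s hs =>
    hasSum_congr ((Complex.hasSum_sinh (b * s)).div_const s) (fun k => by
      rw [sinS, PowerSeries.coeff_mk, mul_pow, pow_succ s (2 * k), pow_mul s]; field_simp) rfl
  obtain ⟨G, hG, hG2⟩ := exists_psum_of_sq (P := sinS b)
    (f := fun s => if s = 0 then b else Complex.sinh (b * s) / s)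
    (Eventually.of_forall fun s => by
      by_cases hs : s = 0
      · rw [if_pos hs, hs]
        have := hasSum_single (f := fun k : ℕ => PowerSeries.coeff k (sinS b) * ((0 : ℂ) ^ 2) ^ k) 0
          fun k hk => by simp [hk]
        simpa [sinS] using this
      · rw [if_neg hs]
        exact key s hs)
  refine hG.hasExp.congr ?_
  filter_upwards [hG2.filter_mono nhdsWithin_le_nhds, self_mem_nhdsWithin] with s hs hs0
  have hs0' : s ≠ 0 := hs0
  rw [← hs, if_neg hs0']

theorem constantCoeff_cosS (b : ℂ) : PowerSeries.constantCoeff (cosS b) = 1 := by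
  rw [← PowerSeries.coeff_zero_eq_constantCoeff_apply, cosS, PowerSeries.coeff_mk]; simp

theorem constantCoeff_sinS (b : ℂ) : PowerSeries.constantCoeff (sinS b) = b := by
  rw [← PowerSeries.coeff_zero_eq_constantCoeff_apply, sinS, PowerSeries.coeff_mk]; simp

/-- The even function `γ exp s / (1 - γ exp s) ^ 2` of `s`. -/
def base (γ : ℤˣ) (s : ℂ) : ℂ := sgn γ * Complex.exp s / (1 - sgn γ * Complex.exp s) ^ 2

/-- In this form both the evenness in `s` and the behaviour at the origin (a pole for `γ = 1`, none
for `γ = -1`) can be read off. -/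
theorem base_eq (γ : ℤˣ) (s : ℂ) : base γ s = sgn γ * (2 * Complex.cosh s - 2 * sgn γ)⁻¹ := by
  have h : (1 - sgn γ * Complex.exp s) ^ 2 =
      Complex.exp s * (2 * Complex.cosh s - 2 * sgn γ) := by
    have h1 : Complex.exp s * Complex.exp (-s) = 1 := by rw [← Complex.exp_add]; simp
    rw [Complex.cosh]
    linear_combination Complex.exp s ^ 2 * sgn_sq γ - h1
  rw [base, h, mul_div_assoc, div_eq_mul_inv, mul_inv, mul_inv_cancel_left₀ (Complex.exp_ne_zero s)]

theorem base_neg (γ : ℤˣ) (s : ℂ) : base γ (-s) = base γ s := by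
  rw [base_eq, base_eq, Complex.cosh_neg]

/-- The expansion of `(2 * cosh s - 2) / s ^ 2`. -/
def versS : PowerSeries ℂ := PowerSeries.mk fun k => 2 / (2 * k + 2).factorial

theorem X_mul_versS : PowerSeries.X * versS = 2 * cosS 1 - 2 := by
  ext k
  have h2 : (2 : PowerSeries ℂ) = PowerSeries.C 2 := (map_ofNat _ 2).symm
  rw [h2, map_sub, PowerSeries.coeff_C_mul, PowerSeries.coeff_C, cosS, PowerSeries.coeff_mk]
  cases k with
  | zero => simp
  | succ k =>
    rw [mul_comm, PowerSeries.coeff_succ_mul_X, versS, PowerSeries.coeff_mk, one_pow, if_neg (by simp),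
      show 2 * (k + 1) = 2 * k + 2 by ring]
    ring

/-- The expansion of `base γ`. -/
def psiL (γ : ℤˣ) : LaurentSeries ℂ :=
  if γ = 1 then xpow (-1) * ps versS⁻¹ else -ps (2 * cosS 1 + 2)⁻¹

theorem constantCoeff_versS : PowerSeries.constantCoeff versS = 1 := by
  rw [← PowerSeries.coeff_zero_eq_constantCoeff_apply, versS, PowerSeries.coeff_mk]; simp

theorem constantCoeff_two_mul_cosS : PowerSeries.constantCoeff (2 * cosS 1 + 2) = 4 := by
  rw [map_add, map_mul, constantCoeff_cosS, map_ofNat]; norm_num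

theorem hasExp_two_cosh : HasExp (fun s => 2 * Complex.cosh s) (ps (2 * cosS 1)) := by
  have := (hasExp_cosh 1).const_mul 2
  rw [map_mul, map_ofNat]
  simp only [one_mul] at this
  rwa [map_ofNat] at this

theorem hasExp_ofNat_two : HasExp (fun _ => 2) (ps 2) := by
  have := hasExp_const 2
  rw [map_ofNat] at this ⊢
  exact this

theorem hasExp_base (γ : ℤˣ) : HasExp (base γ) (psiL γ) := by
  rw [psiL]
  split_ifs with h
  · subst h
    have h1 := ((hasExp_two_cosh.sub hasExp_ofNat_two).mul (hasExp_xpow_neg 1))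
    rw [← map_sub, ← X_mul_versS, map_mul, mul_comm (ps _), mul_assoc, mul_comm (ps _)] at h1
    have h2 : HasExp (fun s => (2 * Complex.cosh s - 2) * ((s ^ 2) ^ 1)⁻¹) (ps versS) := by
      convert h1 using 1
      rw [← pow_one (PowerSeries.X), ps_X_pow, xpow_mul_xpow]
      simp
    have h3 := (hasExp_xpow_neg 1).mul (h2.inv (by rw [constantCoeff_versS]; exact one_ne_zero))
    refine h3.congr ?_
    filter_upwards [self_mem_nhdsWithin] with s hs
    have hs' : s ≠ 0 := hs
    rw [base_eq]
    simp [sgn]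
    field_simp
  · have hγ : γ = -1 := (Int.units_eq_one_or γ).resolve_left h
    subst hγ
    have h1 := (hasExp_two_cosh.add hasExp_ofNat_two)
    rw [← map_add] at h1
    refine (h1.inv (by rw [constantCoeff_two_mul_cosS]; norm_num)).neg.congr ?_
    refine Eventually.of_forall fun s => ?_
    rw [base_eq]
    simp [sgn]

/-- For `γ = 1` the pole is exactly `1 / s ^ 2` because `versS⁻¹` has constant coefficient `1` and
only even powers of `s` occur. -/
theorem exists_reg (γ : ℤˣ) : ∃ r : ℂ → ℂ, AnalyticAt ℂ r 0 ∧
    ∀ᶠ s in 𝓝[≠] (0 : ℂ), base γ s = (if γ = 1 then (s ^ 2)⁻¹ else 0) + r s := by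
  have key : ∃ P, HasExp (fun s => base γ s - if γ = 1 then (s ^ 2)⁻¹ else 0) (ps P) := by
    have h0 := hasExp_base γ
    rw [psiL] at h0
    split_ifs at h0 ⊢ with h
    · have h2 := h0.sub (hasExp_xpow_neg 1)
      simp only [pow_one] at h2
      refine ⟨PowerSeries.mk fun n => PowerSeries.coeff (n + 1) versS⁻¹, ?_⟩
      convert h2 using 1
      have e : versS⁻¹ = 1 + PowerSeries.X * PowerSeries.mk fun n => PowerSeries.coeff (n + 1) versS⁻¹ := by
        ext k
        cases k with
        | zero =>
          rw [map_add, PowerSeries.coeff_zero_X_mul, PowerSeries.coeff_zero_eq_constantCoeff_apply,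
            PowerSeries.constantCoeff_inv, constantCoeff_versS]
          simp
        | succ k => 
          rw [map_add, mul_comm, PowerSeries.coeff_succ_mul_X, PowerSeries.coeff_mk,
            PowerSeries.coeff_one, if_neg (by simp), zero_add]
      conv_rhs => rw [e]
      rw [map_add, map_one, map_mul, ← pow_one (PowerSeries.X), ps_X_pow, mul_add, ← mul_assoc,
        xpow_mul_xpow]
      simp
    · have h2 := h0.sub hasExp_zero
      rw [sub_zero, ← map_neg] at h2
      exact ⟨_, h2⟩
  obtain ⟨P, hP⟩ := key
  obtain ⟨G, hG, hG2⟩ := hP.exists_psum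
  refine ⟨fun s => G (s ^ 2), ?_, ?_⟩
  · refine AnalyticAt.fun_comp (g := G) ?_ (by fun_prop)
    simpa using hG.analyticAt
  · filter_upwards [hG2] with s hs
    rw [← hs]; ring

/-- The regular part of `base γ` at the origin. -/
def reg (γ : ℤˣ) : ℂ → ℂ := (exists_reg γ).choose

theorem analyticAt_reg (γ : ℤˣ) : AnalyticAt ℂ (reg γ) 0 := (exists_reg γ).choose_spec.1

theorem base_eq_reg (γ : ℤˣ) : ∀ᶠ s in 𝓝[≠] (0 : ℂ),
    base γ s = (if γ = 1 then (s ^ 2)⁻¹ else 0) + reg γ s := (exists_reg γ).choose_spec.2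

/-- The expansion coefficients of the regular parts of the basis forms. -/
def corr (i j : Idx) : ℂ :=
  iteratedDeriv (2 * i.2 + 2 * j.2) (reg (i.1 * j.1)) 0 / ((2 * i.2).factorial * (2 * j.2).factorial)

theorem corr_symm (i j : Idx) : corr i j = corr j i := by
  rw [corr, corr, add_comm, mul_comm i.1, mul_comm ((2 * i.2).factorial : ℂ)]

/-- The densities at `z` of the basis of odd forms with poles at the branch points. -/
def bVec (z : ℂ) (i : Idx) : ℂ :=
  iteratedDeriv (2 * i.2) (fun s => sgn i.1 * Complex.exp s / (sgn i.1 * Complex.exp s - z) ^ 2) 0 /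
    (2 * i.2).factorial

/-- In logarithmic coordinates the Bergmann kernel depends only on the difference `t - s`. -/
theorem mul_bVec (β : ℤˣ) (t : ℂ) (i : Idx) :
    sgn β * Complex.exp t * bVec (sgn β * Complex.exp t) i =
      iteratedDeriv (2 * i.2) (base (i.1 * β)) t / (2 * i.2).factorial := by
  have h : (fun s => sgn β * Complex.exp t * (sgn i.1 * Complex.exp s /
      (sgn i.1 * Complex.exp s - sgn β * Complex.exp t) ^ 2)) = fun s => base (i.1 * β) (t - s) := by
    funext s
    have h1 : (sgn i.1 * Complex.exp s - sgn β * Complex.exp t) ^ 2 =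
        Complex.exp s ^ 2 * (1 - sgn (i.1 * β) * Complex.exp (t - s)) ^ 2 := by
      have h2 : Complex.exp t = Complex.exp s * Complex.exp (t - s) := by
        rw [← Complex.exp_add]; simp
      rw [h2, sgn_mul]
      linear_combination (Complex.exp s ^ 2 - sgn β ^ 2 * Complex.exp s ^ 2 *
        Complex.exp (t - s) ^ 2) * sgn_sq i.1
    rw [h1, base, Complex.exp_sub, sgn_mul]
    have := Complex.exp_ne_zero s
    field_simp
  rw [bVec, ← mul_div_assoc, ← iteratedDeriv_const_mul_field, h, iteratedDeriv_comp_const_sub]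
  simp

/-- Inverting `w` amounts to `s ↦ -s`, which does not affect derivatives of even order. As `d(1/w) =
-dw / w ^ 2`, the basis form is odd under the involution. -/
theorem bVec_inv (w : ℂ) (hw : w ≠ 0) (i : Idx) : bVec w⁻¹ i = w ^ 2 * bVec w i := by
  have h : (fun s => sgn i.1 * Complex.exp s / (sgn i.1 * Complex.exp s - w⁻¹) ^ 2) = fun s =>
      w ^ 2 * (fun s => sgn i.1 * Complex.exp s / (sgn i.1 * Complex.exp s - w) ^ 2) (-s) := by
    funext s
    have h1 : (sgn i.1 * Complex.exp s - w⁻¹) ^ 2 * w ^ 2 =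
        Complex.exp s ^ 2 * (sgn i.1 * Complex.exp (-s) - w) ^ 2 := by
      have h2 : Complex.exp s * Complex.exp (-s) = 1 := by rw [← Complex.exp_add]; simp
      rw [← mul_pow, ← mul_pow, sub_mul, inv_mul_cancel₀ hw, mul_sub,
        mul_left_comm, h2]
      linear_combination (Complex.exp s ^ 2 * w ^ 2 - 1) * sgn_sq i.1
    have h3 : sgn i.1 * Complex.exp (-s) / (sgn i.1 * Complex.exp (-s) - w) ^ 2 =
        sgn i.1 * Complex.exp s / (Complex.exp s ^ 2 * (sgn i.1 * Complex.exp (-s) - w) ^ 2) := by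
      have := Complex.exp_ne_zero s
      rw [Complex.exp_neg]
      field_simp
    simp only []
    rw [h3, ← h1]
    field_simp
  rw [bVec, h, iteratedDeriv_const_mul_field, iteratedDeriv_comp_neg (2 * i.2)
    (fun s => sgn i.1 * Complex.exp s / (sgn i.1 * Complex.exp s - w) ^ 2), bVec]
  simp [mul_div_assoc]

/-- Divided by `(2 n)!`, the polar part becomes `(2 n + 1) x ^ (-(n + 1))`, the source of the
factors `2 k + 1` in `modeVec`. -/
theorem iteratedDeriv_base (γ : ℤˣ) (n : ℕ) : ∀ᶠ s in 𝓝[≠] (0 : ℂ),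
    iteratedDeriv (2 * n) (base γ) s =
      (if γ = 1 then (2 * n + 1).factorial * ((s ^ 2) ^ (n + 1))⁻¹ else 0) +
        iteratedDeriv (2 * n) (reg γ) s := by
  filter_upwards [eventually_eventually_nhdsWithin.mpr (base_eq_reg γ),
    (analyticAt_reg γ).eventually_analyticAt.filter_mono nhdsWithin_le_nhds,
    self_mem_nhdsWithin] with s hs hr hs0
  have hs0' : s ≠ 0 := hs0
  have h1 : base γ =ᶠ[𝓝 s] fun s => (if γ = 1 then (s ^ 2)⁻¹ else 0) + reg γ s := by
    rw [eventually_nhdsWithin_iff] at hs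
    filter_upwards [hs.filter_mono (le_refl _), isOpen_ne.mem_nhds hs0'] with t ht ht0
    exact ht ht0
  rw [h1.iteratedDeriv_eq]
  split_ifs with hγ
  · have e : (fun s : ℂ => (s ^ 2)⁻¹ + reg γ s) = (fun s : ℂ => s ^ (-2 : ℤ)) + reg γ := by
      funext s
      simp [zpow_neg]
    have hc : ContDiffAt ℂ (2 * n : ℕ) (fun s : ℂ => s ^ (-2 : ℤ)) s :=
      ((analyticAt_id (𝕜 := ℂ) (z := s)).zpow hs0').contDiffAt
    rw [e, iteratedDeriv_add hc hr.contDiffAt, iteratedDeriv_eq_iterate, iter_deriv_zpow]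
    congr 2
    · clear * -
      induction n with
      | zero => simp
      | succ n ih =>
        rw [show 2 * (n + 1) = 2 * n + 1 + 1 by ring, Finset.prod_range_succ, Finset.prod_range_succ,
          ih, Nat.factorial_succ (2 * n + 1 + 1), Nat.factorial_succ (2 * n + 1)]
        push_cast
        ring
    · rw [← pow_mul, ← zpow_natCast, ← zpow_neg]
      congr 1
      push_cast; ring
  · simp

end EynardOrantin

end

/-! ### Expansions at the branch points and the residue against the recursion kernel. -/

noncomputable section

namespace EynardOrantin

open Filter Topology

theorem coeff_C_mul_laurent (a : ℂ) (A : LaurentSeries ℂ) (n : ℤ) :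
    (HahnSeries.C a * A).coeff n = a * A.coeff n := by
  rw [HahnSeries.C_mul_eq_smul, HahnSeries.coeff_smul, smul_eq_mul]

theorem coeff_ps_mul_eq_zero (P : PowerSeries ℂ) (A : LaurentSeries ℂ) (n : ℤ)
    (h : ∀ j : ℕ, A.coeff (n - j) = 0) : (ps P * A).coeff n = 0 := by
  rw [HahnSeries.coeff_mul]
  refine Finset.sum_eq_zero fun x hx => ?_
  rw [Finset.mem_antidiagonal] at hx
  have h0 : ¬ x.1 < 0 := fun h0 => hx.1 (coeff_ps_neg P _ h0)
  have h1 := h x.1.toNat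
  rw [Int.toNat_of_nonneg (not_lt.mp h0), ← hx.2.2, add_sub_cancel_left] at h1
  rw [h1, mul_zero]

theorem coeff_ps_mul_shift (P : PowerSeries ℂ) (A : LaurentSeries ℂ) (n : ℤ) (L : ℕ) :
    (ps P * A).coeff n = ∑ k ∈ Finset.range L, PowerSeries.coeff k P * A.coeff (n - k) +
      (ps (PowerSeries.mk fun i => PowerSeries.coeff (i + L) P) * A).coeff (n - L) := by
  induction L with
  | zero =>
    simp only [Finset.range_zero, Finset.sum_empty, zero_add, add_zero, Nat.cast_zero, sub_zero]
    congr
    ext k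
    simp
  | succ L ih =>
    rw [ih, Finset.sum_range_succ, add_assoc]
    congr 1
    have e : (PowerSeries.mk fun i => PowerSeries.coeff (i + L) P) =
        PowerSeries.C (PowerSeries.coeff L P) + PowerSeries.X ^ 1 *
          PowerSeries.mk fun i => PowerSeries.coeff (i + (L + 1)) P := by
      ext k
      cases k with
      | zero => simp
      | succ k =>
        rw [map_add, pow_one, mul_comm, PowerSeries.coeff_succ_mul_X, PowerSeries.coeff_C,
          if_neg (by simp), zero_add, PowerSeries.coeff_mk, PowerSeries.coeff_mk]
        congr 1; ring_nf
    rw [e, map_add, map_mul, ps_X_pow, add_mul, mul_assoc, HahnSeries.coeff_add, coeff_xpow_mul,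
      ps, HahnSeries.ofPowerSeries_C, coeff_C_mul_laurent]
    congr 2
    push_cast; ring

theorem coeff_ps_mul (P : PowerSeries ℂ) (A : LaurentSeries ℂ) (n : ℤ) (L : ℕ)
    (h : ∀ j : ℕ, L ≤ j → A.coeff (n - j) = 0) :
    (ps P * A).coeff n = ∑ k ∈ Finset.range L, PowerSeries.coeff k P * A.coeff (n - k) := by
  rw [coeff_ps_mul_shift P A n L, coeff_ps_mul_eq_zero, add_zero]
  intro j
  rw [show n - L - j = n - ((L + j : ℕ) : ℤ) by push_cast; ring]
  exact h _ (Nat.le_add_right _ _)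

/-- The expansion at the branch point `β` of the basis form `i`. -/
def eL (β : ℤˣ) (i : Idx) : LaurentSeries ℂ :=
  (if i.1 = β then HahnSeries.C (2 * (i.2 : ℂ) + 1) * xpow (-((i.2 + 1 : ℕ) : ℤ)) else 0) +
    ps (PowerSeries.mk fun l => corr i (β, l))

theorem coeff_eL (β : ℤˣ) (i : Idx) (n : ℤ) : (eL β i).coeff n = modeVec corr β n i := by
  rw [eL, HahnSeries.coeff_add]
  cases n with
  | ofNat n =>
    have h1 : (if i.1 = β then HahnSeries.C (2 * (i.2 : ℂ) + 1) * xpow (-((i.2 + 1 : ℕ) : ℤ))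
        else (0 : LaurentSeries ℂ)).coeff (Int.ofNat n) = 0 := by
      split_ifs
      · rw [coeff_C_mul_laurent, HahnSeries.coeff_single_of_ne, mul_zero]
        simp only [Int.ofNat_eq_natCast]; omega
      · rfl
    rw [h1, zero_add, Int.ofNat_eq_natCast, coeff_ps_natCast, PowerSeries.coeff_mk, corr_symm]
    rfl
  | negSucc n =>
    rw [coeff_ps_neg _ _ (Int.negSucc_lt_zero n), add_zero,
      modeVec_of_neg _ _ _ (Int.negSucc_lt_zero n)]
    by_cases h : i.1 = β
    · rw [if_pos h, coeff_C_mul_laurent, HahnSeries.coeff_single]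
      by_cases h2 : i.2 = n
      · rw [if_pos (by rw [h2]; rfl), if_pos ⟨h, by rw [h2]; rfl⟩, mul_one]
      · rw [if_neg (by omega), if_neg (by omega), mul_zero]
    · rw [if_neg h, if_neg fun h2 => h h2.1]; rfl

/-- Near `β` the density is an even derivative of `base (i.1 * β)`, hence even; averaging the
regular part over `±s` costs nothing and turns its Taylor series into a series in `x` with
coefficients `corr`. -/
theorem hasExp_mul_bVec (β : ℤˣ) (i : Idx) :
    HasExp (fun t => sgn β * Complex.exp t * bVec (sgn β * Complex.exp t) i) (eL β i) := by
  have hγ : i.1 * β = 1 ↔ i.1 = β := by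
    rw [mul_eq_one_iff_eq_inv, Int.units_inv_eq_self]
  have hf : ((2 * i.2).factorial : ℂ) ≠ 0 := Nat.cast_ne_zero.mpr (Nat.factorial_ne_zero _)
  have ha : AnalyticAt ℂ (iteratedDeriv (2 * i.2) (reg (i.1 * β))) 0 := by
    rw [iteratedDeriv_eq_iterate]
    exact (analyticAt_reg _).iterated_deriv _
  have h1 := hasExp_even_part (ha.const_smul (c := ((2 * i.2).factorial : ℂ)⁻¹))
  have hr := iteratedDeriv_base (i.1 * β) i.2
  have hn : Tendsto (fun s : ℂ => -s) (𝓝[≠] 0) (𝓝[≠] 0) := by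
    refine tendsto_nhdsWithin_of_tendsto_nhds_of_eventually_within _ ?_ ?_
    · have := (continuous_neg (G := ℂ)).tendsto 0
      rw [neg_zero] at this
      exact this.mono_left nhdsWithin_le_nhds
    · filter_upwards [self_mem_nhdsWithin] with s hs
      exact neg_ne_zero.mpr hs
  have h2 : HasExp (fun s : ℂ => if i.1 = β then (2 * (i.2 : ℂ) + 1) * ((s ^ 2) ^ (i.2 + 1))⁻¹ else 0)
      (if i.1 = β then HahnSeries.C (2 * (i.2 : ℂ) + 1) * xpow (-((i.2 + 1 : ℕ) : ℤ)) else 0) := by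
    split_ifs
    · exact (hasExp_xpow_neg _).const_mul _
    · exact hasExp_zero
  have h3 := h2.add h1
  have e : (PowerSeries.mk fun k => iteratedDeriv (2 * k) (((2 * i.2).factorial : ℂ)⁻¹ •
      iteratedDeriv (2 * i.2) (reg (i.1 * β))) 0 / (2 * k).factorial) =
      PowerSeries.mk fun l => corr i (β, l) := by
    ext k
    rw [PowerSeries.coeff_mk, PowerSeries.coeff_mk, iteratedDeriv_const_smul_field, corr, add_comm,
      iteratedDeriv_eq_iterate, iteratedDeriv_eq_iterate, iteratedDeriv_eq_iterate,
      Function.iterate_add_apply, smul_eq_mul]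
    field_simp
  rw [e] at h3
  refine h3.congr ?_
  filter_upwards [hr, hn.eventually hr] with s hs hs'
  have heven : iteratedDeriv (2 * i.2) (base (i.1 * β)) (-s) =
      iteratedDeriv (2 * i.2) (base (i.1 * β)) s := by
    have := iteratedDeriv_comp_neg (2 * i.2) (base (i.1 * β)) s
    simp only [base_neg] at this
    rw [this]; simp
  rw [heven, hs, neg_sq] at hs'
  have hs'' := add_left_cancel hs'
  rw [mul_bVec, hs]
  simp only [Pi.smul_apply, smul_eq_mul, ← hs'', hγ]
  split_ifs
  · rw [Nat.factorial_succ]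
    push_cast
    field_simp
    ring
  · field_simp
    ring

/-- The expansion of the even part of the Bergmann kernel in one variable. -/
def bL (β : ℤˣ) (z : ℂ) : LaurentSeries ℂ := ps (PowerSeries.mk fun k => bVec z (β, k))

theorem analyticAt_bergmann (β : ℤˣ) {z : ℂ} (hz : z ≠ sgn β) :
    AnalyticAt ℂ (fun s => sgn β * Complex.exp s / (sgn β * Complex.exp s - z) ^ 2) 0 := by
  have h : (sgn β * Complex.exp 0 - z) ^ 2 ≠ 0 := by
    rw [Complex.exp_zero, mul_one]
    exact pow_ne_zero _ (sub_ne_zero.mpr hz.symm)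
  fun_prop (disch := assumption)

theorem hasExp_bergmann_even (β : ℤˣ) {z : ℂ} (hz : z ≠ sgn β) :
    HasExp (fun s => (sgn β * Complex.exp s / (sgn β * Complex.exp s - z) ^ 2 +
      sgn β * Complex.exp (-s) / (sgn β * Complex.exp (-s) - z) ^ 2) / 2) (bL β z) :=
  hasExp_even_part (analyticAt_bergmann β hz)

theorem hasExp_bergmann_odd (β : ℤˣ) {z : ℂ} (hz : z ≠ sgn β) :
    ∃ Q, HasExp (fun s => (sgn β * Complex.exp s / (sgn β * Complex.exp s - z) ^ 2 -
      sgn β * Complex.exp (-s) / (sgn β * Complex.exp (-s) - z) ^ 2) / 2 / s) (ps Q) :=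
  ⟨_, hasExp_odd_part (analyticAt_bergmann β hz)⟩

/-- The `s`-derivative of the primitive is the kernel density, so its odd Taylor coefficients are
the even ones of the density divided by `2 k + 1`. -/
theorem hasExp_bergmannPrimitive (β : ℤˣ) {z : ℂ} (hz : z ≠ sgn β) :
    HasExp (fun s => (bergmannPrimitive z (sgn β * Complex.exp s) -
      bergmannPrimitive z (sgn β * Complex.exp s)⁻¹) / 2 / s)
      (ps (PowerSeries.mk fun k => bVec z (β, k) / (2 * (k : ℂ) + 1))) := by
  have hz' : z - sgn β * Complex.exp 0 ≠ 0 := by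
    rw [Complex.exp_zero, mul_one]
    exact sub_ne_zero.mpr hz
  have hp : AnalyticAt ℂ (fun s => bergmannPrimitive z (sgn β * Complex.exp s)) 0 := by
    unfold bergmannPrimitive
    fun_prop (disch := assumption)
  have hd : deriv (fun s => bergmannPrimitive z (sgn β * Complex.exp s)) =ᶠ[𝓝 0]
      fun s => sgn β * Complex.exp s / (sgn β * Complex.exp s - z) ^ 2 := by
    have hc : ContinuousAt (fun s : ℂ => z - sgn β * Complex.exp s) 0 := by fun_prop
    filter_upwards [hc.eventually_ne hz'] with s hs
    have h1 := (hasDerivAt_bergmannPrimitive (sub_ne_zero.mp hs)).comp s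
      ((Complex.hasDerivAt_exp s).const_mul (sgn β))
    refine (HasDerivAt.deriv h1).trans ?_
    rw [bergmann, ← neg_sub z, neg_sq]
    ring
  have h := hasExp_odd_part hp
  have e : (PowerSeries.mk fun k => iteratedDeriv (2 * k + 1)
      (fun s => bergmannPrimitive z (sgn β * Complex.exp s)) 0 / (2 * k + 1).factorial) =
      PowerSeries.mk fun k => bVec z (β, k) / (2 * (k : ℂ) + 1) := by
    ext k
    rw [PowerSeries.coeff_mk, PowerSeries.coeff_mk, iteratedDeriv_succ', hd.iteratedDeriv_eq, bVec,
      Nat.factorial_succ]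
    push_cast
    rw [div_div, mul_comm ((2 * k).factorial : ℂ)]
  rw [e] at h
  refine h.congr (Eventually.of_forall fun s => ?_)
  rw [Complex.exp_neg, mul_inv, sgn_inv]

/-- `B(w, 1/w)` is `base 1` at `2 s`. Its double pole `1 / (2 s) ^ 2` and its constant term are the
two nonzero values of `virConst`. -/
theorem hasExp_bergmann_diag (β : ℤˣ) :
    ∃ A, HasExp (fun s => bergmann (sgn β * Complex.exp s) (sgn β * Complex.exp s)⁻¹) A ∧
      ∀ j : ℕ, A.coeff (-j) = virConst corr β j := by
  have hr : AnalyticAt ℂ (fun s => reg 1 (2 * s)) 0 := by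
    refine AnalyticAt.fun_comp (g := reg 1) ?_ (by fun_prop)
    simpa using analyticAt_reg 1
  have h1 := ((hasExp_xpow_neg 1).const_mul (1 / 4)).add (hasExp_even_part hr)
  have h2t : Tendsto (fun s : ℂ => 2 * s) (𝓝[≠] 0) (𝓝[≠] 0) := by
    refine tendsto_nhdsWithin_of_tendsto_nhds_of_eventually_within _ ?_ ?_
    · have : Continuous fun s : ℂ => 2 * s := by fun_prop
      have := this.tendsto 0
      rw [mul_zero] at this
      exact this.mono_left nhdsWithin_le_nhds
    · filter_upwards [self_mem_nhdsWithin] with s hs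
      exact mul_ne_zero two_ne_zero hs
  have hn : Tendsto (fun s : ℂ => -s) (𝓝[≠] 0) (𝓝[≠] 0) := by
    refine tendsto_nhdsWithin_of_tendsto_nhds_of_eventually_within _ ?_ ?_
    · have := (continuous_neg (G := ℂ)).tendsto 0
      rw [neg_zero] at this
      exact this.mono_left nhdsWithin_le_nhds
    · filter_upwards [self_mem_nhdsWithin] with s hs
      exact neg_ne_zero.mpr hs
  refine ⟨_, h1.congr ?_, ?_⟩
  · filter_upwards [h2t.eventually (base_eq_reg 1),
      hn.eventually (h2t.eventually (base_eq_reg 1))] with s hs hs'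
    rw [mul_neg, base_neg, hs, if_pos rfl, neg_sq] at hs'
    rw [if_pos rfl] at hs
    have h4 : bergmann (sgn β * Complex.exp s) (sgn β * Complex.exp s)⁻¹ = base 1 (2 * s) := by
      have he := Complex.exp_ne_zero s
      have hb := sgn_sq β
      have e1 : Complex.exp (2 * s) = Complex.exp s ^ 2 := by
        rw [← Complex.exp_nat_mul]; norm_num
      rw [bergmann, base, mul_inv, sgn_inv, ← mul_sub, mul_pow, hb, one_mul, e1]
      simp only [sgn, Units.val_one, Int.cast_one, one_mul]
      have h6 : (1 - Complex.exp s ^ 2) ^ 2 =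
          Complex.exp s ^ 2 * (Complex.exp s - (Complex.exp s)⁻¹) ^ 2 := by
        field_simp
        ring
      rw [h6, ← div_div, div_self (pow_ne_zero 2 he), one_div]
    have h5 := add_left_cancel hs'
    rw [h4, hs, mul_neg, ← h5]
    field_simp
    ring
  · intro j
    rw [HahnSeries.coeff_add, coeff_C_mul_laurent, HahnSeries.coeff_single, virConst]
    rcases j with _ | _ | j
    · rw [show (-((0 : ℕ) : ℤ)) = (0 : ℕ) by simp, coeff_ps_natCast]
      simp [corr]
    · rw [coeff_ps_neg _ _ (by simp)]
      simp
    · rw [coeff_ps_neg _ _ (by omega), if_neg (by omega), if_neg (by omega), if_neg (by omega)]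
      simp

/-- The expansion of `(y(w) - y(1/w)) (w - 1/w) / s ^ 2` for `y = w ^ m / m`. -/
def potS (m : ℕ) (β : ℤˣ) : PowerSeries ℂ :=
  PowerSeries.C (4 * sgn β ^ (m + 1) / m) * (sinS m * sinS 1)

theorem constantCoeff_potS {m : ℕ} (hm : 1 ≤ m) (β : ℤˣ) :
    PowerSeries.constantCoeff (potS m β) ≠ 0 := by
  have hm' : (m : ℂ) ≠ 0 := Nat.cast_ne_zero.mpr (by omega)
  rw [potS, map_mul, map_mul, constantCoeff_sinS, constantCoeff_sinS, PowerSeries.constantCoeff_C]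
  exact mul_ne_zero (div_ne_zero (mul_ne_zero (by norm_num) (pow_ne_zero _ (sgn_ne_zero β))) hm')
    (mul_ne_zero hm' one_ne_zero)

theorem sgn_mul_exp_pow_sub (β : ℤˣ) (n : ℕ) (s : ℂ) :
    (sgn β * Complex.exp s) ^ n - ((sgn β * Complex.exp s)⁻¹) ^ n =
      2 * sgn β ^ n * Complex.sinh (n * s) := by
  rw [mul_inv, sgn_inv, ← Complex.exp_neg, mul_pow, mul_pow, ← Complex.exp_nat_mul,
    ← Complex.exp_nat_mul, Complex.sinh]
  ring_nf

theorem hasExp_pot (m : ℕ) (β : ℤˣ) : HasExp (fun s =>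
    (ymon m (sgn β * Complex.exp s) - ymon m (sgn β * Complex.exp s)⁻¹) *
      (sgn β * Complex.exp s - (sgn β * Complex.exp s)⁻¹) / s ^ 2) (ps (potS m β)) := by
  have h := ((hasExp_sinh m).mul (hasExp_sinh 1)).const_mul (4 * sgn β ^ (m + 1) / m)
  rw [potS, map_mul, map_mul, ps, HahnSeries.ofPowerSeries_C]
  refine h.congr (Eventually.of_forall fun s => ?_)
  have h1 := sgn_mul_exp_pow_sub β 1 s
  rw [pow_one, pow_one, pow_one, Nat.cast_one] at h1
  rw [ymon, ymon, ← sub_div, sgn_mul_exp_pow_sub, h1]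
  ring

/-- The residue at a branch point in the topological recursion. -/
theorem residue_kernel {m : ℕ} (hm : 1 ≤ m) (β : ℤˣ) {z : ℂ} (hz : z ≠ sgn β) {f : ℂ → ℂ}
    {A : LaurentSeries ℂ} (hf : HasExp (fun s => f (sgn β * Complex.exp s)) A) (L : ℕ)
    (hL : ∀ j : ℕ, L ≤ j → A.coeff (-j) = 0) :
    residue (fun w => kernel (ymon m) z w * (-(w ^ 2)⁻¹) * f w) (sgn β) =
      ∑ k ∈ Finset.range L, bVec z (β, k) / (2 * (k : ℂ) + 1) *
        ∑ n ∈ Finset.range L, PowerSeries.coeff n (potS m β)⁻¹ * A.coeff (-((k + n : ℕ) : ℤ)) := by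
  -- Multiplied by `w`, the integrand is `s` times the product of the halved primitive divided by
  -- `s`, the factor `1 / x`, the inverse of the potential and `f`. So the coefficient of `x ^ (-1)`
  -- picks the constant coefficient of the other three.
  have h1 := (hasExp_bergmannPrimitive β hz).mul ((hasExp_xpow_neg 1).mul
    (((hasExp_pot m β).inv (constantCoeff_potS hm β)).mul hf))
  rw [residue_eq_coeff β h1]
  · rw [← mul_assoc, mul_comm (ps _), mul_assoc, coeff_xpow_mul,
      show (-1 : ℤ) - (-((1 : ℕ) : ℤ)) = 0 by simp]
    have h2 : ∀ k : ℕ, (ps (potS m β)⁻¹ * A).coeff (0 - k) =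
        ∑ n ∈ Finset.range L, PowerSeries.coeff n (potS m β)⁻¹ * A.coeff (-((k + n : ℕ) : ℤ)) := by
      intro k
      rw [coeff_ps_mul _ _ _ L]
      · refine Finset.sum_congr rfl fun n _ => ?_
        congr 2; push_cast; ring
      · intro j hj
        rw [show (0 : ℤ) - k - j = -((k + j : ℕ) : ℤ) by push_cast; ring]
        exact hL _ (by omega)
    rw [coeff_ps_mul _ _ _ L]
    · refine Finset.sum_congr rfl fun k _ => ?_
      rw [PowerSeries.coeff_mk, h2]
    · intro k hk
      rw [h2]
      refine Finset.sum_eq_zero fun n _ => ?_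
      rw [hL _ (by omega), mul_zero]
  · filter_upwards [self_mem_nhdsWithin] with s hs
    have hs' : s ≠ 0 := hs
    have hw : sgn β * Complex.exp s ≠ 0 := mul_ne_zero (sgn_ne_zero β) (Complex.exp_ne_zero s)
    generalize sgn β * Complex.exp s = w at *
    have h2 : (w - w⁻¹)⁻¹ = (dx w)⁻¹ * w⁻¹ := by
      rw [← mul_inv, dx]
      congr 1
      field_simp
    rw [kernel, div_eq_mul_inv, mul_inv, mul_inv, div_eq_mul_inv _ (s ^ 2), mul_inv, mul_inv,
      inv_inv, h2]
    generalize (dx w)⁻¹ = d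
    generalize (ymon m w - ymon m w⁻¹)⁻¹ = y
    field_simp
    
end EynardOrantin

end

/-! ### Matching the bracket of the topological recursion with the Virasoro operators. -/

noncomputable section

namespace EynardOrantin

open MvPolynomial

theorem modeVec_neg_sub_eq_zero (c : Idx → Idx → ℂ) (β : ℤˣ) (j ν : ℕ) (i : Idx) (h : i.2 + 2 ≤ ν) :
    modeVec c β (-j - ν) i = 0 := by
  rw [modeVec_neg_sub, if_neg (by omega), if_neg (by omega)]

/-- The expansion with the coefficients of a linear functional. -/
def fieldL (β : ℤˣ) (d : Idx → ℂ) : LaurentSeries ℂ := ps (PowerSeries.mk fun k => d (β, k))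

theorem coeff_fieldL_mul_eL (β : ℤˣ) (d : Idx → ℂ) (i : Idx) (j : ℕ) :
    (fieldL β d * eL β i).coeff (-j) =
      ∑ ν ∈ Finset.range (i.2 + 2), d (β, ν) * modeVec corr β (-j - ν) i := by
  rw [fieldL, coeff_ps_mul _ _ _ (i.2 + 2)]
  · exact Finset.sum_congr rfl fun ν _ => by rw [PowerSeries.coeff_mk, coeff_eL]
  · intro ν hν
    rw [coeff_eL, modeVec_neg_sub_eq_zero _ _ _ _ _ hν]

/-- This identity explains the shape of `virMat`: its two parts come from the singular and the
regular part of the first factor. -/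
theorem coeff_eL_mul_eL (β : ℤˣ) (i i' : Idx) (j : ℕ) :
    (eL β i * eL β i').coeff (-j) = virMat corr β j i i' := by
  have h : (ps (PowerSeries.mk fun l => corr i (β, l)) * eL β i').coeff (-j) = _ :=
    coeff_fieldL_mul_eL β (corr i) i' j
  rw [virMat, ← h]
  conv_lhs => rw [eL]
  rw [add_mul, HahnSeries.coeff_add]
  congr 1
  split_ifs
  · rw [mul_assoc, coeff_C_mul_laurent, coeff_xpow_mul, coeff_eL,
      show (-(j : ℤ)) - -((i.2 + 1 : ℕ) : ℤ) = (i.2 : ℤ) + 1 - j by push_cast; ring]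
  · rw [zero_mul]; rfl

theorem coeff_fieldL_mul_fieldL (β : ℤˣ) (d d' : Idx → ℂ) (j : ℕ) :
    (fieldL β d * fieldL β d').coeff (-j) = if j = 0 then d (β, 0) * d' (β, 0) else 0 := by
  rw [fieldL, fieldL, ← map_mul]
  split_ifs with h
  · subst h
    rw [show (-((0 : ℕ) : ℤ)) = (0 : ℕ) by simp, coeff_ps_natCast,
      PowerSeries.coeff_zero_eq_constantCoeff_apply, map_mul,
      ← PowerSeries.coeff_zero_eq_constantCoeff_apply,
      ← PowerSeries.coeff_zero_eq_constantCoeff_apply, PowerSeries.coeff_mk, PowerSeries.coeff_mk]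
  · exact coeff_ps_neg _ _ (by omega)

theorem coeff_sum_laurent {ι : Type*} (S : Finset ι) (A : ι → LaurentSeries ℂ) (n : ℤ) :
    (∑ t ∈ S, A t).coeff n = ∑ t ∈ S, (A t).coeff n :=
  map_sum (HahnSeries.coeff.addMonoidHom n) A S

section

variable {τ : Type*} [Fintype τ] [DecidableEq τ]

/-- The coefficients of a stable factor of the recursion. -/
def stableCoeff (φ : τ → Idx → ℂ) (F : ℕ → Poly) (h : ℕ) (I : Finset τ) (i : Idx) : ℂ :=
  jet (I.val.map φ) (pderiv i (F (2 * h + I.card - 1)))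

/-- The expansion of a stable factor of the recursion. -/
def stableL (β : ℤˣ) (φ : τ → Idx → ℂ) (F : ℕ → Poly) (L h : ℕ) (I : Finset τ) : LaurentSeries ℂ :=
  ∑ i ∈ box L, HahnSeries.C (stableCoeff φ F h I i) * eL β i

/-- The expansion of a factor of the recursion of genus `0` with two points. -/
def unstableL (β : ℤˣ) (φ : τ → Idx → ℂ) (h : ℕ) (I : Finset τ) : LaurentSeries ℂ :=
  ∑ t, if h = 0 ∧ I = {t} then fieldL β (φ t) else 0

/-- Reindexing the splittings of the genus and the points. -/
theorem sum_split_swap {A : Type*} [AddCommMonoid A] (g : ℕ) (f : ℕ → Finset τ → ℕ → Finset τ → A) :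
    ∑ h ∈ Finset.range (g + 1), ∑ I : Finset τ, f h I (g - h) Iᶜ =
      ∑ h ∈ Finset.range (g + 1), ∑ I : Finset τ, f (g - h) Iᶜ h I := by
  rw [← Finset.sum_range_reflect (fun h => ∑ I : Finset τ, f h I (g - h) Iᶜ)]
  refine Finset.sum_congr rfl fun h hh => ?_
  rw [Finset.mem_range] at hh
  rw [show g + 1 - 1 - h = g - h by omega, show g - (g - h) = h by omega]
  exact Fintype.sum_bijective compl compl_involutive.bijective _ _ fun I => by rw [compl_compl]

/-- A factor `ω^0_2` carries no genus and exactly one of the points. -/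
theorem sum_unstableL_mul (β : ℤˣ) (φ : τ → Idx → ℂ) (g : ℕ)
    (Y : ℕ → Finset τ → LaurentSeries ℂ) :
    ∑ h ∈ Finset.range (g + 1), ∑ I : Finset τ, unstableL β φ h I * Y (g - h) Iᶜ =
      ∑ t, fieldL β (φ t) * Y g {t}ᶜ := by
  rw [Finset.sum_eq_single 0]
  · simp only [unstableL, true_and, Finset.sum_mul, ite_mul, zero_mul, tsub_zero]
    rw [Finset.sum_comm]
    simp
  · intro h _ hh
    refine Finset.sum_eq_zero fun I _ => ?_
    rw [unstableL, Finset.sum_eq_zero, zero_mul]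
    intro t _
    rw [if_neg fun h2 => hh h2.1]
  · simp

theorem jet_X_finset (φ : τ → Idx → ℂ) (I : Finset τ) (i : Idx) :
    jet (I.val.map φ) (X i) = ∑ t, if I = {t} then φ t i else 0 := by
  rw [← mul_one (X i), jet_X_mul]
  by_cases hI : ∃ t, I = {t}
  · obtain ⟨t, rfl⟩ := hI
    simp [jet, Finset.singleton_inj]
  · push Not at hI
    rw [Finset.sum_eq_zero, Finset.sum_eq_zero]
    · intro t _
      rw [if_neg (hI t)]
    · intro t ht
      rw [← C_1, jet_C, mul_zero]
      intro h0
      rw [Multiset.map_eq_zero, Finset.val_eq_zero] at h0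
      exact hI t (by rw [← Finset.insert_erase ht, h0]; rfl)

/-- With the point set split as `p + q`, a factor of genus `h` has index `2 h + p - 1`, so splitting
the genus is the same as splitting the index: the other pairs of indices violate the parity or the
genus bound. Where the subtraction truncates, the index is `0` and the term vanishes. -/
theorem sum_genus_eq_sum_antidiagonal (g p q : ℕ) (hN : 2 ≤ 2 * g + (p + q)) (x y : ℕ → ℂ)
    (hx0 : x 0 = 0) (hy0 : y 0 = 0)
    (hx : ∀ a, (a + 2 < p + 1 ∨ (p + 1 + a) % 2 = 1) → x a = 0)
    (hy : ∀ a, (a + 2 < q + 1 ∨ (q + 1 + a) % 2 = 1) → y a = 0) :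
    ∑ h ∈ Finset.range (g + 1), x (2 * h + p - 1) * y (2 * (g - h) + q - 1) =
      ∑ k ∈ Finset.HasAntidiagonal.antidiagonal (2 * g + (p + q) - 2), x k.1 * y k.2 := by
  refine Finset.sum_bij_ne_zero
    (fun h _ _ => (2 * h + p - 1, 2 * (g - h) + q - 1)) ?_ ?_ ?_ ?_
  · intro h hh h0
    have h1 : 2 * h + p - 1 ≠ 0 := fun h1 => h0 (by rw [h1, hx0, zero_mul])
    have h2 : 2 * (g - h) + q - 1 ≠ 0 := fun h2 => h0 (by rw [h2, hy0, mul_zero])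
    rw [Finset.mem_range] at hh
    rw [Finset.HasAntidiagonal.mem_antidiagonal]
    simp only
    omega
  · intro h hh h0 h' hh' h0' heq
    have h1 : 2 * h + p - 1 ≠ 0 := fun h1 => h0 (by rw [h1, hx0, zero_mul])
    simp only [Prod.mk.injEq] at heq
    omega
  · intro k hk h0
    have hx1 : ¬ (k.1 + 2 < p + 1 ∨ (p + 1 + k.1) % 2 = 1) :=
      fun h => h0 (by rw [hx _ h, zero_mul])
    have hy1 : ¬ (k.2 + 2 < q + 1 ∨ (q + 1 + k.2) % 2 = 1) :=
      fun h => h0 (by rw [hy _ h, mul_zero])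
    have hx2 : k.1 ≠ 0 := fun h1 => h0 (by rw [h1, hx0, zero_mul])
    have hy2 : k.2 ≠ 0 := fun h1 => h0 (by rw [h1, hy0, mul_zero])
    rw [Finset.HasAntidiagonal.mem_antidiagonal] at hk
    have e1 : 2 * ((k.1 + 1 - p) / 2) + p - 1 = k.1 := by omega
    have e2 : 2 * (g - (k.1 + 1 - p) / 2) + q - 1 = k.2 := by omega
    refine ⟨(k.1 + 1 - p) / 2, ?_, ?_, ?_⟩
    · rw [Finset.mem_range]; omega
    · rw [e1, e2]; exact h0
    · rw [e1, e2]
  · intro h _ _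
    rfl

theorem coeff_stableL_mul (β : ℤˣ) (φ : τ → Idx → ℂ) (F : ℕ → Poly) (L h h' : ℕ) (I I' : Finset τ)
    (j : ℕ) : (stableL β φ F L h I * stableL β φ F L h' I').coeff (-j) =
      ∑ i ∈ box L, ∑ i' ∈ box L, virMat corr β j i i' *
        (stableCoeff φ F h I i * stableCoeff φ F h' I' i') := by
  rw [stableL, stableL, Finset.sum_mul_sum, coeff_sum_laurent]
  refine Finset.sum_congr rfl fun i _ => ?_
  rw [coeff_sum_laurent]
  refine Finset.sum_congr rfl fun i' _ => ?_
  rw [mul_mul_mul_comm, ← map_mul, coeff_C_mul_laurent, coeff_eL_mul_eL, mul_comm]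

variable {V U : ℤˣ → ℕ → ℂ} {F : ℕ → Poly}

/-- The Leibniz rule produces the splittings of the points, and `sum_genus_eq_sum_antidiagonal`
those of the genus. -/
theorem sum_stableL_mul (hU : IsConvInv V U) (hF : IsFreeEnergy corr V F) (β : ℤˣ)
    (φ : τ → Idx → ℂ) (g : ℕ) (hg : 2 ≤ 2 * g + Fintype.card τ) (L : ℕ)
    (hL : ∀ k ≤ 2 * g + Fintype.card τ, bd (F k) ≤ L) (j : ℕ) :
    ∑ h ∈ Finset.range (g + 1), ∑ I : Finset τ,
        (stableL β φ F L h I * stableL β φ F L (g - h) Iᶜ).coeff (-j) =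
      jet (Finset.univ.val.map φ) (∑ x ∈ Finset.HasAntidiagonal.antidiagonal (2 * g + Fintype.card τ - 2),
        gam (virMat corr β j) (F x.1) (F x.2)) := by
  have hpd : ∀ (k : ℕ) (I : Finset τ) (i : Idx), (k + 2 < I.card + 1 ∨ (I.card + 1 + k) % 2 = 1) →
      jet (I.val.map φ) (pderiv i (F k)) = 0 := by
    intro k I i hk
    rw [pderiv_eq_vecD, ← jet_cons]
    refine jet_freeEnergy_eq_zero hU hF k _ Multiset.cons_ne_zero ?_
    simpa using hk
  have h1 : ∀ x ∈ Finset.HasAntidiagonal.antidiagonal (2 * g + Fintype.card τ - 2),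
      jet (Finset.univ.val.map φ) (gam (virMat corr β j) (F x.1) (F x.2)) =
      ∑ i ∈ box L, ∑ i' ∈ box L, virMat corr β j i i' * ∑ I : Finset τ,
        jet (I.val.map φ) (pderiv i (F x.1)) * jet (Iᶜ.val.map φ) (pderiv i' (F x.2)) := by
    intro x hx
    rw [Finset.HasAntidiagonal.mem_antidiagonal] at hx
    rw [gam_double_sum _ _ _ _ (pderiv_eq_zero_of_notMem_box (hL x.1 (by omega)))
      (pderiv_eq_zero_of_notMem_box (hL x.2 (by omega))), jet_sum]
    refine Finset.sum_congr rfl fun i _ => ?_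
    rw [jet_sum]
    refine Finset.sum_congr rfl fun i' _ => ?_
    rw [jet_C_mul, jet_mul_finset, Finset.powerset_univ]
    rfl
  rw [jet_sum, Finset.sum_congr rfl h1]
  simp only [coeff_stableL_mul, Finset.mul_sum]
  have e1 : ∀ f : ℕ → Finset τ → Idx → Idx → ℂ, ∑ h ∈ Finset.range (g + 1), ∑ I : Finset τ,
      ∑ i ∈ box L, ∑ i' ∈ box L, f h I i i' = ∑ i ∈ box L, ∑ i' ∈ box L, ∑ I : Finset τ,
      ∑ h ∈ Finset.range (g + 1), f h I i i' := by
    intro f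
    simp_rw [Finset.sum_comm (s := box L) (t := (Finset.univ : Finset (Finset τ)))]
    rw [Finset.sum_comm]
    refine Finset.sum_congr rfl fun I _ => ?_
    rw [Finset.sum_comm]
    exact Finset.sum_congr rfl fun i _ => Finset.sum_comm
  have e2 : ∀ (T : Finset (ℕ × ℕ)) (f : ℕ × ℕ → Idx → Idx → Finset τ → ℂ), ∑ x ∈ T,
      ∑ i ∈ box L, ∑ i' ∈ box L, ∑ I : Finset τ, f x i i' I = ∑ i ∈ box L, ∑ i' ∈ box L,
      ∑ I : Finset τ, ∑ x ∈ T, f x i i' I := by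
    intro T f
    rw [Finset.sum_comm]
    refine Finset.sum_congr rfl fun i _ => ?_
    rw [Finset.sum_comm]
    refine Finset.sum_congr rfl fun i' _ => ?_
    rw [Finset.sum_comm]
  rw [e1, e2]
  refine Finset.sum_congr rfl fun i _ => Finset.sum_congr rfl fun i' _ =>
    Finset.sum_congr rfl fun I _ => ?_
  rw [← Finset.mul_sum, ← Finset.mul_sum]
  congr 1
  have hc : I.card + Iᶜ.card = Fintype.card τ := by simp
  rw [← hc] at hg ⊢
  exact sum_genus_eq_sum_antidiagonal g _ _ hg
    (fun a => jet (I.val.map φ) (pderiv i (F a))) (fun a => jet (Iᶜ.val.map φ) (pderiv i' (F a)))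
    (by rw [hF.1, map_zero, jet_map_zero]) (by rw [hF.1, map_zero, jet_map_zero])
    (fun a ha => hpd a I i ha) (fun a ha => hpd a Iᶜ i' ha)

/-- At the origin the variable in `virField` must be hit by exactly one direction `φ t`, which
becomes the factor `ω^0_2`. The `2` accounts for the two orders of the factors. -/
theorem sum_cross (β : ℤˣ) (φ : τ → Idx → ℂ) (g : ℕ)
    (L : ℕ) (hL : ∀ k ≤ 2 * g + Fintype.card τ, bd (F k) ≤ L) (j : ℕ) :
    2 * ∑ t, (fieldL β (φ t) * stableL β φ F L g {t}ᶜ).coeff (-j) =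
      jet (Finset.univ.val.map φ) (fieldD (virField corr β j) (F (2 * g + Fintype.card τ - 2))) := by
  rw [fieldD_eq_sum _ _ _ (pderiv_eq_zero_of_notMem_box (hL _ (Nat.sub_le _ _))), jet_sum]
  have h1 : ∀ i, jet (Finset.univ.val.map φ) (virField corr β j i * pderiv i (F (2 * g + Fintype.card τ - 2))) =
      ∑ t, 2 * (stableCoeff φ F g {t}ᶜ i *
        ∑ ν ∈ Finset.range (i.2 + 2), φ t (β, ν) * modeVec corr β (-j - ν) i) := by
    intro i
    rw [virField, Finset.sum_mul, jet_sum]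
    have h2 : ∀ ν ∈ Finset.range (i.2 + 2), jet (Finset.univ.val.map φ)
        (C (2 * modeVec corr β (-j - ν) i) * X (β, ν) * pderiv i (F (2 * g + Fintype.card τ - 2))) =
        ∑ t, 2 * (stableCoeff φ F g {t}ᶜ i * (φ t (β, ν) * modeVec corr β (-j - ν) i)) := by
      intro ν _
      rw [mul_assoc, jet_C_mul, jet_X_mul, Finset.mul_sum]
      refine Finset.sum_congr rfl fun t _ => ?_
      have hc : ({t}ᶜ : Finset τ).card = Fintype.card τ - 1 := by
        rw [Finset.card_compl, Finset.card_singleton]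
      rw [stableCoeff, hc, ← Finset.compl_singleton,
        show 2 * g + (Fintype.card τ - 1) - 1 = 2 * g + Fintype.card τ - 2 by
          have := Fintype.card_pos_iff.mpr ⟨t⟩
          omega]
      ring
    rw [Finset.sum_congr rfl h2, Finset.sum_comm]
    refine Finset.sum_congr rfl fun t _ => ?_
    rw [Finset.mul_sum, Finset.mul_sum]
  simp only [h1]
  rw [Finset.sum_comm, Finset.mul_sum]
  refine Finset.sum_congr rfl fun t _ => ?_
  rw [stableL, Finset.mul_sum, coeff_sum_laurent, Finset.mul_sum]
  refine Finset.sum_congr rfl fun i _ => ?_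
  rw [mul_left_comm, coeff_C_mul_laurent, coeff_fieldL_mul_eL]

/-- Two factors `ω^0_2` require genus `0` and two points. The conditions `g = 0` and index `0`
differ only when the number of points is not two, where the jet of a quadratic monomial vanishes. -/
theorem sum_unstable_unstable (β : ℤˣ) (φ : τ → Idx → ℂ) (g : ℕ)
    (hg : 2 ≤ 2 * g + Fintype.card τ) (j : ℕ) :
    ∑ t, (fieldL β (φ t) * unstableL β φ g {t}ᶜ).coeff (-j) =
      jet (Finset.univ.val.map φ) (if 2 * g + Fintype.card τ - 2 = 0 then virQuad β j else 0) := by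
  have h1 : ∑ t, (fieldL β (φ t) * unstableL β φ g {t}ᶜ).coeff (-j) =
      if g = 0 then jet (Finset.univ.val.map φ) (virQuad β j) else 0 := by
    have h2 : ∀ t, (fieldL β (φ t) * unstableL β φ g {t}ᶜ).coeff (-j) =
        if g = 0 then if j = 0 then φ t (β, 0) * jet (({t}ᶜ : Finset τ).val.map φ) (X (β, 0)) else 0
        else 0 := by
      intro t
      rw [unstableL, Finset.mul_sum, coeff_sum_laurent, jet_X_finset]
      have h3 : ∀ t' : τ, (fieldL β (φ t) * if g = 0 ∧ ({t}ᶜ : Finset τ) = {t'} then fieldL β (φ t') else 0).coeff (-j) =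
          if g = 0 then if j = 0 then φ t (β, 0) * (if ({t}ᶜ : Finset τ) = {t'} then φ t' (β, 0) else 0)
            else 0 else 0 := by
        intro t'
        by_cases hg0 : g = 0
        · by_cases ht : ({t}ᶜ : Finset τ) = {t'}
          · rw [if_pos ⟨hg0, ht⟩, coeff_fieldL_mul_fieldL, if_pos hg0, if_pos ht]
          · rw [if_neg fun h => ht h.2, if_neg ht]
            simp
        · rw [if_neg fun h => hg0 h.1, if_neg hg0]
          simp
      rw [Finset.sum_congr rfl fun t' _ => h3 t']
      split_ifs
      · rw [Finset.mul_sum]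
      · simp
      · simp
    rw [Finset.sum_congr rfl fun t _ => h2 t]
    split_ifs with hg0 hj
    · rw [virQuad, if_pos hj, pow_two, jet_X_mul]
      exact Finset.sum_congr rfl fun t _ => by rw [Finset.compl_singleton]
    · rw [virQuad, if_neg hj, jet_map_zero]; simp
    · simp
  have h4 : ∀ (s : Multiset (Idx → ℂ)), Multiset.card s ≠ 2 → jet s (virQuad β j) = 0 := by
    intro s hs
    rw [virQuad]
    split_ifs
    · rw [pow_two]
      refine jet_mul_eq_zero _ _ _ fun s₁ s₂ h12 => ?_
      by_cases hs1 : Multiset.card s₁ = 1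
      · refine Or.inr (jet_X _ _ fun hs2 => hs ?_)
        rw [← h12, Multiset.card_add, hs1, hs2]
      · exact Or.inl (jet_X _ _ hs1)
    · rw [jet_map_zero]
  have hcard : Multiset.card ((Finset.univ : Finset τ).val.map φ) = Fintype.card τ := by simp
  rw [h1]
  split_ifs with hg0 hN hN
  · rfl
  · rw [h4 _ (by rw [hcard]; omega), jet_map_zero]
  · rw [h4 _ (by rw [hcard]; omega)]
  · rw [jet_map_zero]

/-- The coefficients of the quadratic part of the recursion. -/
theorem sum_bracket_coeff (hU : IsConvInv V U) (hF : IsFreeEnergy corr V F) (β : ℤˣ)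
    (φ : τ → Idx → ℂ) (g : ℕ) (hg : 2 ≤ 2 * g + Fintype.card τ) (L : ℕ)
    (hL : ∀ k ≤ 2 * g + Fintype.card τ, bd (F k) ≤ L) (j : ℕ) :
    ∑ h ∈ Finset.range (g + 1), ∑ I : Finset τ,
        ((stableL β φ F L h I + unstableL β φ h I) *
          (stableL β φ F L (g - h) Iᶜ + unstableL β φ (g - h) Iᶜ)).coeff (-j) =
      jet (Finset.univ.val.map φ) (if 2 * g + Fintype.card τ - 2 = 0 then virQuad β j else 0) +
      jet (Finset.univ.val.map φ) (fieldD (virField corr β j) (F (2 * g + Fintype.card τ - 2))) +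
      jet (Finset.univ.val.map φ) (∑ x ∈ Finset.HasAntidiagonal.antidiagonal (2 * g + Fintype.card τ - 2),
        gam (virMat corr β j) (F x.1) (F x.2)) := by
  have e1 : ∀ Y : ℕ → Finset τ → LaurentSeries ℂ,
      ∑ h ∈ Finset.range (g + 1), ∑ I : Finset τ, (unstableL β φ h I * Y (g - h) Iᶜ).coeff (-j) =
      ∑ t, (fieldL β (φ t) * Y g {t}ᶜ).coeff (-j) := by
    intro Y
    have := congrArg (fun A => HahnSeries.coeff A (-(j : ℤ))) (sum_unstableL_mul β φ g Y)
    simpa only [coeff_sum_laurent] using this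
  have e2 : ∑ h ∈ Finset.range (g + 1), ∑ I : Finset τ,
      (stableL β φ F L h I * unstableL β φ (g - h) Iᶜ).coeff (-j) =
      ∑ t, (fieldL β (φ t) * stableL β φ F L g {t}ᶜ).coeff (-j) := by
    rw [sum_split_swap g fun h I h' I' => (stableL β φ F L h I * unstableL β φ h' I').coeff (-j),
      ← e1 (stableL β φ F L)]
    exact Finset.sum_congr rfl fun h _ => Finset.sum_congr rfl fun I _ => by rw [mul_comm]
  simp only [add_mul, mul_add, HahnSeries.coeff_add, Finset.sum_add_distrib]
  rw [sum_stableL_mul hU hF β φ g hg L hL, e1 (stableL β φ F L), e1 (unstableL β φ), e2,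
    sum_unstable_unstable β φ g hg, ← sum_cross β φ g L hL]
  ring

end

end EynardOrantin

end

/-! ### The invariants as jets of the free energy. -/

noncomputable section

namespace EynardOrantin

open Filter Topology

/-- A factor of the quadratic term of the topological recursion. -/
def factor (y : ℂ → ℂ) {n : ℕ} (z : Fin n → ℂ) (h : ℕ) (I : Finset (Fin n)) (w : ℂ) : ℂ :=
  if h = 0 ∧ I.card = 0 then 0 else omegaForm y h (I.card + 1) (Fin.cons w (restrict z I))

/-- The term of the topological recursion of lower genus. -/
def loopTerm (y : ℂ → ℂ) (g : ℕ) {n : ℕ} (z : Fin n → ℂ) (w : ℂ) : ℂ :=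
  if 0 < g then omegaForm y (g - 1) (n + 2) (Fin.cons w (Fin.cons w⁻¹ z)) else 0

/-- The condition excluding `ω^0_1` is moved into the factors, so that the sum over splittings is
unrestricted and symmetric. -/
theorem omegaForm_succ (y : ℂ → ℂ) (g n : ℕ) (z : Fin (n + 1) → ℂ) (h : 2 < 2 * g + (n + 1)) :
    omegaForm y g (n + 1) z = ∑ α ∈ ({1, -1} : Finset ℂ), residue (fun w =>
      kernel y (z 0) w * (-(w ^ 2)⁻¹) * (loopTerm y g (Fin.tail z) w +
        ∑ k ∈ Finset.range (g + 1), ∑ I : Finset (Fin n),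
          factor y (Fin.tail z) k I w * factor y (Fin.tail z) (g - k) Iᶜ w⁻¹)) α := by
  rw [omegaForm, if_neg (by omega), dif_neg (by omega)]
  refine Finset.sum_congr rfl fun α _ => ?_
  congr 1
  funext w
  congr 2
  rw [← Fin.sum_univ_eq_sum_range (fun k => ∑ I : Finset (Fin n),
    factor y (Fin.tail z) k I w * factor y (Fin.tail z) (g - k) Iᶜ w⁻¹)]
  refine Finset.sum_congr rfl fun k _ => Finset.sum_congr rfl fun I _ => ?_
  rw [factor, factor]
  split_ifs with h1 h2 h3 h3 <;> first | rfl | (exfalso; tauto) | simp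

theorem map_univ_cons {A B : Type*} {n : ℕ} (f : B → A) (a : B) (v : Fin n → B) :
    (Finset.univ : Finset (Fin (n + 1))).val.map (fun i => f ((Fin.cons a v : Fin (n + 1) → B) i)) =
      f a ::ₘ (Finset.univ : Finset (Fin n)).val.map (fun i => f (v i)) := by
  rw [Fin.univ_succ, Finset.cons_val, Multiset.map_cons, Finset.map_val, Multiset.map_map]
  simp

theorem map_univ_restrict {A : Type*} {n : ℕ} (f : ℂ → A) (z : Fin n → ℂ) (I : Finset (Fin n)) :
    (Finset.univ : Finset (Fin I.card)).val.map (fun i => f (restrict z I i)) =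
      I.val.map (fun i => f (z i)) := by
  conv_rhs => rw [← Finset.map_orderEmbOfFin_univ I rfl, Finset.map_val, Multiset.map_map]
  rfl

theorem eventually_ne_sgn (β : ℤˣ) : ∀ᶠ s in 𝓝[≠] (0 : ℂ), ∀ α : ℤˣ,
    sgn β * Complex.exp s ≠ sgn α ∧ (sgn β * Complex.exp s)⁻¹ ≠ sgn α := by
  have h : ∀ c : ℂ, ∀ᶠ s in 𝓝[≠] (0 : ℂ), Complex.exp s ≠ c := fun c =>
    (Complex.hasDerivAt_exp 0).eventually_ne (Complex.exp_ne_zero 0)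
  filter_upwards [h (sgn β * sgn 1), h (sgn β * sgn (-1))] with s h1 h2 α
  have h3 : sgn β * Complex.exp s ≠ sgn α := by
    intro h3
    have h4 : Complex.exp s = sgn β * sgn α := by
      rw [← h3, ← mul_assoc, sgn_mul_self, one_mul]
    rcases Int.units_eq_one_or α with rfl | rfl
    · exact h1 h4
    · exact h2 h4
  refine ⟨h3, fun h4 => h3 ?_⟩
  rw [← inv_inv (sgn β * _), h4, sgn_inv]

/-- The decomposition of a form at a branch point into even and odd parts. -/
def HasParts (β : ℤˣ) (f : ℂ → ℂ) (A : LaurentSeries ℂ) : Prop :=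
  ∃ (E O : ℂ → ℂ) (Q : PowerSeries ℂ), HasExp E A ∧ HasExp O (ps Q) ∧
    ∀ᶠ s in 𝓝[≠] (0 : ℂ),
      sgn β * Complex.exp s * f (sgn β * Complex.exp s) = E s + s * O s ∧
      (sgn β * Complex.exp s)⁻¹ * f (sgn β * Complex.exp s)⁻¹ = E s - s * O s

/-- With even parts `E, E'` and odd parts `s O, s O'` the symmetrised product is `2 (E E' - s ^ 2 O
O')`. The regular odd parts only contribute positive powers of `x`, which the recursion does not
see. -/
theorem HasParts.pair {β : ℤˣ} {f f' : ℂ → ℂ} {A A' : LaurentSeries ℂ} (h : HasParts β f A)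
    (h' : HasParts β f' A') : ∃ R : PowerSeries ℂ,
    HasExp (fun s => f (sgn β * Complex.exp s) * f' (sgn β * Complex.exp s)⁻¹ +
      f' (sgn β * Complex.exp s) * f (sgn β * Complex.exp s)⁻¹)
      (HahnSeries.C 2 * (A * A') + xpow 1 * ps R) := by
  obtain ⟨E, O, Q, hE, hO, hs⟩ := h
  obtain ⟨E', O', Q', hE', hO', hs'⟩ := h'
  refine ⟨PowerSeries.C (-2) * (Q * Q'), ?_⟩
  have h1 := ((hE.mul hE').const_mul 2).add ((hasExp_xpow 1).mul ((hO.mul hO').const_mul (-2)))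
  rw [map_mul, map_mul, ps, HahnSeries.ofPowerSeries_C]
  refine h1.congr ?_
  filter_upwards [hs, hs'] with s h2 h3
  have hw : sgn β * Complex.exp s ≠ 0 := mul_ne_zero (sgn_ne_zero β) (Complex.exp_ne_zero s)
  generalize sgn β * Complex.exp s = w at *
  have e1 : f w * f' w⁻¹ = (w * f w) * (w⁻¹ * f' w⁻¹) := by field_simp
  have e2 : f' w * f w⁻¹ = (w * f' w) * (w⁻¹ * f w⁻¹) := by field_simp
  rw [e1, e2, h2.1, h2.2, h3.1, h3.2]
  ring

theorem hasParts_bergmann (β : ℤˣ) {z : ℂ} (hz : z ≠ sgn β) :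
    HasParts β (fun w => bergmann w z) (fieldL β (bVec z)) := by
  obtain ⟨Q, hQ⟩ := hasExp_bergmann_odd β hz
  refine ⟨_, _, Q, hasExp_bergmann_even β hz, hQ, ?_⟩
  filter_upwards [self_mem_nhdsWithin] with s hs
  have hs' : s ≠ 0 := hs
  have e : (sgn β * Complex.exp s)⁻¹ = sgn β * Complex.exp (-s) := by
    rw [mul_inv, sgn_inv, Complex.exp_neg]
  rw [mul_div_cancel₀ _ hs', e, bergmann, bergmann, ← div_eq_mul_inv, ← div_eq_mul_inv]
  constructor <;> ring

/-- By `bVec_inv` a combination of basis forms has no odd part. -/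
theorem hasParts_even (β : ℤˣ) {f : ℂ → ℂ} (S : Finset Idx) (a : Idx → ℂ)
    (hf : ∀ w, (∀ α, w ≠ sgn α) → f w = ∑ i ∈ S, a i * bVec w i) :
    HasParts β f (∑ i ∈ S, HahnSeries.C (a i) * eL β i) := by
  refine ⟨_, _, 0, hasExp_sum S fun i _ => (hasExp_mul_bVec β i).const_mul (a i),
    (by rw [map_zero]; exact hasExp_zero), ?_⟩
  filter_upwards [eventually_ne_sgn β] with s hs
  have hw : sgn β * Complex.exp s ≠ 0 := mul_ne_zero (sgn_ne_zero β) (Complex.exp_ne_zero s)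
  rw [hf _ fun α => (hs α).1, hf _ fun α => (hs α).2, mul_zero, add_zero, sub_zero]
  generalize sgn β * Complex.exp s = w at *
  constructor
  · rw [Finset.mul_sum]
    exact Finset.sum_congr rfl fun i _ => by ring
  · rw [Finset.mul_sum]
    refine Finset.sum_congr rfl fun i _ => ?_
    rw [bVec_inv _ hw]
    field_simp

theorem stableL_zero_card_le_one {τ : Type*} (β : ℤˣ) (φ : τ → Idx → ℂ) {F : ℕ → Poly} (hF0 : F 0 = 0)
    (L : ℕ) (I : Finset τ) (hI : I.card ≤ 1) : stableL β φ F L 0 I = 0 := by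
  refine Finset.sum_eq_zero fun i _ => ?_
  rw [stableCoeff, show 2 * 0 + I.card - 1 = 0 by omega, hF0, map_zero, jet_map_zero, map_zero,
    zero_mul]

theorem unstableL_eq_zero {τ : Type*} [Fintype τ] [DecidableEq τ] (β : ℤˣ) (φ : τ → Idx → ℂ) (h : ℕ)
    (I : Finset τ) (hI : ¬ (h = 0 ∧ I.card = 1)) : unstableL β φ h I = 0 := by
  refine Finset.sum_eq_zero fun t _ => if_neg ?_
  rintro ⟨h1, rfl⟩
  exact hI ⟨h1, Finset.card_singleton t⟩

/-- The densities of the invariants are the jets of the free energy. -/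
def JetFormula (m : ℕ) (F : ℕ → Poly) (g n : ℕ) : Prop :=
  ∀ z : Fin n → ℂ, (∀ i α, z i ≠ sgn α) →
    omegaForm (ymon m) g n z = jet (Finset.univ.val.map fun i => bVec (z i)) (F (2 * g + n - 2))

variable {m : ℕ} {V U : ℤˣ → ℕ → ℂ} {F : ℕ → Poly}

/-- Either the factor is the Bergmann kernel, or it is stable and the jet formula, being linear in
the first direction, expands it in basis forms. -/
theorem hasParts_factor (hF0 : F 0 = 0) (β : ℤˣ) {n : ℕ} (z : Fin n → ℂ) (hz : ∀ i α, z i ≠ sgn α)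
    (h : ℕ) (I : Finset (Fin n)) (hI : ¬ (h = 0 ∧ I.card = 0)) (L : ℕ)
    (hL : bd (F (2 * h + I.card - 1)) ≤ L)
    (ih : 2 < 2 * h + (I.card + 1) → JetFormula m F h (I.card + 1)) :
    HasParts β (factor (ymon m) z h I)
      (stableL β (fun i => bVec (z i)) F L h I + unstableL β (fun i => bVec (z i)) h I) := by
  by_cases hs : h = 0 ∧ I.card = 1
  · obtain ⟨rfl, hc⟩ := hs
    rw [stableL_zero_card_le_one β _ hF0 L I hc.le, zero_add]
    obtain ⟨t, rfl⟩ := Finset.card_eq_one.mp hc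
    have h1 : unstableL β (fun i => bVec (z i)) 0 {t} = fieldL β (bVec (z t)) := by
      rw [unstableL, Finset.sum_eq_single t]
      · simp
      · intro t' _ ht'
        rw [if_neg]
        rintro ⟨_, h2⟩
        exact ht' (Finset.singleton_injective h2).symm
      · simp
    rw [h1]
    have h2 : factor (ymon m) z 0 {t} = fun w => bergmann w (z t) := by
      funext w
      rw [factor, if_neg hI, omegaForm, if_neg (by simp), dif_pos (by simp)]
      have h3 : restrict z {t} ⟨0, by simp⟩ = z t := by
        have := Finset.orderEmbOfFin_mem {t} rfl (⟨0, by simp⟩ : Fin ({t} : Finset (Fin n)).card)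
        rw [Finset.mem_singleton] at this
        rw [restrict, this]
      rw [← h3]
      rfl
    rw [h2]
    exact hasParts_bergmann β (hz t β)
  · rw [unstableL_eq_zero β _ h I hs, add_zero]
    refine hasParts_even β _ _ fun w hw => ?_
    rw [factor, if_neg hI, ih (by omega)]
    · rw [map_univ_cons bVec, map_univ_restrict bVec, jet_cons,
        show 2 * h + (I.card + 1) - 2 = 2 * h + I.card - 1 by omega,
        vecD_eq_sum _ _ _ (pderiv_eq_zero_of_notMem_box hL), jet_sum]
      refine Finset.sum_congr rfl fun i _ => ?_
      rw [jet_C_mul, mul_comm]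
      rfl
    · intro i α
      refine Fin.cases ?_ (fun i => ?_) i
      · simpa using hw α
      · rw [Fin.cons_succ]
        exact hz _ α

/-- In genus `0` there is no such term, and the `lap` jet vanishes by the genus bound. For one point
in genus `1` the term is `B(w, 1/w)`, which gives `virConst`. Otherwise it is a sum of products of
two basis forms, which gives `lap`. -/
theorem hasExp_loopTerm (hU : IsConvInv V U) (hF : IsFreeEnergy corr V F) (β : ℤˣ) (g n : ℕ)
    (hg : 2 ≤ 2 * g + n) (z : Fin n → ℂ) (hz : ∀ i α, z i ≠ sgn α)
    (ih : 0 < g → 2 < 2 * (g - 1) + (n + 2) → JetFormula m F (g - 1) (n + 2)) :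
    ∃ D, HasExp (fun s => loopTerm (ymon m) g z (sgn β * Complex.exp s)) D ∧ ∀ j : ℕ,
      D.coeff (-j) = jet (Finset.univ.val.map fun i => bVec (z i))
        (if 2 * g + n - 2 = 0 then MvPolynomial.C (virConst corr β j) else 0) +
        jet (Finset.univ.val.map fun i => bVec (z i)) (lap (virMat corr β j) (F (2 * g + n - 2))) := by
  have hcard : Multiset.card ((Finset.univ : Finset (Fin n)).val.map fun i => bVec (z i)) = n := by simp
  rcases Nat.eq_zero_or_pos g with rfl | hg0
  · refine ⟨0, ?_, fun j => ?_⟩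
    · refine hasExp_zero.congr (Eventually.of_forall fun s => ?_)
      rw [loopTerm, if_neg (lt_irrefl 0)]
    · have hne : (Finset.univ : Finset (Fin n)).val.map (fun i => bVec (z i)) ≠ 0 := by
        intro h0
        rw [h0, Multiset.card_zero] at hcard
        omega
      have h1 : jet (Finset.univ.val.map fun i => bVec (z i))
          (if 2 * 0 + n - 2 = 0 then MvPolynomial.C (virConst corr β j) else 0) = 0 := by
        split_ifs
        · exact jet_C _ _ hne
        · exact jet_map_zero _
      rw [h1, zero_add, lap_double_sum _ _ _ (pderiv_eq_zero_of_notMem_box le_rfl), jet_sum,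
        Finset.sum_eq_zero]
      · rfl
      intro i _
      rw [jet_sum, Finset.sum_eq_zero]
      intro i' _
      rw [jet_C_mul, pderiv_eq_vecD i', ← jet_cons, pderiv_eq_vecD i, ← jet_cons,
        jet_freeEnergy_eq_zero hU hF _ _ Multiset.cons_ne_zero, mul_zero]
      left
      rw [Multiset.card_cons, Multiset.card_cons, hcard]
      omega
  · by_cases h1 : 2 < 2 * (g - 1) + (n + 2)
    · set N := 2 * g + n - 2 with hN
      have hN0 : N ≠ 0 := by omega
      set S := (Finset.univ : Finset (Fin n)).val.map (fun i => bVec (z i))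
      refine ⟨∑ i ∈ box (bd (F N)), ∑ i' ∈ box (bd (F N)), HahnSeries.C
        (jet S (MvPolynomial.pderiv i' (MvPolynomial.pderiv i (F N)))) * (eL β i * eL β i'), ?_, fun j => ?_⟩
      · refine HasExp.congr (hasExp_sum _ fun i _ => hasExp_sum _ fun i' _ =>
          ((hasExp_mul_bVec β i).mul (hasExp_mul_bVec β i')).const_mul _) ?_
        filter_upwards [eventually_ne_sgn β] with s hs
        have hw : sgn β * Complex.exp s ≠ 0 := mul_ne_zero (sgn_ne_zero β) (Complex.exp_ne_zero s)
        generalize sgn β * Complex.exp s = w at *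
        rw [loopTerm, if_pos hg0, ih hg0 h1]
        · rw [map_univ_cons bVec, map_univ_cons bVec, Multiset.cons_swap, jet_cons, jet_cons,
            show 2 * (g - 1) + (n + 2) - 2 = N by omega, vecD_comm,
            vecD_eq_sum _ (F N) _ (pderiv_eq_zero_of_notMem_box le_rfl), map_sum, jet_sum]
          refine Finset.sum_congr rfl fun i _ => ?_
          rw [vecD_C_mul, jet_C_mul, vecD_eq_sum _ _ (box (bd (F N))), jet_sum, Finset.mul_sum]
          · refine Finset.sum_congr rfl fun i' _ => ?_
            rw [jet_C_mul, bVec_inv _ hw]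
            ring
          · intro i' hi'
            rw [pderiv_eq_vecD i, pderiv_vecD,
              pderiv_eq_zero_of_notMem_box le_rfl i' hi', map_zero]
        · intro i α
          refine Fin.cases ?_ (fun i => Fin.cases ?_ (fun i => ?_) i) i
          · simpa using (hs α).1
          · simpa using (hs α).2
          · simpa using hz _ α
      · rw [if_neg hN0, jet_map_zero, zero_add,
          lap_double_sum _ _ _ (pderiv_eq_zero_of_notMem_box le_rfl), jet_sum, coeff_sum_laurent]
        refine Finset.sum_congr rfl fun i _ => ?_
        rw [coeff_sum_laurent, jet_sum]
        refine Finset.sum_congr rfl fun i' _ => ?_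
        rw [coeff_C_mul_laurent, coeff_eL_mul_eL, jet_C_mul, mul_comm]
    · obtain rfl : g = 1 := by omega
      obtain rfl : n = 0 := by omega
      obtain ⟨A, hA, hA2⟩ := hasExp_bergmann_diag β
      refine ⟨A, hA.congr (Eventually.of_forall fun s => ?_), fun j => ?_⟩
      · rw [loopTerm, if_pos one_pos, omegaForm, if_neg (by simp), dif_pos (by simp)]
        rfl
      · rw [hA2, if_pos (by simp), show 2 * 1 + 0 - 2 = 0 by simp, hF.1, map_zero, jet_map_zero, add_zero]
        simp [jet_zero]

theorem hasExp_bracket (hU : IsConvInv V U) (hF : IsFreeEnergy corr V F) (β : ℤˣ) (g n : ℕ)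
    (hg : 2 ≤ 2 * g + n) (z : Fin n → ℂ) (hz : ∀ i α, z i ≠ sgn α)
    (ih : ∀ h k, 0 < k → 2 < 2 * h + k → 2 * h + k < 2 * g + (n + 1) → JetFormula m F h k) :
    ∃ B, HasExp (fun s => loopTerm (ymon m) g z (sgn β * Complex.exp s) +
        ∑ k ∈ Finset.range (g + 1), ∑ I : Finset (Fin n),
          factor (ymon m) z k I (sgn β * Complex.exp s) *
            factor (ymon m) z (g - k) Iᶜ (sgn β * Complex.exp s)⁻¹) B ∧
      ∀ j : ℕ, B.coeff (-j) = jet (Finset.univ.val.map fun i => bVec (z i))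
        (vecD (dvec V β j) (F (2 * g + n - 1))) := by
  obtain ⟨D, hD, hD2⟩ := hasExp_loopTerm (m := m) hU hF β g n hg z hz fun h1 h2 =>
    ih _ _ (by omega) h2 (by omega)
  set φ : Fin n → Idx → ℂ := fun i => bVec (z i) with hφ
  set L := ∑ k ∈ Finset.range (2 * g + n + 1), bd (F k) with hLdef
  have hL : ∀ k ≤ 2 * g + n, bd (F k) ≤ L := fun k hk =>
    Finset.single_le_sum (f := fun k => bd (F k)) (fun _ _ => Nat.zero_le _)
      (Finset.mem_range.mpr (by omega))
  have hpair : ∀ k ∈ Finset.range (g + 1), ∀ I : Finset (Fin n), ∃ R : PowerSeries ℂ,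
      HasExp (fun s => factor (ymon m) z k I (sgn β * Complex.exp s) *
          factor (ymon m) z (g - k) Iᶜ (sgn β * Complex.exp s)⁻¹ +
        factor (ymon m) z (g - k) Iᶜ (sgn β * Complex.exp s) *
          factor (ymon m) z k I (sgn β * Complex.exp s)⁻¹)
        (HahnSeries.C 2 * ((stableL β φ F L k I + unstableL β φ k I) *
          (stableL β φ F L (g - k) Iᶜ + unstableL β φ (g - k) Iᶜ)) + xpow 1 * ps R) := by
    intro k hk I
    rw [Finset.mem_range] at hk
    have hc : I.card + Iᶜ.card = n := by simp
    have hzero : ∀ (h : ℕ) (J : Finset (Fin n)), h = 0 ∧ J.card = 0 →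
        (∀ w, factor (ymon m) z h J w = 0) ∧ stableL β φ F L h J + unstableL β φ h J = 0 := by
      rintro h J ⟨rfl, hJ⟩
      refine ⟨fun w => by rw [factor, if_pos ⟨rfl, hJ⟩], ?_⟩
      rw [stableL_zero_card_le_one β φ hF.1 L J (by omega), unstableL_eq_zero β φ 0 J (by omega),
        add_zero]
    by_cases h1 : k = 0 ∧ I.card = 0
    · refine ⟨0, ?_⟩
      simp only [(hzero k I h1).1, (hzero k I h1).2, zero_mul, mul_zero, add_zero, map_zero]
      exact hasExp_zero
    by_cases h2 : g - k = 0 ∧ Iᶜ.card = 0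
    · refine ⟨0, ?_⟩
      simp only [(hzero _ _ h2).1, (hzero _ _ h2).2, zero_mul, mul_zero, add_zero, map_zero]
      exact hasExp_zero
    exact (hasParts_factor hF.1 β z hz k I h1 L (hL _ (by omega)) fun h3 =>
      ih _ _ (by omega) h3 (by omega)).pair
      (hasParts_factor hF.1 β z hz (g - k) Iᶜ h2 L (hL _ (by omega)) fun h3 =>
      ih _ _ (by omega) h3 (by omega))
  choose! R hR using hpair
  -- A single product need not be even in `s`; half the sum over both orders is, and by the symmetry
  -- of the splittings it is the same total.
  have hsum := (hasExp_sum (Finset.range (g + 1)) fun k hk =>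
    hasExp_sum Finset.univ fun I _ => hR k hk I).const_mul (1 / 2)
  refine ⟨_, hD.add (hsum.congr (Eventually.of_forall fun s => ?_)), fun j => ?_⟩
  · simp only [Finset.sum_add_distrib]
    rw [← sum_split_swap g fun k I k' I' => factor (ymon m) z k I (sgn β * Complex.exp s) *
      factor (ymon m) z k' I' (sgn β * Complex.exp s)⁻¹]
    ring
  · have h1 : 2 * g + n - 1 = (2 * g + n - 2) + 1 := by omega
    have h2 := sum_bracket_coeff hU hF β φ g (by simpa using hg) L (by simpa using hL) j
    rw [Fintype.card_fin] at h2
    have h3 : (HahnSeries.C (1 / 2) * ∑ k ∈ Finset.range (g + 1), ∑ I : Finset (Fin n),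
        (HahnSeries.C 2 * ((stableL β φ F L k I + unstableL β φ k I) *
          (stableL β φ F L (g - k) Iᶜ + unstableL β φ (g - k) Iᶜ)) + xpow 1 * ps (R k I))).coeff (-j) =
        ∑ k ∈ Finset.range (g + 1), ∑ I : Finset (Fin n),
          ((stableL β φ F L k I + unstableL β φ k I) *
          (stableL β φ F L (g - k) Iᶜ + unstableL β φ (g - k) Iᶜ)).coeff (-j) := by
      rw [coeff_C_mul_laurent, coeff_sum_laurent, Finset.mul_sum]
      refine Finset.sum_congr rfl fun k _ => ?_
      rw [coeff_sum_laurent, Finset.mul_sum]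
      refine Finset.sum_congr rfl fun I _ => ?_
      rw [HahnSeries.coeff_add, coeff_C_mul_laurent, coeff_xpow_mul, coeff_ps_neg _ _ (by omega)]
      ring
    rw [HahnSeries.coeff_add, hD2, h3, h2, h1, hF.2, jet_add, jet_add, jet_add]
    have h4 : jet (Finset.univ.val.map φ) (if 2 * g + n - 2 = 0 then
        virQuad β j + MvPolynomial.C (virConst corr β j) else 0) =
        jet (Finset.univ.val.map φ) (if 2 * g + n - 2 = 0 then virQuad β j else 0) +
        jet (Finset.univ.val.map φ) (if 2 * g + n - 2 = 0 then
          MvPolynomial.C (virConst corr β j) else 0) := by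
      rw [← jet_add]
      split_ifs <;> simp
    rw [h4]
    ring

/-- The coefficients of the potential. -/
def potV (m : ℕ) (α : ℤˣ) (n : ℕ) : ℂ := PowerSeries.coeff n (potS m α)

/-- The coefficients of the inverse of the potential. -/
def potU (m : ℕ) (α : ℤˣ) (n : ℕ) : ℂ := PowerSeries.coeff n (potS m α)⁻¹

theorem isConvInv_pot (hm : 1 ≤ m) : IsConvInv (potV m) (potU m) := by
  intro α n
  have := congrArg (PowerSeries.coeff n) (PowerSeries.mul_inv_cancel (potS m α) (constantCoeff_potS hm α))
  rwa [PowerSeries.coeff_mul, PowerSeries.coeff_one] at this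

/-- The invariants are the jets of the free energy. -/
theorem jetFormula (hm : 1 ≤ m) (hF : IsFreeEnergy corr (potV m) F) (g n : ℕ) (hn : 0 < n)
    (hg : 2 < 2 * g + n) : JetFormula m F g n := by
  induction hN : 2 * g + n using Nat.strong_induction_on generalizing g n with
  | _ N ih =>
  obtain ⟨n, rfl⟩ := Nat.exists_eq_add_one_of_ne_zero hn.ne'
  have hU := isConvInv_pot hm
  intro z hz
  have hB := fun β => hasExp_bracket (m := m) hU hF β g n (by omega) (Fin.tail z) (fun i α => hz i.succ α)
    fun h k hk h1 h2 => ih _ (by omega) h k hk h1 rfl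
  choose B hB hB2 using hB
  have hzc : z = Fin.cons (z 0) (Fin.tail z) := (Fin.cons_self_tail z).symm
  set P := F (2 * g + n - 1) with hP
  -- The sums may stop at `bd P` because the coefficients of the bracket are derivatives of `P`
  -- along `dvec`, which only involves times of order at least `j`.
  have hres : ∀ β : ℤˣ, residue (fun w => kernel (ymon m) (z 0) w * (-(w ^ 2)⁻¹) *
      (loopTerm (ymon m) g (Fin.tail z) w + ∑ k ∈ Finset.range (g + 1), ∑ I : Finset (Fin n),
        factor (ymon m) (Fin.tail z) k I w * factor (ymon m) (Fin.tail z) (g - k) Iᶜ w⁻¹)) (sgn β) =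
      ∑ k ∈ Finset.range (bd P), bVec (z 0) (β, k) / (2 * (k : ℂ) + 1) *
        ∑ l ∈ Finset.range (bd P), potU m β l *
          jet (Finset.univ.val.map fun i => bVec (Fin.tail z i))
            (vecD (dvec (potV m) β (k + l)) P) := by
    intro β
    rw [residue_kernel hm β (hz 0 β) (f := fun w => loopTerm (ymon m) g (Fin.tail z) w +
      ∑ k ∈ Finset.range (g + 1), ∑ I : Finset (Fin n),
        factor (ymon m) (Fin.tail z) k I w * factor (ymon m) (Fin.tail z) (g - k) Iᶜ w⁻¹)
      (hB β) (bd P)]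
    · simp only [hB2]
      rfl
    · intro j hj
      rw [hB2, vecD_eq_sum _ _ _ (pderiv_eq_zero_of_notMem_box le_rfl), Finset.sum_eq_zero,
        jet_map_zero]
      intro i hi
      rw [mem_box] at hi
      rw [dvec, if_neg (by omega), map_zero, zero_mul]
  have hunits : (Finset.univ : Finset ℤˣ) = {1, -1} := rfl
  have h1 := hres 1
  have h2 := hres (-1)
  simp only [sgn, Units.val_one, Int.cast_one, Units.val_neg, Int.cast_neg] at h1 h2
  rw [omegaForm_succ _ _ _ _ hg, Finset.sum_pair (by norm_num), h1, h2]
  conv_rhs => rw [hzc]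
  -- The two residues are the two halves of the expansion of the direction `bVec (z 0)` in the
  -- directions `dvec`.
  rw [map_univ_cons bVec, jet_cons, show 2 * g + (n + 1) - 2 = 2 * g + n - 1 by omega, ← hP,
    vecD_eq_sum_dvec hU _ _ _ le_rfl, jet_sum, box, Finset.sum_product, hunits,
    Finset.sum_pair (by decide)]
  congr 1 <;>
  · refine Finset.sum_congr rfl fun k _ => ?_
    rw [jet_C_mul, jet_sum]
    congr 1
    exact Finset.sum_congr rfl fun l _ => by rw [jet_C_mul]

end EynardOrantin

end

/-! ### An algebraic form of the residue theorem on the sphere. -/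

noncomputable section

namespace EynardOrantin

open Filter Topology

/-- Reduces identities between the hyperbolic series to addition formulas for functions. -/
theorem ps_unique {f g : ℂ → ℂ} {P Q : PowerSeries ℂ} (hf : HasExp f (ps P)) (hg : HasExp g (ps Q))
    (h : ∀ᶠ s in 𝓝[≠] (0 : ℂ), f s = g s) : P = Q :=
  HahnSeries.ofPowerSeries_injective ((hg.congr h).unique hf).symm

theorem hasExp_psC (a : ℂ) : HasExp (fun _ => a) (ps (PowerSeries.C a)) := by
  rw [ps, HahnSeries.ofPowerSeries_C]
  exact hasExp_const a

theorem HasExp.psMul {f g : ℂ → ℂ} {P Q : PowerSeries ℂ} (hf : HasExp f (ps P)) (hg : HasExp g (ps Q)) :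
    HasExp (fun s => f s * g s) (ps (P * Q)) := by
  rw [map_mul]
  exact hf.mul hg

theorem HasExp.psAdd {f g : ℂ → ℂ} {P Q : PowerSeries ℂ} (hf : HasExp f (ps P)) (hg : HasExp g (ps Q)) :
    HasExp (fun s => f s + g s) (ps (P + Q)) := by
  rw [map_add]
  exact hf.add hg

theorem HasExp.psSub {f g : ℂ → ℂ} {P Q : PowerSeries ℂ} (hf : HasExp f (ps P)) (hg : HasExp g (ps Q)) :
    HasExp (fun s => f s - g s) (ps (P - Q)) := by
  rw [map_sub]
  exact hf.sub hg

theorem hasExp_psX : HasExp (fun s => s ^ 2) (ps PowerSeries.X) := by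
  have := hasExp_xpow 1
  rw [← ps_X_pow, pow_one] at this
  simpa using this

theorem cosS_mul_cosS (a b : ℂ) :
    PowerSeries.C 2 * (cosS a * cosS b) = cosS (a + b) + cosS (a - b) := by
  refine ps_unique ((hasExp_psC 2).psMul ((hasExp_cosh a).psMul (hasExp_cosh b)))
    ((hasExp_cosh (a + b)).psAdd (hasExp_cosh (a - b))) (Eventually.of_forall fun s => ?_)
  rw [add_mul, sub_mul, Complex.cosh_add, Complex.cosh_sub]
  ring

theorem cosS_mul_sinS (a b : ℂ) :
    PowerSeries.C 2 * (cosS a * sinS b) = sinS (b + a) + sinS (b - a) := by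
  refine ps_unique ((hasExp_psC 2).psMul ((hasExp_cosh a).psMul (hasExp_sinh b)))
    ((hasExp_sinh (b + a)).psAdd (hasExp_sinh (b - a))) (Eventually.of_forall fun s => ?_)
  rw [add_mul, sub_mul, Complex.sinh_add, Complex.sinh_sub]
  ring

theorem sinS_mul_sinS (a b : ℂ) :
    PowerSeries.X * (PowerSeries.C 2 * (sinS a * sinS b)) = cosS (a + b) - cosS (a - b) := by
  refine ps_unique (hasExp_psX.psMul ((hasExp_psC 2).psMul ((hasExp_sinh a).psMul (hasExp_sinh b))))
    ((hasExp_cosh (a + b)).psSub (hasExp_cosh (a - b))) ?_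
  filter_upwards [self_mem_nhdsWithin] with s hs
  have hs' : s ≠ 0 := hs
  rw [add_mul, sub_mul, Complex.cosh_add, Complex.cosh_sub]
  field_simp
  ring

theorem cosS_zero : cosS 0 = 1 := by
  refine ps_unique (hasExp_cosh 0) (by rw [map_one]; exact hasExp_one)
    (Eventually.of_forall fun s => ?_)
  simp

theorem cosS_neg (b : ℂ) : cosS (-b) = cosS b := by
  ext k
  rw [cosS, cosS, PowerSeries.coeff_mk, PowerSeries.coeff_mk, (even_two_mul k).neg_pow]

/-- The expansion of `s / (2 * sinh s)`. -/
def cschS : PowerSeries ℂ := (PowerSeries.C 2 * sinS 1)⁻¹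

theorem cschS_mul : PowerSeries.C 2 * sinS 1 * cschS = 1 := by
  refine PowerSeries.mul_inv_cancel _ ?_
  rw [map_mul, constantCoeff_sinS, PowerSeries.constantCoeff_C]
  norm_num

theorem constantCoeff_cschS : PowerSeries.constantCoeff cschS = 1 / 2 := by
  rw [cschS, PowerSeries.constantCoeff_inv, map_mul, constantCoeff_sinS, PowerSeries.constantCoeff_C]
  norm_num

/-- The polynomials that express the derivatives of `base` of even order through `base`. -/
def derivPoly : ℕ → Polynomial ℂ
  | 0 => Polynomial.X
  | k + 1 => (Polynomial.X ^ 2 + 4 * Polynomial.X ^ 3) * Polynomial.derivative (Polynomial.derivative (derivPoly k)) +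
      (Polynomial.X + 6 * Polynomial.X ^ 2) * Polynomial.derivative (derivPoly k)

/-- This expresses that the densities vanish at `w = 0` and `w = ∞`; the factor will absorb one
`cosh`. -/
theorem X_dvd_derivPoly (k : ℕ) : Polynomial.X ∣ derivPoly k := by
  cases k with
  | zero => exact dvd_rfl
  | succ k =>
    refine dvd_add (Dvd.dvd.mul_right ⟨Polynomial.X + 4 * Polynomial.X ^ 2, by ring⟩ _)
      (Dvd.dvd.mul_right ⟨1 + 6 * Polynomial.X, by ring⟩ _)

theorem eventually_base (γ : ℤˣ) : ∀ᶠ s in 𝓝[≠] (0 : ℂ), 2 * Complex.cosh s - 2 * sgn γ ≠ 0 := by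
  have h : ∀ c : ℂ, ∀ᶠ s in 𝓝[≠] (0 : ℂ), Complex.exp s ≠ c := fun c =>
    (Complex.hasDerivAt_exp 0).eventually_ne (Complex.exp_ne_zero 0)
  filter_upwards [h (sgn γ)] with s hs h0
  have h1 : Complex.exp s * Complex.exp (-s) = 1 := by rw [← Complex.exp_add]; simp
  rw [Complex.cosh] at h0
  have h2 : (Complex.exp s - sgn γ) ^ 2 = 0 := by
    linear_combination Complex.exp s * h0 - h1 + sgn_sq γ
  exact hs (sub_eq_zero.mp (pow_eq_zero_iff two_ne_zero |>.mp h2))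

theorem hasDerivAt_base (γ : ℤˣ) {s : ℂ} (hs : 2 * Complex.cosh s - 2 * sgn γ ≠ 0) :
    HasDerivAt (base γ) (-(sgn γ * (2 * Complex.sinh s)) * base γ s ^ 2) s := by
  have h := ((((Complex.hasDerivAt_cosh s).const_mul 2).sub_const (2 * sgn γ)).fun_inv hs).const_mul (sgn γ)
  have e : base γ = fun s => sgn γ * (2 * Complex.cosh s - 2 * sgn γ)⁻¹ := funext (base_eq γ)
  rw [e]
  refine h.congr_deriv ?_
  have h2 := sgn_sq γ
  simp only [mul_pow, h2]
  field_simp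

theorem two_cosh_mul_base (γ : ℤˣ) {s : ℂ} (hs : 2 * Complex.cosh s - 2 * sgn γ ≠ 0) :
    2 * Complex.cosh s * base γ s = sgn γ + 2 * sgn γ * base γ s := by
  have h : base γ s * (2 * Complex.cosh s - 2 * sgn γ) = sgn γ := by
    rw [base_eq, mul_assoc, inv_mul_cancel₀ hs, mul_one]
  linear_combination h

theorem two_sinh_sq_mul_base (γ : ℤˣ) {s : ℂ} (hs : 2 * Complex.cosh s - 2 * sgn γ ≠ 0) :
    (2 * Complex.sinh s) ^ 2 * base γ s ^ 2 = 1 + 4 * base γ s := by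
  have h := two_cosh_mul_base γ hs
  rw [mul_pow, Complex.sinh_sq]
  linear_combination (2 * Complex.cosh s * base γ s + sgn γ + 2 * sgn γ * base γ s) * h +
    (1 + 2 * base γ s) ^ 2 * sgn_sq γ

/-- The function `ψ = base γ` satisfies `ψ' ^ 2 = ψ ^ 2 + 4 ψ ^ 3` and `ψ'' = ψ + 6 ψ ^ 2`, so its
even derivatives are polynomials in `ψ`. -/
theorem iteratedDeriv_base_eq (γ : ℤˣ) (k : ℕ) : ∀ᶠ s in 𝓝[≠] (0 : ℂ),
    iteratedDeriv (2 * k) (base γ) s = (derivPoly k).eval (base γ s) := by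
  induction k with
  | zero => simp [derivPoly]
  | succ k ih =>
    have key : ∀ (p : Polynomial ℂ) (s : ℂ), 2 * Complex.cosh s - 2 * sgn γ ≠ 0 →
        HasDerivAt (fun s => p.eval (base γ s))
          ((Polynomial.derivative p).eval (base γ s) *
            (-(sgn γ * (2 * Complex.sinh s)) * base γ s ^ 2)) s := fun p s hs =>
      (p.hasDerivAt (base γ s)).comp s (hasDerivAt_base γ hs)
    have key2 : ∀ s : ℂ, 2 * Complex.cosh s - 2 * sgn γ ≠ 0 → HasDerivAt
        (fun s => (Polynomial.derivative (derivPoly k)).eval (base γ s) *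
            (-(sgn γ * (2 * Complex.sinh s)) * base γ s ^ 2)) ((derivPoly (k + 1)).eval (base γ s)) s := by
      intro s hs
      have h1 := (key (Polynomial.derivative (derivPoly k)) s hs).fun_mul
        ((((Complex.hasDerivAt_sinh s).const_mul 2).const_mul (sgn γ)).fun_neg.fun_mul
          ((hasDerivAt_base γ hs).fun_pow 2))
      refine h1.congr_deriv ?_
      have h2 := two_sinh_sq_mul_base γ hs
      have h3 : sgn γ * (2 * Complex.cosh s) * base γ s = 1 + 2 * base γ s := by
        linear_combination sgn γ * two_cosh_mul_base γ hs + (1 + 2 * base γ s) * sgn_sq γ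
      have h4 := sgn_sq γ
      simp only [derivPoly, Polynomial.eval_add, Polynomial.eval_mul, Polynomial.eval_pow,
        Polynomial.eval_X, Polynomial.eval_ofNat]
      generalize Polynomial.eval (base γ s) (Polynomial.derivative (Polynomial.derivative (derivPoly k))) = q2
      generalize Polynomial.eval (base γ s) (Polynomial.derivative (derivPoly k)) = q1
      generalize base γ s = ψ at *
      norm_num
      linear_combination q2 * ψ ^ 4 * (2 * Complex.sinh s) ^ 2 * h4 + q2 * ψ ^ 2 * h2 - q1 * ψ * h3 +
        q1 * (2 * ψ ^ 3 * (2 * Complex.sinh s) ^ 2 * h4 + 2 * ψ * h2)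
    filter_upwards [eventually_eventually_nhdsWithin.mpr ih,
      eventually_eventually_nhdsWithin.mpr (eventually_base γ), self_mem_nhdsWithin] with s h1 h2 hs0
    have hs0' : s ≠ 0 := hs0
    rw [isOpen_compl_singleton.nhdsWithin_eq hs0'] at h1 h2
    have e1 : iteratedDeriv (2 * k) (base γ) =ᶠ[𝓝 s] fun s => (derivPoly k).eval (base γ s) := h1
    have e2 : deriv (iteratedDeriv (2 * k) (base γ)) =ᶠ[𝓝 s] fun s =>
        (Polynomial.derivative (derivPoly k)).eval (base γ s) *
            (-(sgn γ * (2 * Complex.sinh s)) * base γ s ^ 2) := by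
      refine e1.deriv.trans ?_
      filter_upwards [h2] with t ht
      exact (key _ t ht).deriv
    rw [show 2 * (k + 1) = 2 * k + 1 + 1 by ring, iteratedDeriv_succ, iteratedDeriv_succ, e2.deriv_eq]
    exact (key2 s h2.self_of_nhds).deriv

theorem hasExp_eval (p : Polynomial ℂ) {f : ℂ → ℂ} {A : LaurentSeries ℂ} (h : HasExp f A) :
    HasExp (fun s => p.eval (f s)) (p.eval₂ (HahnSeries.C : ℂ →+* LaurentSeries ℂ) A) := by
  induction p using Polynomial.induction_on' with
  | add p q hp hq =>
    simp only [Polynomial.eval_add, Polynomial.eval₂_add]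
    exact hp.add hq
  | monomial n a =>
    simp only [Polynomial.eval_monomial, Polynomial.eval₂_monomial]
    exact (h.pow n).const_mul a

theorem eL_eq_eval (β : ℤˣ) (i : Idx) : eL β i = HahnSeries.C (((2 * i.2).factorial : ℂ)⁻¹) *
    (derivPoly i.2).eval₂ (HahnSeries.C : ℂ →+* LaurentSeries ℂ) (psiL (i.1 * β)) := by
  refine (hasExp_mul_bVec β i).unique
    (((hasExp_eval (derivPoly i.2) (hasExp_base (i.1 * β))).const_mul _).congr ?_)
  filter_upwards [iteratedDeriv_base_eq (i.1 * β) i.2] with s hs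
  rw [mul_bVec, hs]
  ring

theorem two_cosS_mul_psiL (γ : ℤˣ) : ps (2 * cosS 1) * psiL γ =
    HahnSeries.C (sgn γ) + HahnSeries.C (2 * sgn γ) * psiL γ := by
  refine (hasExp_two_cosh.mul (hasExp_base γ)).unique
    (((hasExp_const _).add ((hasExp_base γ).const_mul (2 * sgn γ))).congr ?_)
  filter_upwards [eventually_base γ] with s hs
  exact two_cosh_mul_base γ hs

/-- Partial fractions for the denominators `2 cosh s - 2 γ` and `2 cosh s + 2 γ`. -/
theorem psiL_mul_psiL_neg (γ : ℤˣ) : psiL γ * psiL (-γ) =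
    HahnSeries.C (-1 / 4) * psiL γ + HahnSeries.C (-1 / 4) * psiL (-γ) := by
  refine ((hasExp_base γ).mul (hasExp_base (-γ))).unique
    ((((hasExp_base γ).const_mul (-1 / 4)).add ((hasExp_base (-γ)).const_mul (-1 / 4))).congr ?_)
  filter_upwards [eventually_base γ, eventually_base (-γ)] with s hs hs'
  have h1 := two_cosh_mul_base γ hs
  have h2 := two_cosh_mul_base (-γ) hs'
  have h3 : sgn (-γ) = -sgn γ := by simp [sgn]
  rw [h3] at h2
  have h4 := sgn_sq γ
  have h5 : sgn γ * (4 * (base γ s * base (-γ) s) + base γ s + base (-γ) s) = 0 := by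
    linear_combination base γ s * h2 - base (-γ) s * h1
  have h6 := (mul_eq_zero.mp h5).resolve_left (sgn_ne_zero γ)
  linear_combination (1 / 4 : ℂ) * h6

/-- The coefficient is the residue of `2 sinh s ψ ^ (n + 2) ds`, which is exact because `dψ = -2
sinh s ψ ^ 2 ds`. -/
theorem coeff_sinS_mul_psiL_pow (n : ℕ) :
    (ps (PowerSeries.C 2 * sinS 1) * psiL 1 ^ (n + 2)).coeff (-1) = 0 := by
  set g : ℂ → ℂ := fun w => -((w / (1 - w) ^ 2) ^ n * ((1 + w) / (1 - w) ^ 3)) with hg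
  have h1 : HasExp (fun s => 2 * (Complex.sinh (1 * s) / s) * base 1 s ^ (n + 2))
      (ps (PowerSeries.C 2 * sinS 1) * psiL 1 ^ (n + 2)) :=
    ((hasExp_psC 2).psMul (hasExp_sinh 1)).mul ((hasExp_base 1).pow (n + 2))
  have hne : ∀ᶠ w in 𝓝[≠] (sgn 1), w ≠ 1 := by
    filter_upwards [self_mem_nhdsWithin] with w hw
    simpa [sgn] using hw
  have h2 : HasRes g (sgn 1) 0 := by
    refine hasRes_deriv (F := fun w => -((n + 1 : ℂ)⁻¹ * (w / (1 - w) ^ 2) ^ (n + 1))) ?_ ?_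
    · filter_upwards [hne] with w hw
      have hw' : 1 - w ≠ 0 := sub_ne_zero.mpr (Ne.symm hw)
      have hn : (n + 1 : ℂ) ≠ 0 := Nat.cast_add_one_ne_zero n
      have hd := (((hasDerivAt_id' w).fun_div (((hasDerivAt_id' w).const_sub 1).fun_pow 2)
        (pow_ne_zero 2 hw')).fun_pow (n + 1)).const_mul ((n + 1 : ℂ)⁻¹) |>.fun_neg
      refine hd.congr_deriv ?_
      simp only [hg, Nat.add_sub_cancel]
      push_cast
      field_simp
      ring
    · filter_upwards [hne] with w hw
      have hw' : 1 - w ≠ 0 := sub_ne_zero.mpr (Ne.symm hw)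
      have : ContinuousAt (fun w : ℂ => 1 - w) w := by fun_prop
      exact (((continuousAt_id.div (this.pow 2) (pow_ne_zero 2 hw')).pow n).mul
        ((continuousAt_const.add continuousAt_id).div (this.pow 3) (pow_ne_zero 3 hw'))).neg
  rw [← residue_eq_coeff 1 h1 (g := g), h2.residue_eq]
  filter_upwards [eventually_base 1, self_mem_nhdsWithin] with s hs hs0
  have hs0' : s ≠ 0 := hs0
  have e1 : sgn 1 = 1 := by simp [sgn]
  have e2 : Complex.exp s * Complex.exp (-s) = 1 := by rw [← Complex.exp_add]; simp
  have e3 : 1 - Complex.exp s ≠ 0 := by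
    intro h
    apply hs
    have h' : Complex.exp s = 1 := (sub_eq_zero.mp h).symm
    rw [h', one_mul] at e2
    rw [Complex.cosh, h', e2, e1]
    norm_num
  have e4 : s * (2 * (Complex.sinh (1 * s) / s) * base 1 s ^ (n + 2)) =
      2 * Complex.sinh s * base 1 s ^ (n + 2) := by
    rw [one_mul]
    field_simp
  rw [e4, Complex.sinh]
  simp only [hg, base, e1, one_mul]
  generalize Complex.exp s = u at *
  have hu : u ≠ 0 := left_ne_zero_of_mul_eq_one e2
  rw [← inv_eq_of_mul_eq_one_right e2, pow_add]
  generalize (u / (1 - u) ^ 2) ^ n = q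
  field_simp
  ring

/-- Dividing `ψ ^ n + 4 ψ ^ (n + 1) = (2 sinh s) ^ 2 ψ ^ (n + 2)` by `2 sinh s` turns the right side
into the exact form above, so each power contributes `-1 / 4` times the previous one. -/
theorem coeff_cschS_mul_psiL_one (n : ℕ) :
    (ps cschS * psiL 1 ^ n).coeff 0 = 1 / 2 * (-1 / 4) ^ n := by
  have e1 : sgn 1 = 1 := by simp [sgn]
  induction n with
  | zero =>
    have h := coeff_ps_natCast cschS 0
    rw [PowerSeries.coeff_zero_eq_constantCoeff_apply, constantCoeff_cschS, Nat.cast_zero] at h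
    rw [pow_zero, mul_one, h, pow_zero, mul_one]
  | succ n ih =>
    have h1 : psiL 1 ^ n + HahnSeries.C 4 * psiL 1 ^ (n + 1) =
        xpow 1 * (ps (PowerSeries.C 2 * sinS 1) * (ps (PowerSeries.C 2 * sinS 1) * psiL 1 ^ (n + 2))) := by
      refine (((hasExp_base 1).pow n).add (((hasExp_base 1).pow (n + 1)).const_mul 4)).unique
        (((hasExp_xpow 1).mul (((hasExp_psC 2).psMul (hasExp_sinh 1)).mul
          (((hasExp_psC 2).psMul (hasExp_sinh 1)).mul ((hasExp_base 1).pow (n + 2))))).congr ?_)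
      filter_upwards [eventually_base 1, self_mem_nhdsWithin] with s hs hs0
      have hs0' : s ≠ 0 := hs0
      have h := two_sinh_sq_mul_base 1 hs
      rw [one_mul]
      field_simp
      linear_combination (-base 1 s ^ n) * h
    have h2 : ps cschS * psiL 1 ^ n + HahnSeries.C 4 * (ps cschS * psiL 1 ^ (n + 1)) =
        xpow 1 * (ps (PowerSeries.C 2 * sinS 1) * psiL 1 ^ (n + 2)) := by
      have h3 : ps (PowerSeries.C 2 * sinS 1) * ps cschS = 1 := by
        rw [← map_mul, cschS_mul, map_one]
      linear_combination ps cschS * h1 +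
        xpow 1 * (ps (PowerSeries.C 2 * sinS 1) * psiL 1 ^ (n + 2)) * h3
    have h4 := congrArg (fun A => HahnSeries.coeff A 0) h2
    simp only [HahnSeries.coeff_add, coeff_C_mul_laurent] at h4
    rw [coeff_xpow_mul, zero_sub, coeff_sinS_mul_psiL_pow, ih] at h4
    rw [pow_succ (-1 / 4 : ℂ)]
    linear_combination (1 / 4 : ℂ) * h4

/-- Here the series is regular, and its constant coefficient is `-1 / 4`. -/
theorem coeff_cschS_mul_psiL_neg_one (n : ℕ) :
    (ps cschS * psiL (-1) ^ n).coeff 0 = 1 / 2 * (-1 / 4) ^ n := by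
  have h1 : psiL (-1) = ps (-(2 * cosS 1 + 2)⁻¹) := by
    rw [psiL, if_neg (by decide), map_neg]
  have h := coeff_ps_natCast (cschS * (-(2 * cosS 1 + 2)⁻¹) ^ n) 0
  rw [PowerSeries.coeff_zero_eq_constantCoeff_apply, Nat.cast_zero] at h
  rw [h1, ← map_pow, ← map_mul, h, map_mul, map_pow, map_neg, constantCoeff_cschS,
    PowerSeries.constantCoeff_inv, constantCoeff_two_mul_cosS]
  congr 2
  norm_num

theorem coeff_cschS_mul_psiL (γ : ℤˣ) (n : ℕ) :
    (ps cschS * psiL γ ^ n).coeff 0 = 1 / 2 * (-1 / 4) ^ n := by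
  rcases Int.units_eq_one_or γ with rfl | rfl
  · exact coeff_cschS_mul_psiL_one n
  · exact coeff_cschS_mul_psiL_neg_one n

/-- The expansions at the branch points of the global functions with poles at the branch points
that are invariant under the involution. -/
inductive Glob : (ℤˣ → LaurentSeries ℂ) → Prop
  | pow (α : ℤˣ) (n : ℕ) : Glob fun β => psiL (α * β) ^ n
  | add {A B : ℤˣ → LaurentSeries ℂ} : Glob A → Glob B → Glob fun β => A β + B β
  | const_mul (a : ℂ) {A : ℤˣ → LaurentSeries ℂ} : Glob A → Glob fun β => HahnSeries.C a * A β

/-- The residue theorem for `A dw / (w (w - 1/w))`, where `w - 1/w = 2 β sinh s`. For a power of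
`psiL` both branch points give the same coefficient, and the signs cancel. -/
theorem Glob.sum_coeff {A : ℤˣ → LaurentSeries ℂ} (h : Glob A) :
    ∑ β : ℤˣ, sgn β * (ps cschS * A β).coeff 0 = 0 := by
  induction h with
  | pow α n =>
    simp only [coeff_cschS_mul_psiL, ← Finset.sum_mul]
    rw [show ∑ β : ℤˣ, sgn β = 0 by simp [sgn, UnitsInt.univ]]
    simp
  | add _ _ h1 h2 =>
    simp only [mul_add, HahnSeries.coeff_add, Finset.sum_add_distrib, h1, h2, add_zero]
  | @const_mul a A _ h =>
    have : ∀ β, sgn β * (ps cschS * (HahnSeries.C a * A β)).coeff 0 =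
        a * (sgn β * (ps cschS * A β).coeff 0) := fun β => by
      rw [mul_left_comm, coeff_C_mul_laurent]; ring
    simp only [this, ← Finset.mul_sum, h, mul_zero]

/-- Products of poles at different branch points are reduced to sums by partial fractions, by
induction on the exponent. -/
theorem Glob.psiL_mul (α : ℤˣ) {A : ℤˣ → LaurentSeries ℂ} (h : Glob A) :
    Glob fun β => psiL (α * β) * A β := by
  induction h with
  | pow α' n =>
    rcases eq_or_ne α' α with rfl | hne
    · simpa only [← pow_succ'] using Glob.pow α' (n + 1)
    · have hneg : α' = -α := by
        rcases Int.units_eq_one_or α with rfl | rfl <;> rcases Int.units_eq_one_or α' with rfl | rfl <;>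
          simp_all
      subst hneg
      induction n with
      | zero => simpa using Glob.pow α 1
      | succ n ih =>
        have e : (fun β => psiL (α * β) * psiL (-α * β) ^ (n + 1)) = fun β =>
            HahnSeries.C (-1 / 4) * (psiL (α * β) * psiL (-α * β) ^ n) +
              HahnSeries.C (-1 / 4) * psiL (-α * β) ^ (n + 1) := by
          funext β
          have := psiL_mul_psiL_neg (α * β)
          rw [← neg_mul] at this
          linear_combination psiL (-α * β) ^ n * this
        rw [e]
        exact (ih.const_mul _).add ((Glob.pow (-α) (n + 1)).const_mul _)
  | add _ _ h1 h2 => simpa only [mul_add] using h1.add h2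
  | const_mul a _ h => simpa only [mul_left_comm] using h.const_mul a

theorem Glob.eval_mul (α : ℤˣ) (p : Polynomial ℂ) {A : ℤˣ → LaurentSeries ℂ} (h : Glob A) :
    Glob fun β => p.eval₂ (HahnSeries.C : ℂ →+* LaurentSeries ℂ) (psiL (α * β)) * A β := by
  induction p using Polynomial.induction_on' with
  | add p q hp hq => simpa only [Polynomial.eval₂_add, add_mul] using hp.add hq
  | monomial n a =>
    have key : Glob fun β => psiL (α * β) ^ n * A β := by
      induction n with
      | zero => simpa using h
      | succ n ih => simpa only [pow_succ', mul_assoc] using ih.psiL_mul α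
    simpa only [Polynomial.eval₂_monomial, mul_assoc] using key.const_mul a

theorem exists_eL_eq (i : Idx) : ∃ p : Polynomial ℂ, ∀ β, eL β i =
    psiL (i.1 * β) * p.eval₂ (HahnSeries.C : ℂ →+* LaurentSeries ℂ) (psiL (i.1 * β)) := by
  obtain ⟨q, hq⟩ := X_dvd_derivPoly i.2
  refine ⟨Polynomial.C (((2 * i.2).factorial : ℂ)⁻¹) * q, fun β => ?_⟩
  rw [eL_eq_eval, hq, Polynomial.eval₂_mul, Polynomial.eval₂_mul, Polynomial.eval₂_X,
    Polynomial.eval₂_C]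
  ring

theorem Glob.eL_mul (i : Idx) {A : ℤˣ → LaurentSeries ℂ} (h : Glob A) :
    Glob fun β => eL β i * A β := by
  obtain ⟨p, hp⟩ := exists_eL_eq i
  simpa only [hp, mul_assoc] using (h.eval_mul i.1 p).psiL_mul i.1

/-- The multiplier is the function `w + 1/w`. Its poles at `0` and `∞` are absorbed by the factor
`psiL` of the basis form, as `2 cosh s ψ = γ + 2 γ ψ`. -/
theorem Glob.cosS_mul_eL_mul (i : Idx) {A : ℤˣ → LaurentSeries ℂ} (h : Glob A) :
    Glob fun β => HahnSeries.C (sgn β) * ps (2 * cosS 1) * (eL β i * A β) := by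
  obtain ⟨p, hp⟩ := exists_eL_eq i
  have h1 := h.eval_mul i.1 p
  have e : (fun β => HahnSeries.C (sgn β) * ps (2 * cosS 1) * (eL β i * A β)) = fun β =>
      HahnSeries.C (sgn i.1) * (p.eval₂ (HahnSeries.C : ℂ →+* LaurentSeries ℂ) (psiL (i.1 * β)) * A β) +
      HahnSeries.C (2 * sgn i.1) *
        (psiL (i.1 * β) * (p.eval₂ (HahnSeries.C : ℂ →+* LaurentSeries ℂ) (psiL (i.1 * β)) * A β)) := by
    funext β
    have h2 := two_cosS_mul_psiL (i.1 * β)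
    have h3 : HahnSeries.C (sgn β) * HahnSeries.C (sgn β) = (1 : LaurentSeries ℂ) := by
      rw [← map_mul, sgn_mul_self, map_one]
    simp only [sgn_mul, map_mul] at h2 ⊢
    rw [hp]
    generalize Polynomial.eval₂ (HahnSeries.C : ℂ →+* LaurentSeries ℂ) (psiL (i.1 * β)) p = q
    linear_combination HahnSeries.C (sgn β) * q * A β * h2 + (HahnSeries.C (sgn i.1) * q * A β +
      HahnSeries.C 2 * HahnSeries.C (sgn i.1) * psiL (i.1 * β) * q * A β) * h3
  rw [e]
  exact (h1.const_mul _).add ((h1.psiL_mul i.1).const_mul _)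

theorem glob_one : Glob fun _ => 1 := by
  simpa using Glob.pow 1 0

end EynardOrantin

end

/-! ### The string equations and the dilaton direction. -/

noncomputable section

namespace EynardOrantin

open MvPolynomial

/-- The jet as a linear function of one direction. -/
def jetVec (s : Multiset (Idx → ℂ)) (p : Poly) : (Idx → ℂ) →ₗ[ℂ] ℂ where
  toFun d := jet s (vecD d p)
  map_add' d e := by rw [vecD_add, Derivation.add_apply, jet_add]
  map_smul' a d := by
    rw [vecD_smul, Derivation.smul_apply, smul_eq_C_mul, jet_C_mul]; rfl

theorem jetVec_apply (s : Multiset (Idx → ℂ)) (p : Poly) (d : Idx → ℂ) :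
    jetVec s p d = jet s (vecD d p) := rfl

theorem jetVec_congr (s : Multiset (Idx → ℂ)) (p : Poly) (K : ℕ) (hK : bd p ≤ K) {d e : Idx → ℂ}
    (h : ∀ i ∈ box K, d i = e i) : jetVec s p d = jetVec s p e := by
  have hS := pderiv_eq_zero_of_notMem_box hK
  rw [jetVec_apply, jetVec_apply, vecD_eq_sum d p _ hS, vecD_eq_sum e p _ hS]
  congr 1
  exact Finset.sum_congr rfl fun i hi => by rw [h i hi]

theorem jet_fieldD_virField {τ : Type*} [DecidableEq τ] (φ : τ → Idx → ℂ) (S : Finset τ) (β : ℤˣ)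
    (j : ℕ) (p : Poly) : jet (S.val.map φ) (fieldD (virField corr β j) p) =
      ∑ t ∈ S, jetVec ((S.erase t).val.map φ) p
        fun i => 2 * (fieldL β (φ t) * eL β i).coeff (-j) := by
  have hS := pderiv_eq_zero_of_notMem_box (le_refl (bd p))
  simp only [jetVec_apply, vecD_eq_sum _ p _ hS, fieldD_eq_sum _ p _ hS, jet_sum]
  rw [Finset.sum_comm]
  refine Finset.sum_congr rfl fun i _ => ?_
  simp only [virField, Finset.sum_mul, jet_sum, mul_assoc, jet_C_mul, jet_X_mul, coeff_fieldL_mul_eL]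
  simp only [Finset.mul_sum]
  rw [Finset.sum_comm]
  refine Finset.sum_congr rfl fun t _ => Finset.sum_congr rfl fun ν _ => ?_
  ring

theorem sum_C_mul_lap_eq_zero (w : Idx → ℂ) (S : Finset Idx) (c : Idx → Idx → ℂ) (p : Poly)
    (K : ℕ) (hK : bd p ≤ K)
    (h : ∀ i ∈ box K, ∀ i' ∈ box K, ∑ x ∈ S, w x * virMat c x.1 x.2 i i' = 0) :
    ∑ x ∈ S, C (w x) * lap (virMat c x.1 x.2) p = 0 := by
  simp only [lap_double_sum _ p _ (pderiv_eq_zero_of_notMem_box hK), Finset.mul_sum]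
  rw [Finset.sum_comm]
  refine Finset.sum_eq_zero fun i hi => ?_
  rw [Finset.sum_comm]
  refine Finset.sum_eq_zero fun i' hi' => ?_
  simp only [← mul_assoc, ← C_mul]
  rw [← Finset.sum_mul, ← map_sum, h i hi i' hi', map_zero, zero_mul]

theorem sum_C_mul_gam_eq_zero (w : Idx → ℂ) (S : Finset Idx) (c : Idx → Idx → ℂ) (p q : Poly)
    (K : ℕ) (hp : bd p ≤ K) (hq : bd q ≤ K)
    (h : ∀ i ∈ box K, ∀ i' ∈ box K, ∑ x ∈ S, w x * virMat c x.1 x.2 i i' = 0) :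
    ∑ x ∈ S, C (w x) * gam (virMat c x.1 x.2) p q = 0 := by
  simp only [gam_double_sum _ p q _ (pderiv_eq_zero_of_notMem_box hp)
    (pderiv_eq_zero_of_notMem_box hq), Finset.mul_sum]
  rw [Finset.sum_comm]
  refine Finset.sum_eq_zero fun i hi => ?_
  rw [Finset.sum_comm]
  refine Finset.sum_eq_zero fun i' hi' => ?_
  simp only [← mul_assoc, ← C_mul]
  simp only [mul_assoc, C_mul]
  simp only [← mul_assoc, ← C_mul]
  rw [← Finset.sum_mul, ← Finset.sum_mul, ← map_sum, h i hi i' hi', map_zero, zero_mul, zero_mul]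

/-- A linear combination of the recursion relations in which the quadratic terms cancel. -/
theorem weighted_recursion {V : ℤˣ → ℕ → ℂ} {F : ℕ → Poly} (hF : IsFreeEnergy corr V F) (w : Idx → ℂ)
    (J K n : ℕ) (hK : ∀ k ≤ n + 1, bd (F k) ≤ K)
    (h : ∀ i ∈ box K, ∀ i' ∈ box K, ∑ x ∈ box J, w x * virMat corr x.1 x.2 i i' = 0)
    {τ : Type*} [DecidableEq τ] (φ : τ → Idx → ℂ) (S : Finset τ) :
    jetVec (S.val.map φ) (F (n + 2)) (∑ x ∈ box J, w x • dvec V x.1 x.2) =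
      ∑ t ∈ S, jetVec ((S.erase t).val.map φ) (F (n + 1))
        (∑ x ∈ box J, w x • fun i => 2 * (fieldL x.1 (φ t) * eL x.1 i).coeff (-x.2)) := by
  have e1 : jetVec (S.val.map φ) (F (n + 2)) (∑ x ∈ box J, w x • dvec V x.1 x.2) =
      jet (S.val.map φ) (∑ x ∈ box J, C (w x) * vecD (dvec V x.1 x.2) (F (n + 2))) := by
    rw [map_sum, jet_sum]
    exact Finset.sum_congr rfl fun x _ => by rw [map_smul, smul_eq_mul, jet_C_mul, jetVec_apply]
  have e2 : ∑ t ∈ S, jetVec ((S.erase t).val.map φ) (F (n + 1))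
        (∑ x ∈ box J, w x • fun i => 2 * (fieldL x.1 (φ t) * eL x.1 i).coeff (-x.2)) =
      jet (S.val.map φ) (∑ x ∈ box J, C (w x) * fieldD (virField corr x.1 x.2) (F (n + 1))) := by
    rw [jet_sum, Finset.sum_congr rfl fun t _ => map_sum _ _ _, Finset.sum_comm]
    refine Finset.sum_congr rfl fun x _ => ?_
    rw [jet_C_mul, jet_fieldD_virField, Finset.mul_sum]
    exact Finset.sum_congr rfl fun t _ => by rw [map_smul, smul_eq_mul]
  rw [e1, e2]
  refine congrArg (jet (S.val.map φ)) ?_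
  -- The index `n + 1` is positive, so the inhomogeneous term of the recursion is absent.
  have hrec : ∀ x ∈ box J, C (w x) * vecD (dvec V x.1 x.2) (F (n + 2)) =
      C (w x) * fieldD (virField corr x.1 x.2) (F (n + 1)) +
      (C (w x) * lap (virMat corr x.1 x.2) (F (n + 1)) +
        ∑ y ∈ Finset.HasAntidiagonal.antidiagonal (n + 1),
          C (w x) * gam (virMat corr x.1 x.2) (F y.1) (F y.2)) := fun x _ => by
    rw [hF.2 (n + 1), if_neg (by omega), zero_add, mul_add, mul_add, Finset.mul_sum, add_assoc]
  have hgam : ∑ x ∈ box J, ∑ y ∈ Finset.HasAntidiagonal.antidiagonal (n + 1),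
      C (w x) * gam (virMat corr x.1 x.2) (F y.1) (F y.2) = 0 := by
    rw [Finset.sum_comm]
    refine Finset.sum_eq_zero fun y hy => ?_
    have hy' := Finset.HasAntidiagonal.mem_antidiagonal.mp hy
    exact sum_C_mul_gam_eq_zero w _ _ _ _ K (hK _ (by omega)) (hK _ (by omega)) h
  rw [Finset.sum_congr rfl hrec, Finset.sum_add_distrib, Finset.sum_add_distrib,
    sum_C_mul_lap_eq_zero w _ _ _ K (hK _ le_rfl) h, hgam, add_zero, add_zero]

/-- The coefficients of the expansion of `α ^ b * cosh (b * s)` at the branch points. -/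
def sVec (b : ℤ) (i : Idx) : ℂ := sgn i.1 ^ b * PowerSeries.coeff i.2 (cosS b)

theorem sgn_zpow_add_two (β : ℤˣ) (b : ℤ) : sgn β ^ (b + 2) = sgn β ^ b := by
  rw [zpow_add₀ (sgn_ne_zero β)]
  rw [show sgn β ^ (2 : ℤ) = 1 from (zpow_ofNat _ 2).trans (sgn_sq β), mul_one]

theorem sgn_zpow_neg (β : ℤˣ) (b : ℤ) : sgn β ^ (-b) = sgn β ^ b := by
  rw [zpow_neg, ← inv_zpow, sgn_inv]

theorem sVec_neg (b : ℤ) : sVec (-b) = sVec b := by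
  funext i
  rw [sVec, sVec, sgn_zpow_neg, Int.cast_neg, cosS_neg]

theorem fieldL_sVec (β : ℤˣ) (b : ℤ) :
    fieldL β (sVec b) = HahnSeries.C (sgn β ^ b) * ps (cosS b) := by
  rw [fieldL, ← HahnSeries.ofPowerSeries_C, ← map_mul]
  congr 1
  ext k
  rw [PowerSeries.coeff_mk, PowerSeries.coeff_C_mul, sVec]

/-- The residues of the basis forms with hyperbolic functions. -/
def hypRes (b : ℤ) (i : Idx) : ℂ :=
  ∑ β : ℤˣ, sgn β ^ (b + 1) * (ps (cosS b * cschS) * eL β i).coeff 0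

theorem hypRes_zero : hypRes 0 = 0 := by
  funext i
  have h := (glob_one.eL_mul i).sum_coeff
  simp only [mul_one] at h
  rw [Pi.zero_apply, ← h]
  refine Finset.sum_congr rfl fun β _ => ?_
  rw [zero_add, zpow_one, Int.cast_zero, cosS_zero, one_mul]

/-- The factor `β cosh s` is half of `w + 1/w`, and one basis form is enough to absorb it. -/
theorem hypRes_one : hypRes 1 = 0 := by
  funext i
  have h := (glob_one.cosS_mul_eL_mul i).sum_coeff
  simp only [mul_one] at h
  have e : ∀ β : ℤˣ, sgn β ^ ((1 : ℤ) + 1) * (ps (cosS (1 : ℤ) * cschS) * eL β i).coeff 0 =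
      1 / 2 * (sgn β * (ps cschS * (HahnSeries.C (sgn β) * ps (2 * cosS 1) * eL β i)).coeff 0) := by
    intro β
    have e1 : ps cschS * (HahnSeries.C (sgn β) * ps (2 * cosS 1) * eL β i) =
        HahnSeries.C (2 * sgn β) * (ps (cosS 1 * cschS) * eL β i) := by
      rw [map_mul ps, map_mul ps, map_mul, map_ofNat, map_ofNat]
      ring
    rw [e1, coeff_C_mul_laurent, Int.cast_one]
    rw [show sgn β ^ ((1 : ℤ) + 1) = 1 from (zpow_ofNat _ 2).trans (sgn_sq β)]
    linear_combination (-(ps (cosS 1 * cschS) * eL β i).coeff 0) * sgn_sq β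
  rw [hypRes, Finset.sum_congr rfl fun β _ => e β, ← Finset.mul_sum, h, mul_zero]
  rfl

theorem coeff_sinS (b : ℂ) (k : ℕ) :
    (2 * (k : ℂ) + 1) * PowerSeries.coeff k (sinS b) = b * PowerSeries.coeff k (cosS b) := by
  rw [sinS, cosS, PowerSeries.coeff_mk, PowerSeries.coeff_mk, Nat.factorial_succ]
  have h : ((2 * k).factorial : ℂ) ≠ 0 := Nat.cast_ne_zero.mpr (Nat.factorial_ne_zero _)
  have h2 : (2 * (k : ℂ) + 1) ≠ 0 := by
    exact_mod_cast (Nat.cast_ne_zero (R := ℂ)).mpr (Nat.succ_ne_zero (2 * k))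
  push_cast
  field_simp
  ring

/-- `cosh ((b + 1) s) - cosh ((b - 1) s) = 2 sinh (b s) sinh s` cancels the denominator. Only the
pole of the basis form is left to contribute, at its own branch point. -/
theorem hypRes_add_one_sub (b : ℤ) : hypRes (b + 1) - hypRes (b - 1) = (b : ℂ) • sVec b := by
  funext i
  have e1 : cosS ((b + 1 : ℤ) : ℂ) * cschS =
      PowerSeries.X * sinS b + cosS ((b - 1 : ℤ) : ℂ) * cschS := by
    push_cast
    have h := sinS_mul_sinS b 1
    linear_combination (-cschS) * h + PowerSeries.X * sinS b * cschS_mul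
  have e2 : ∀ β : ℤˣ, (ps (PowerSeries.X * sinS b) * eL β i).coeff 0 =
      if i.1 = β then (b : ℂ) * PowerSeries.coeff i.2 (cosS b) else 0 := by
    intro β
    have hX : ps PowerSeries.X = xpow 1 := by simp
    rw [map_mul, hX, mul_assoc, coeff_xpow_mul, zero_sub, coeff_ps_mul _ _ _ (i.2 + 1)]
    · rw [← coeff_sinS, Finset.sum_eq_single i.2]
      · rw [coeff_eL, modeVec_of_neg _ _ _ (by omega)]
        by_cases h : i.1 = β
        · rw [if_pos h, if_pos ⟨h, by ring⟩]; ring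
        · rw [if_neg h, if_neg fun hc => h hc.1, mul_zero]
      · intro k _ hk
        rw [coeff_eL, modeVec_of_neg _ _ _ (by omega), if_neg, mul_zero]
        omega
      · intro h
        simp at h
    · intro j hj
      rw [coeff_eL, modeVec_of_neg _ _ _ (by omega), if_neg]
      omega
  have e3 : ∀ β : ℤˣ, sgn β ^ (b + 1 + 1) * (ps (cosS ((b + 1 : ℤ) : ℂ) * cschS) * eL β i).coeff 0 =
      sgn β ^ b * (if i.1 = β then (b : ℂ) * PowerSeries.coeff i.2 (cosS b) else 0) +
      sgn β ^ (b - 1 + 1) * (ps (cosS ((b - 1 : ℤ) : ℂ) * cschS) * eL β i).coeff 0 := by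
    intro β
    rw [e1, map_add, add_mul, HahnSeries.coeff_add, e2, sub_add_cancel,
      show b + 1 + 1 = b + 2 by ring, sgn_zpow_add_two, mul_add]
  rw [Pi.sub_apply, hypRes, hypRes, Finset.sum_congr rfl fun β _ => e3 β, Finset.sum_add_distrib,
    add_sub_cancel_right]
  simp only [mul_ite, mul_zero, Finset.sum_ite_eq, Finset.mem_univ, if_true, Pi.smul_apply, smul_eq_mul,
    sVec]
  ring

theorem hypRes_natCast (b : ℕ) : hypRes b =
    ∑ k ∈ (Finset.Icc 1 (b : ℤ)).filter (fun k => ¬ k ≡ b [ZMOD 2]), (k : ℂ) • sVec k := by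
  induction b using Nat.twoStepInduction with
  | zero => simp [hypRes_zero]
  | one =>
    rw [Nat.cast_one, hypRes_one, Finset.sum_eq_zero]
    intro k hk
    rw [Finset.mem_filter, Finset.mem_Icc] at hk
    exact absurd (by rw [show k = 1 by omega]) hk.2
  | more b ih _ =>
    have h := hypRes_add_one_sub (b + 1)
    have e : (Finset.Icc 1 ((b + 2 : ℕ) : ℤ)).filter (fun k => ¬ k ≡ ((b + 2 : ℕ) : ℤ) [ZMOD 2]) =
        insert ((b : ℤ) + 1) ((Finset.Icc 1 (b : ℤ)).filter (fun k => ¬ k ≡ b [ZMOD 2])) := by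
      ext k
      rw [Finset.mem_insert, Finset.mem_filter, Finset.mem_filter, Finset.mem_Icc, Finset.mem_Icc,
        Int.ModEq, Int.ModEq]
      omega
    rw [e, Finset.sum_insert (by simp), ← ih, show ((b + 2 : ℕ) : ℤ) = (b : ℤ) + 1 + 1 by push_cast; ring]
    rw [add_sub_cancel_right] at h
    rw [← h]
    abel

theorem hypRes_of_nonneg {b : ℤ} (hb : 0 ≤ b) : hypRes b =
    ∑ k ∈ (Finset.Icc 1 b).filter (fun k => ¬ k ≡ b [ZMOD 2]), (k : ℂ) • sVec k := by
  lift b to ℕ using hb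
  exact hypRes_natCast b

theorem hypRes_add_hypRes {b : ℤ} (hb : 0 ≤ b) : hypRes (b + 1) + hypRes (b - 1) =
    2 • ∑ k ∈ (Finset.Icc 1 b).filter (fun k => k ≡ b [ZMOD 2]), (k : ℂ) • sVec k - (b : ℂ) • sVec b := by
  have h := hypRes_of_nonneg (b := b + 1) (by omega)
  have e : (Finset.Icc 1 (b + 1)).filter (fun k => ¬ k ≡ b + 1 [ZMOD 2]) =
      (Finset.Icc 1 b).filter (fun k => k ≡ b [ZMOD 2]) := by
    ext k
    rw [Finset.mem_filter, Finset.mem_filter, Finset.mem_Icc, Finset.mem_Icc, Int.ModEq, Int.ModEq]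
    omega
  rw [e] at h
  rw [← h, ← hypRes_add_one_sub]
  abel

/-- The weights of the string equations. -/
def hypS (a : ℕ) : PowerSeries ℂ := PowerSeries.C 2 * cosS a * cschS

theorem cosS_two : PowerSeries.C 2 * cosS 2 = (2 * cosS 1) ^ 2 - PowerSeries.C 2 := by
  have h := cosS_mul_cosS 1 1
  rw [sub_self, cosS_zero, show (1 : ℂ) + 1 = 2 by norm_num] at h
  have h2 : (PowerSeries.C 2 : PowerSeries ℂ) = 2 := map_ofNat _ 2
  rw [h2] at h ⊢
  linear_combination (-2) * h

/-- Each of the two basis forms absorbs one factor `w + 1/w`, and `w^2 + w^(-2) = (w + 1/w) ^ 2 -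
2`; this is where `a ≤ 2` is needed. -/
theorem sum_hypS_eL_mul_eL {a : ℕ} (ha : a ≤ 2) (i i' : Idx) :
    ∑ β : ℤˣ, sgn β ^ (a + 1) * (ps (hypS a) * (eL β i * eL β i')).coeff 0 = 0 := by
  have h0 := ((glob_one.eL_mul i').eL_mul i).sum_coeff
  have h1 := ((glob_one.eL_mul i').cosS_mul_eL_mul i).sum_coeff
  have h2 := ((glob_one.cosS_mul_eL_mul i').cosS_mul_eL_mul i).sum_coeff
  simp only [mul_one] at h0 h1 h2
  have hC : (ps (PowerSeries.C 2) : LaurentSeries ℂ) = HahnSeries.C 2 := HahnSeries.ofPowerSeries_C _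
  have hC2 : (2 : LaurentSeries ℂ) = HahnSeries.C 2 := (map_ofNat _ 2).symm
  have hs : ∀ β, (HahnSeries.C (sgn β) * HahnSeries.C (sgn β) : LaurentSeries ℂ) = 1 := fun β => by
    rw [← map_mul, sgn_mul_self, map_one]
  interval_cases a
  · have e : ∀ β : ℤˣ, sgn β ^ (0 + 1) * (ps (hypS 0) * (eL β i * eL β i')).coeff 0 =
        2 * (sgn β * (ps cschS * (eL β i * eL β i')).coeff 0) := fun β => by
      rw [hypS, Nat.cast_zero, cosS_zero, mul_one, map_mul, hC, mul_assoc, coeff_C_mul_laurent]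
      ring
    rw [Finset.sum_congr rfl fun β _ => e β, ← Finset.mul_sum, h0, mul_zero]
  · rw [← h1]
    refine Finset.sum_congr rfl fun β _ => ?_
    have e : ps cschS * (HahnSeries.C (sgn β) * ps (2 * cosS 1) * (eL β i * eL β i')) =
        HahnSeries.C (sgn β) * (ps (hypS 1) * (eL β i * eL β i')) := by
      rw [hypS, Nat.cast_one, map_mul ps, map_mul ps, map_mul ps, hC, map_ofNat, hC2]
      ring
    rw [e, coeff_C_mul_laurent]
    ring
  · have e : ∀ β : ℤˣ, sgn β ^ (2 + 1) * (ps (hypS 2) * (eL β i * eL β i')).coeff 0 =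
        sgn β * (ps cschS * (HahnSeries.C (sgn β) * ps (2 * cosS 1) *
          (eL β i * (HahnSeries.C (sgn β) * ps (2 * cosS 1) * eL β i')))).coeff 0 -
        2 * (sgn β * (ps cschS * (eL β i * eL β i')).coeff 0) := fun β => by
      have e1 : ps (hypS 2) * (eL β i * eL β i') =
          ps cschS * (HahnSeries.C (sgn β) * ps (2 * cosS 1) *
          (eL β i * (HahnSeries.C (sgn β) * ps (2 * cosS 1) * eL β i'))) +
          HahnSeries.C (-2) * (ps cschS * (eL β i * eL β i')) := by
        rw [hypS, Nat.cast_ofNat, cosS_two, map_mul ps, map_sub, map_pow, hC, map_neg]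
        linear_combination (-ps cschS * ps (2 * cosS 1) ^ 2 * eL β i * eL β i') * hs β
      rw [e1, HahnSeries.coeff_add, coeff_C_mul_laurent, show sgn β ^ (2 + 1) = sgn β by
        rw [pow_succ, sgn_sq, one_mul]]
      ring
    rw [Finset.sum_congr rfl fun β _ => e β, Finset.sum_sub_distrib, h2, ← Finset.mul_sum, h0]
    norm_num

/-- The coefficients of the weights of the string equations. -/
def hypW (a : ℕ) (x : Idx) : ℂ := sgn x.1 ^ (a + 1) * PowerSeries.coeff x.2 (hypS a)

theorem sum_box_hypW (a J : ℕ) (A : ℤˣ → LaurentSeries ℂ)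
    (hA : ∀ β (j : ℕ), J ≤ j → (A β).coeff (-j) = 0) :
    ∑ x ∈ box J, hypW a x * (A x.1).coeff (-x.2) =
      ∑ β : ℤˣ, sgn β ^ (a + 1) * (ps (hypS a) * A β).coeff 0 := by
  rw [box, Finset.sum_product]
  refine Finset.sum_congr rfl fun β _ => ?_
  rw [coeff_ps_mul _ _ _ J fun j hj => by rw [zero_sub]; exact hA β j hj, Finset.mul_sum]
  refine Finset.sum_congr rfl fun j _ => ?_
  rw [hypW, zero_sub, mul_assoc]

theorem sum_hypW_virMat {a : ℕ} (ha : a ≤ 2) {J : ℕ} {i i' : Idx} (hJ : i.2 + i'.2 + 3 ≤ J) :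
    ∑ x ∈ box J, hypW a x * virMat corr x.1 x.2 i i' = 0 := by
  have h := sum_box_hypW a J (fun β => eL β i * eL β i') fun β j hj => by
    rw [coeff_eL_mul_eL, virMat, Finset.sum_eq_zero, modeVec_of_neg _ _ _ (by omega),
      if_neg (c := _ ∧ _) (by omega), mul_zero, ite_self, add_zero]
    intro ν _
    rw [modeVec_neg_sub, if_neg (by omega), if_neg (by omega), mul_zero]
  rw [sum_hypS_eL_mul_eL ha] at h
  simpa only [coeff_eL_mul_eL] using h

/-- The weight cancels the `sinh s` in the potential, and `2 cosh (a s) sinh (m s)` splits into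
`sinh ((m + a) s) + sinh ((m - a) s)`; the factor `2 k + 1` turns the coefficients of `sinh (c s) /
s` into `c` times those of `cosh (c s)`. -/
theorem sum_hypW_dvec (a m J : ℕ) (i : Idx) (hi : i.2 < J) :
    (∑ x ∈ box J, hypW a x • dvec (potV m) x.1 x.2) i =
      2 / (m : ℂ) * (((m : ℂ) + a) * sVec (m + a) i + ((m : ℂ) - a) * sVec (m - a) i) := by
  have h1 : (∑ x ∈ box J, hypW a x • dvec (potV m) x.1 x.2) i =
      (2 * (i.2 : ℂ) + 1) * (sgn i.1 ^ (a + 1) * PowerSeries.coeff i.2 (hypS a * potS m i.1)) := by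
    rw [Finset.sum_apply, box, Finset.sum_product, Finset.sum_eq_single i.1]
    · rw [PowerSeries.coeff_mul, Finset.Nat.sum_antidiagonal_eq_sum_range_succ_mk,
        ← Finset.sum_subset (Finset.range_subset_range.mpr (Nat.succ_le_of_lt hi)), Finset.mul_sum,
        Finset.mul_sum]
      · refine Finset.sum_congr rfl fun j hj => ?_
        rw [Finset.mem_range] at hj
        rw [Pi.smul_apply, dvec, if_pos ⟨rfl, by omega⟩, potV, hypW, smul_eq_mul]
        ring
      · intro j _ hj
        rw [Finset.mem_range] at hj
        rw [Pi.smul_apply, dvec, if_neg (by omega), smul_zero]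
    · intro β _ hβ
      refine Finset.sum_eq_zero fun j _ => ?_
      rw [Pi.smul_apply, dvec, if_neg fun hc => hβ hc.1.symm, smul_zero]
    · intro h
      exact absurd (Finset.mem_univ _) h
  have h2 : hypS a * potS m i.1 = PowerSeries.C (2 * sgn i.1 ^ (m + 1) / m) *
      (sinS ((m : ℂ) + a) + sinS ((m : ℂ) - a)) := by
    have e1 := cosS_mul_sinS a m
    have e2 : (PowerSeries.C (4 * sgn i.1 ^ (m + 1) / m) : PowerSeries ℂ) =
        PowerSeries.C 2 * PowerSeries.C (2 * sgn i.1 ^ (m + 1) / m) := by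
      rw [← map_mul]; congr 1; ring
    rw [hypS, potS, e2]
    linear_combination PowerSeries.C (2 * sgn i.1 ^ (m + 1) / m) * e1 +
      PowerSeries.C (2 * sgn i.1 ^ (m + 1) / m) * PowerSeries.C 2 * cosS a * sinS m * cschS_mul
  have h3 : sgn i.1 ^ ((m : ℤ) + a) = sgn i.1 ^ (a + 1) * sgn i.1 ^ (m + 1) := by
    rw [← pow_add, show a + 1 + (m + 1) = m + a + 2 by ring, pow_add, sgn_sq, mul_one]
    norm_cast
  have h4 : sgn i.1 ^ ((m : ℤ) - a) = sgn i.1 ^ ((m : ℤ) + a) := by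
    rw [sub_eq_add_neg, zpow_add₀ (sgn_ne_zero _), sgn_zpow_neg, ← zpow_add₀ (sgn_ne_zero _)]
  rw [h1, h2, PowerSeries.coeff_C_mul, map_add, sVec, sVec, h4, h3]
  have e3 := coeff_sinS ((m : ℂ) + a) i.2
  have e4 := coeff_sinS ((m : ℂ) - a) i.2
  push_cast
  linear_combination (2 / (m : ℂ) * sgn i.1 ^ (a + 1) * sgn i.1 ^ (m + 1)) * (e3 + e4)

/-- The product formula for `2 cosh (a s) cosh (b s)`; the parity of `b ± a` matches the signs. -/
theorem sum_hypW_field (a J : ℕ) (b : ℤ) (i : Idx) (hi : i.2 + 2 ≤ J) :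
    (∑ x ∈ box J, hypW a x • fun i => 2 * (fieldL x.1 (sVec b) * eL x.1 i).coeff (-x.2)) i =
      2 * (hypRes (b + a) i + hypRes (b - a) i) := by
  have h := sum_box_hypW a J (fun β => fieldL β (sVec b) * eL β i) fun β j hj => by
    rw [coeff_fieldL_mul_eL]
    refine Finset.sum_eq_zero fun ν _ => ?_
    rw [modeVec_neg_sub, if_neg (by omega), if_neg (by omega), mul_zero]
  have e1 : (∑ x ∈ box J, hypW a x • fun i => 2 * (fieldL x.1 (sVec b) * eL x.1 i).coeff (-x.2)) i =
      2 * ∑ x ∈ box J, hypW a x * (fieldL x.1 (sVec b) * eL x.1 i).coeff (-x.2) := by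
    rw [Finset.sum_apply, Finset.mul_sum]
    refine Finset.sum_congr rfl fun x _ => ?_
    rw [Pi.smul_apply, smul_eq_mul]
    ring
  rw [e1, h, hypRes, hypRes, ← Finset.sum_add_distrib]
  congr 1
  refine Finset.sum_congr rfl fun β _ => ?_
  have e2 : ps (hypS a) * (fieldL β (sVec b) * eL β i) = HahnSeries.C (sgn β ^ b) *
      (ps (cosS ((b + a : ℤ) : ℂ) * cschS) * eL β i + ps (cosS ((b - a : ℤ) : ℂ) * cschS) * eL β i) := by
    have e3 := congrArg ps (cosS_mul_cosS b a)
    rw [map_mul, map_mul, map_add] at e3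
    rw [fieldL_sVec, hypS, map_mul ps, map_mul ps, map_mul ps, map_mul ps]
    push_cast
    linear_combination HahnSeries.C (sgn β ^ b) * ps cschS * eL β i * e3
  have h3 : sgn β ^ (b + a + 1) = sgn β ^ (a + 1) * sgn β ^ b := by
    rw [← zpow_natCast, ← zpow_add₀ (sgn_ne_zero _)]
    congr 1
    push_cast
    ring
  have h4 : sgn β ^ (b - a + 1) = sgn β ^ (b + a + 1) := by
    rw [zpow_add₀ (sgn_ne_zero β), zpow_add₀ (sgn_ne_zero β), sub_eq_add_neg,
      zpow_add₀ (sgn_ne_zero β), zpow_add₀ (sgn_ne_zero β), sgn_zpow_neg]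
  rw [e2, coeff_C_mul_laurent, HahnSeries.coeff_add, h4, h3]
  ring

/-- The string equations. -/
theorem string_equation {m : ℕ} (hm : 1 ≤ m) {F : ℕ → Poly} (hF : IsFreeEnergy corr (potV m) F) {a : ℕ}
    (ha : a ≤ 2) (n : ℕ) {τ : Type*} [DecidableEq τ] (b : τ → ℤ) (S : Finset τ) :
    ((m : ℂ) + a) * jetVec (S.val.map fun t => sVec (b t)) (F (n + 2)) (sVec (m + a)) +
      ((m : ℂ) - a) * jetVec (S.val.map fun t => sVec (b t)) (F (n + 2)) (sVec (m - a)) =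
    m * ∑ t ∈ S, jetVec ((S.erase t).val.map fun t => sVec (b t)) (F (n + 1))
      (hypRes (b t + a) + hypRes (b t - a)) := by
  set K := (Finset.range (n + 3)).sup fun k => bd (F k) with hK
  have hKk : ∀ k ≤ n + 2, bd (F k) ≤ K := fun k hk =>
    Finset.le_sup (f := fun k => bd (F k)) (Finset.mem_range.mpr (by omega))
  -- `K` bounds all orders that occur, and `2 * K + 3` is past the last nonzero entry of `virMat` on
  -- the box.
  have h := weighted_recursion hF (hypW a) (2 * K + 3) K n (fun k hk => hKk k (by omega))
    (fun i hi i' hi' => sum_hypW_virMat ha (by rw [mem_box] at hi hi'; omega))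
    (fun t => sVec (b t)) S
  rw [jetVec_congr _ _ K (hKk _ le_rfl) (e := (2 / (m : ℂ)) • (((m : ℂ) + a) • sVec (m + a) +
      ((m : ℂ) - a) • sVec (m - a))) fun i hi => by
      rw [mem_box] at hi
      rw [sum_hypW_dvec _ _ _ _ (by omega)]
      rfl,
    Finset.sum_congr rfl fun t _ => jetVec_congr _ _ K (hKk _ (by omega))
      (e := (2 : ℂ) • (hypRes (b t + a) + hypRes (b t - a))) fun i hi => by
      rw [mem_box] at hi
      rw [sum_hypW_field _ _ _ _ (by omega)]
      rfl] at h
  simp only [map_smul, map_add, smul_eq_mul, ← Finset.mul_sum] at h ⊢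
  have hm' : (m : ℂ) ≠ 0 := Nat.cast_ne_zero.mpr (by omega)
  field_simp at h
  linear_combination h

/-- By `2 sinh (m s) sinh s = cosh ((m + 1) s) - cosh ((m - 1) s)`, applied to `x V`. -/
theorem dilVec_potV {m : ℕ} (i : Idx) :
    dilVec (potV m) i = 1 / (m : ℂ) * (sVec (m + 1) i - sVec (m - 1) i) := by
  have h1 : PowerSeries.X * potS m i.1 = PowerSeries.C (2 * sgn i.1 ^ (m + 1) / m) *
      (cosS ((m : ℂ) + 1) - cosS ((m : ℂ) - 1)) := by
    have e1 := sinS_mul_sinS m 1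
    have e2 : (PowerSeries.C (4 * sgn i.1 ^ (m + 1) / m) : PowerSeries ℂ) =
        PowerSeries.C 2 * PowerSeries.C (2 * sgn i.1 ^ (m + 1) / m) := by
      rw [← map_mul]; congr 1; ring
    rw [potS, e2, ← e1]
    ring
  have h2 := congrArg (PowerSeries.coeff i.2) h1
  rw [PowerSeries.coeff_C_mul, map_sub] at h2
  have h3 : dilVec (potV m) i = PowerSeries.coeff i.2 (PowerSeries.X * potS m i.1) / 2 := by
    rw [dilVec]
    obtain ⟨α, _ | k⟩ := i
    · simp
    · rw [if_neg (Nat.succ_ne_zero k), PowerSeries.coeff_succ_X_mul, potV, Nat.add_sub_cancel]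
  have h4 : sgn i.1 ^ ((m : ℤ) - 1) = sgn i.1 ^ ((m : ℤ) + 1) := by
    rw [sub_eq_add_neg, zpow_add₀ (sgn_ne_zero _), sgn_zpow_neg, ← zpow_add₀ (sgn_ne_zero _)]
  have h5 : sgn i.1 ^ ((m : ℤ) + 1) = sgn i.1 ^ (m + 1) := by norm_cast
  rw [h3, h2, sVec, sVec, h4, h5]
  push_cast
  ring

end EynardOrantin

end

/-! ### Expansions at `z = 0`, quasi-polynomiality and uniqueness. -/

noncomputable section

namespace EynardOrantin

open Filter Topology

/-- The terms of the expansion of the derivatives of the Bergmann kernel. -/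
def bergmannTerm (α : ℤˣ) (z : ℂ) (n c : ℕ) (s : ℂ) : ℂ :=
  sgn α ^ (c + 1) * z ^ c * (c + 1) * (-(c + 1 : ℂ)) ^ n * Complex.exp (-(c + 1 : ℂ) * s)

theorem hasDerivAt_bergmannTerm (α : ℤˣ) (z : ℂ) (n c : ℕ) (s : ℂ) :
    HasDerivAt (bergmannTerm α z n c) (bergmannTerm α z (n + 1) c s) s := by
  have h := (((hasDerivAt_id' s).const_mul (-(c + 1 : ℂ))).cexp).const_mul
    (sgn α ^ (c + 1) * z ^ c * (c + 1) * (-(c + 1 : ℂ)) ^ n)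
  refine HasDerivAt.congr_deriv (f := bergmannTerm α z n c) h ?_
  rw [bergmannTerm, pow_succ (-(c + 1 : ℂ))]
  ring

theorem norm_sgn (α : ℤˣ) : ‖sgn α‖ = 1 := by
  rcases Int.units_eq_one_or α with rfl | rfl <;> simp [sgn]

theorem norm_exp_neg_le {s : ℂ} (hs : s ∈ Metric.ball (0 : ℂ) 1) : ‖Complex.exp (-s)‖ ≤ 3 := by
  rw [mem_ball_zero_iff] at hs
  rw [Complex.norm_exp]
  have h1 : (-s).re ≤ 1 := (Complex.re_le_norm _).trans (by rw [norm_neg]; exact hs.le)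
  exact (Real.exp_le_exp.mpr h1).trans Real.exp_one_lt_three.le

theorem norm_bergmannTerm_le (α : ℤˣ) {z : ℂ} (hz : ‖z‖ ≤ 1 / 4) (n c : ℕ) {s : ℂ}
    (hs : s ∈ Metric.ball (0 : ℂ) 1) :
    ‖bergmannTerm α z n c s‖ ≤ 4 * (((c + 1 : ℕ) : ℝ) ^ (n + 1) * (3 / 4 : ℝ) ^ (c + 1)) := by
  have h0 : ‖(c + 1 : ℂ)‖ = c + 1 := by
    exact_mod_cast Complex.norm_natCast (c + 1)
  have h1 : Complex.exp (-(c + 1 : ℂ) * s) = Complex.exp (-s) ^ (c + 1) := by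
    rw [← Complex.exp_nat_mul]
    push_cast
    ring_nf
  rw [bergmannTerm, h1, norm_mul, norm_mul, norm_mul, norm_mul, norm_pow, norm_pow, norm_pow, norm_pow,
    norm_sgn, norm_neg, h0, one_pow, one_mul]
  have h2 : ‖z‖ ^ c ≤ (1 / 4) ^ c := pow_le_pow_left₀ (norm_nonneg _) hz c
  have h3 : ‖Complex.exp (-s)‖ ^ (c + 1) ≤ 3 ^ (c + 1) :=
    pow_le_pow_left₀ (norm_nonneg _) (norm_exp_neg_le hs) _
  calc ‖z‖ ^ c * (c + 1 : ℝ) * (c + 1 : ℝ) ^ n * ‖Complex.exp (-s)‖ ^ (c + 1)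
      ≤ (1 / 4) ^ c * (c + 1 : ℝ) * (c + 1 : ℝ) ^ n * 3 ^ (c + 1) := by gcongr
    _ = 4 * (((c + 1 : ℕ) : ℝ) ^ (n + 1) * (3 / 4 : ℝ) ^ (c + 1)) := by
      rw [div_pow, div_pow, one_pow, pow_succ (4 : ℝ)]
      push_cast
      field_simp
      ring

theorem summable_bound (n : ℕ) :
    Summable fun c : ℕ => 4 * (((c + 1 : ℕ) : ℝ) ^ (n + 1) * (3 / 4 : ℝ) ^ (c + 1)) := by
  refine Summable.mul_left 4 ?_
  refine (summable_nat_add_iff (f := fun c : ℕ => (c : ℝ) ^ (n + 1) * (3 / 4 : ℝ) ^ c) 1).mpr ?_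
  exact summable_pow_mul_geometric_of_norm_lt_one _ (by rw [Real.norm_eq_abs, abs_of_pos] <;> norm_num)

/-- The kernel is the derivative of a geometric series in `α e^(-s) z`, of norm at most `3 / 4` for
`|s| < 1`; differentiation term by term in `s` is justified by the summable bounds. -/
theorem hasSum_bergmannTerm (α : ℤˣ) {z : ℂ} (hz : ‖z‖ ≤ 1 / 4) (n : ℕ) {s : ℂ}
    (hs : s ∈ Metric.ball (0 : ℂ) 1) :
    HasSum (fun c => bergmannTerm α z n c s) (iteratedDeriv n
      (fun s => sgn α * Complex.exp s / (sgn α * Complex.exp s - z) ^ 2) s) := by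
  induction n generalizing s with
  | zero =>
    set u := sgn α * Complex.exp (-s) with hu
    have hr : ‖u * z‖ < 1 := by
      rw [hu, norm_mul, norm_mul, norm_sgn, one_mul]
      have := mul_le_mul (norm_exp_neg_le hs) hz (norm_nonneg _) (by norm_num)
      linarith
    have h := (hasSum_choose_mul_geometric_of_norm_lt_one 1 hr).mul_left u
    refine hasSum_congr h (fun c => ?_) ?_
    · have h1 : Complex.exp (-(c + 1 : ℂ) * s) = Complex.exp (-s) ^ (c + 1) := by
        rw [← Complex.exp_nat_mul]
        push_cast
        ring_nf
      rw [bergmannTerm, h1, hu, Nat.choose_one_right]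
      push_cast
      ring
    · have h1 : Complex.exp s * Complex.exp (-s) = 1 := by rw [← Complex.exp_add]; simp
      have h2 : 1 - u * z ≠ 0 := by
        intro h0
        rw [← sub_eq_zero.mp h0, norm_one] at hr
        exact lt_irrefl _ hr
      have h3 : sgn α * Complex.exp s * u = 1 := by
        rw [hu]
        linear_combination sgn α * sgn α * h1 + sgn_mul_self α
      have h4 : sgn α * Complex.exp s - z = sgn α * Complex.exp s * (1 - u * z) := by
        linear_combination z * h3
      have h5 : sgn α * Complex.exp s ≠ 0 := left_ne_zero_of_mul_eq_one h3
      have h6 := eq_inv_of_mul_eq_one_right h3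
      rw [iteratedDeriv_zero, h4]
      generalize 1 - u * z = q at h2 ⊢
      rw [h6]
      generalize sgn α * Complex.exp s = v at h5 ⊢
      field_simp
  | succ n ih =>
    have he : iteratedDeriv n (fun s => sgn α * Complex.exp s / (sgn α * Complex.exp s - z) ^ 2) =ᶠ[𝓝 s]
        fun s => ∑' c, bergmannTerm α z n c s := by
      filter_upwards [Metric.isOpen_ball.mem_nhds hs] with t ht
      exact (ih ht).tsum_eq.symm
    have hd := hasDerivAt_tsum_of_isPreconnected (summable_bound (n + 1)) Metric.isOpen_ball
      (convex_ball (0 : ℂ) 1).isPreconnected (fun c y _ => hasDerivAt_bergmannTerm α z n c y)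
      (fun c y hy => norm_bergmannTerm_le α hz (n + 1) c hy) hs (ih hs).summable hs
    rw [iteratedDeriv_succ, he.deriv_eq, hd.deriv]
    exact (Summable.of_norm_bounded (summable_bound (n + 1)) fun c =>
      norm_bergmannTerm_le α hz (n + 1) c hs).hasSum

/-- The expansion of the basis forms at the origin. -/
theorem hasSum_bVec {z : ℂ} (hz : ‖z‖ ≤ 1 / 4) (i : Idx) :
    HasSum (fun c : ℕ => sVec ((c : ℤ) + 1) i * ((c + 1) * z ^ c)) (bVec z i) := by
  have h := (hasSum_bergmannTerm i.1 hz (2 * i.2) (Metric.mem_ball_self one_pos)).div_const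
    ((2 * i.2).factorial : ℂ)
  refine hasSum_congr h (fun c => ?_) rfl
  have e : sgn i.1 ^ ((c : ℤ) + 1) = sgn i.1 ^ (c + 1) := by norm_cast
  rw [bergmannTerm, sVec, e, cosS, PowerSeries.coeff_mk, mul_zero, Complex.exp_zero,
    (even_two_mul i.2).neg_pow]
  push_cast
  ring

theorem hasSum_mul_hasSum {ι κ : Type*} {f : ι → ℂ} {g : κ → ℂ} {a b : ℂ} (hf : HasSum f a)
    (hg : HasSum g b) : HasSum (fun x : ι × κ => f x.1 * g x.2) (a * b) :=
  hf.mul hg (summable_mul_of_summable_norm hf.summable.norm hg.summable.norm)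

theorem hasSum_fin_cons {n : ℕ} {f : (Fin (n + 1) → ℕ) → ℂ} {a : ℂ} :
    HasSum f a ↔ HasSum (fun x : ℕ × (Fin n → ℕ) => f (Fin.cons x.1 x.2)) a :=
  ((Fin.consEquiv fun _ : Fin (n + 1) => ℕ).hasSum_iff).symm

/-- The jet is multilinear and involves finitely many coordinates of each direction, so the
expansions of the `bVec (z t)` are inserted one variable at a time. -/
theorem hasSum_jet (p : Poly) (n : ℕ) (z : Fin n → ℂ) (hz : ∀ t, ‖z t‖ ≤ 1 / 4) :
    HasSum (fun c : Fin n → ℕ => jet (Finset.univ.val.map fun t => sVec ((c t : ℤ) + 1)) p *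
      ∏ t, (((c t : ℂ) + 1) * z t ^ c t)) (jet (Finset.univ.val.map fun t => bVec (z t)) p) := by
  induction n generalizing p with
  | zero =>
    have := hasSum_unique (fun c : Fin 0 → ℕ => jet (Finset.univ.val.map fun t => sVec ((c t : ℤ) + 1)) p *
      ∏ t, (((c t : ℂ) + 1) * z t ^ c t))
    refine hasSum_congr this (fun _ => rfl) ?_
    simp
  | succ n ih =>
    have hS := pderiv_eq_zero_of_notMem_box (le_refl (bd p))
    have hexp : ∀ {B : Type} (f : B → Idx → ℂ) (w : B) (b : Fin n → B),
        jet (Finset.univ.val.map fun t => f ((Fin.cons w b : Fin (n + 1) → B) t)) p = ∑ i ∈ box (bd p),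
          f w i * jet (Finset.univ.val.map fun t => f (b t)) (MvPolynomial.pderiv i p) := by
      intro B f w b
      rw [map_univ_cons f w b, jet_cons, vecD_eq_sum _ _ _ hS, jet_sum]
      exact Finset.sum_congr rfl fun i _ => jet_C_mul _ _ _
    obtain ⟨w, y, rfl⟩ : ∃ (w : ℂ) (y : Fin n → ℂ), z = Fin.cons w y :=
      ⟨z 0, Fin.tail z, (Fin.cons_self_tail z).symm⟩
    have hi := hasSum_sum (s := box (bd p)) fun i _ => hasSum_mul_hasSum (hasSum_bVec (hz 0) i)
      (ih (MvPolynomial.pderiv i p) y fun t => hz t.succ)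
    rw [hexp bVec w y, hasSum_fin_cons]
    refine hasSum_congr hi (fun x => ?_) rfl
    rw [hexp (fun k : ℕ => sVec ((k : ℤ) + 1)), Fin.prod_univ_succ, Finset.sum_mul]
    refine Finset.sum_congr rfl fun i _ => ?_
    simp only [Fin.cons_zero, Fin.cons_succ]
    ring

/-- An entry of `sVec b` is the sign `α ^ b`, which depends on the parity of `b`, times the monomial
`b ^ (2 k) / (2 k)!`. -/
theorem isQuasiPolynomial_jet (p : Poly) (n : ℕ) :
    IsQuasiPolynomial fun b : Fin n → ℤ => jet (Finset.univ.val.map fun t => sVec (b t)) p := by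
  induction n generalizing p with
  | zero =>
    refine ⟨fun _ => MvPolynomial.C (jet 0 p), fun b => ?_⟩
    rw [MvPolynomial.eval_C]
    rfl
  | succ n ih =>
    have hS := pderiv_eq_zero_of_notMem_box (le_refl (bd p))
    choose P hP using fun i : Idx => ih (MvPolynomial.pderiv i p)
    refine ⟨fun ε => ∑ i ∈ box (bd p), MvPolynomial.C ((if ε 0 = 0 then 1 else sgn i.1) *
      ((2 * i.2).factorial : ℂ)⁻¹) * MvPolynomial.X 0 ^ (2 * i.2) *
        MvPolynomial.rename Fin.succ (P i fun t => ε t.succ), fun b => ?_⟩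
    have h1 := map_univ_cons sVec (b 0) (Fin.tail b)
    rw [Fin.cons_self_tail] at h1
    simp only
    rw [h1, jet_cons, vecD_eq_sum _ _ _ hS, jet_sum, map_sum]
    refine Finset.sum_congr rfl fun i _ => ?_
    rw [jet_C_mul, map_mul, map_mul, map_pow, MvPolynomial.eval_C, MvPolynomial.eval_X,
      MvPolynomial.eval_rename]
    have h2 := hP i (Fin.tail b)
    simp only at h2
    rw [h2]
    congr 1
    have h3 : sgn i.1 ^ b 0 = if ((b 0 : ℤ) : ZMod 2) = 0 then 1 else sgn i.1 := by
      split_ifs with h <;> rw [ZMod.intCast_zmod_eq_zero_iff_dvd] at h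
      · obtain ⟨k, hk⟩ := h
        rw [hk, zpow_mul]
        norm_num [show sgn i.1 ^ (2 : ℤ) = 1 from (zpow_ofNat _ 2).trans (sgn_sq _)]
      · obtain ⟨k, hk⟩ : ∃ k, b 0 = 2 * k + 1 := ⟨b 0 / 2, by push_cast at h; omega⟩
        rw [hk, zpow_add₀ (sgn_ne_zero _), zpow_mul,
          show sgn i.1 ^ (2 : ℤ) = 1 from (zpow_ofNat _ 2).trans (sgn_sq _), one_zpow, one_mul, zpow_one]
    rw [sVec, h3, cosS, PowerSeries.coeff_mk]
    ring

/-- With the other variables fixed, uniqueness in the first variable shows that each of its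
coefficients sums to zero; then induction. -/
theorem eq_zero_of_hasSum (n : ℕ) (a : (Fin n → ℕ) → ℂ)
    (h : ∀ᶠ z in 𝓝 (0 : Fin n → ℂ), HasSum (fun c => a c * ∏ t, z t ^ c t) 0) (c : Fin n → ℕ) :
    a c = 0 := by
  induction n with
  | zero =>
    have h1 := h.self_of_nhds
    have h2 := hasSum_unique (fun c : Fin 0 → ℕ => a c * ∏ t, (0 : Fin 0 → ℂ) t ^ c t)
    have h3 := h2.unique h1
    rw [Finset.univ_eq_empty, Finset.prod_empty, mul_one] at h3
    rw [← h3]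
    exact congrArg a (Subsingleton.elim _ _)
  | succ n ih =>
    obtain ⟨ε, hε, hb⟩ := Metric.eventually_nhds_iff.mp h
    have key : ∀ (w : ℂ) (z : Fin n → ℂ), dist w 0 < ε → dist z 0 < ε →
        HasSum (fun x : ℕ × (Fin n → ℕ) => w ^ x.1 * (a (Fin.cons x.1 x.2) * ∏ t, z t ^ x.2 t)) 0 := by
      intro w z hw hz
      have h1 := hb (y := Fin.cons w z) (by
        rw [dist_pi_lt_iff hε] at hz ⊢
        intro t
        refine Fin.cases ?_ (fun t => ?_) t
        · simpa using hw
        · simpa using hz t)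
      rw [hasSum_fin_cons] at h1
      refine hasSum_congr h1 (fun x => ?_) rfl
      rw [Fin.prod_univ_succ]
      simp only [Fin.cons_zero, Fin.cons_succ]
      ring
    have hz : ∀ z : Fin n → ℂ, dist z 0 < ε → ∀ k : ℕ,
        HasSum (fun c : Fin n → ℕ => a (Fin.cons k c) * ∏ t, z t ^ c t) 0 := by
      intro z hz
      have hsum : ∀ k, Summable fun c : Fin n → ℕ => a (Fin.cons k c) * ∏ t, z t ^ c t := by
        intro k
        -- Any nonzero point in the disc serves: summability of the slice follows after division by
        -- `w ^ k`.
        have hw : dist ((ε / 2 : ℝ) : ℂ) 0 < ε := by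
          rw [dist_zero_right, Complex.norm_real, Real.norm_eq_abs, abs_of_pos (by positivity)]
          linarith
        have hw0 : ((ε / 2 : ℝ) : ℂ) ^ k ≠ 0 :=
          pow_ne_zero _ (Complex.ofReal_ne_zero.mpr (by positivity))
        have h1 := (key _ z hw hz).summable.prod_factor k
        exact (summable_mul_left_iff hw0).mp h1
      have hP : PSum (PowerSeries.mk fun k => ∑' c : Fin n → ℕ, a (Fin.cons k c) * ∏ t, z t ^ c t)
          fun _ => 0 := by
        refine Metric.eventually_nhds_iff.mpr ⟨ε, hε, fun w hw => ?_⟩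
        refine hasSum_congr ((key w z hw hz).prod_fiberwise fun k => (hsum k).hasSum.mul_left (w ^ k))
          (fun k => ?_) rfl
        rw [PowerSeries.coeff_mk, mul_comm]
      have h0 := hP.unique (psum_C 0) (Eventually.of_forall fun _ => rfl)
      intro k
      have h1 := congrArg (PowerSeries.coeff k) h0
      rw [PowerSeries.coeff_mk, map_zero, map_zero] at h1
      rw [← h1]
      exact (hsum k).hasSum
    have h1 := ih (fun c' => a (Fin.cons (c 0) c'))
      (Metric.eventually_nhds_iff.mpr ⟨ε, hε, fun z hz' => hz z hz' (c 0)⟩) (Fin.tail c)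
    simpa using h1

theorem IsQuasiPolynomial.ext {n : ℕ} {N N' : (Fin n → ℤ) → ℂ} (h : IsQuasiPolynomial N)
    (h' : IsQuasiPolynomial N')
    (heq : ∀ c : Fin n → ℕ, N (fun t => (c t : ℤ) + 1) = N' (fun t => (c t : ℤ) + 1)) : N = N' := by
  obtain ⟨P, hP⟩ := h
  obtain ⟨Q, hQ⟩ := h'
  funext b
  rw [hP, hQ]
  congr 1
  -- Infinitely many positive integers of the same parity as `b t`, so both quasi-polynomials use
  -- the polynomials of the class of `b` there.
  refine MvPolynomial.funext_set (fun t => (fun k : ℕ => ((2 * k + (b t).natAbs + 2 : ℕ) : ℂ)) '' Set.univ)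
    (fun t => ?_) fun x hx => ?_
  · refine Set.infinite_univ.image fun k _ l _ hkl => ?_
    have := Nat.cast_injective hkl
    omega
  · choose k _ hk using fun t => hx t (Set.mem_univ t)
    have h1 := heq fun t => 2 * k t + (b t).natAbs + 1
    rw [hP, hQ] at h1
    have e1 : (fun t => ((((2 * k t + (b t).natAbs + 1 : ℕ) : ℤ) + 1 : ℤ) : ℂ)) = x := by
      funext t
      rw [← hk t, ← Int.cast_natCast]
      congr 1
    have e2 : (fun t => ((((2 * k t + (b t).natAbs + 1 : ℕ) : ℤ) + 1 : ℤ) : ZMod 2)) =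
        fun t => ((b t : ℤ) : ZMod 2) := by
      funext t
      rw [ZMod.intCast_eq_intCast_iff]
      refine Int.emod_emod_of_dvd _ (dvd_refl 2) |>.symm.trans ?_
      omega
    rwa [e1, e2] at h1

end EynardOrantin

end

/-! ### The recursions for the quasi-polynomials. -/

noncomputable section

namespace EynardOrantin

open Filter Topology

/-- The quasi-polynomials of the free energy. -/
def jetQP (F : ℕ → Poly) (M n : ℕ) (b : Fin n → ℤ) : ℂ :=
  jet (Finset.univ.val.map fun t => sVec (b t)) (F M)

theorem isInvariantQuasiPolynomial_jetQP {m : ℕ} (hm : 1 ≤ m) {F : ℕ → Poly}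
    (hF : IsFreeEnergy corr (potV m) F) (g n : ℕ) (hn : 1 ≤ n) (hg : 2 < 2 * g + n) :
    IsInvariantQuasiPolynomial (ymon m) g n (jetQP F (2 * g + n - 2) n) := by
  refine ⟨isQuasiPolynomial_jet _ n, ?_⟩
  filter_upwards [Metric.closedBall_mem_nhds (0 : Fin n → ℂ) (ε := 1 / 4) (by norm_num)] with z hz
  rw [mem_closedBall_zero_iff] at hz
  have hz' : ∀ t, ‖z t‖ ≤ 1 / 4 := fun t => (norm_le_pi_norm z t).trans hz
  rw [jetFormula hm hF g n hn hg z fun t α h => by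
    have := hz' t
    rw [h, norm_sgn] at this
    norm_num at this]
  exact hasSum_jet _ n z hz'

theorem IsInvariantQuasiPolynomial.unique {y : ℂ → ℂ} {g n : ℕ} {N N' : (Fin n → ℤ) → ℂ}
    (h : IsInvariantQuasiPolynomial y g n N) (h' : IsInvariantQuasiPolynomial y g n N') : N = N' := by
  refine h.1.ext h'.1 fun c => ?_
  have h0 := eq_zero_of_hasSum n
    (fun c => (N (fun t => (c t : ℤ) + 1) - N' (fun t => (c t : ℤ) + 1)) * ∏ t, ((c t : ℂ) + 1)) (by
      filter_upwards [h.2, h'.2] with z h1 h2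
      refine hasSum_congr (h1.sub h2) (fun c => ?_) (sub_self _).symm
      rw [Finset.prod_mul_distrib]
      ring) c
  refine sub_eq_zero.mp ((mul_eq_zero.mp h0).resolve_right ?_)
  exact Finset.prod_ne_zero_iff.mpr fun t _ => Nat.cast_add_one_ne_zero _

theorem jetVec_map_erase {n : ℕ} (b : Fin n → ℤ) (t : Fin n) (F : ℕ → Poly) (M : ℕ) (k : ℤ) :
    jetVec (((Finset.univ.erase t).val).map fun t => sVec (b t)) (F M) (sVec k) =
      jetQP F M n (Function.update b t k) := by
  rw [jetQP, jetVec_apply, ← jet_cons]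
  congr 1
  conv_rhs => rw [← Finset.insert_erase (Finset.mem_univ t),
    Finset.insert_val_of_notMem (Finset.notMem_erase t _), Multiset.map_cons, Function.update_self]
  congr 1
  refine Multiset.map_congr rfl fun s hs => ?_
  rw [Function.update_of_ne (Finset.ne_of_mem_erase (Finset.mem_val.mp hs))]

theorem jetVec_map_univ {n : ℕ} (b : Fin n → ℤ) (F : ℕ → Poly) (M : ℕ) (k : ℤ) :
    jetVec ((Finset.univ : Finset (Fin n)).val.map fun t => sVec (b t)) (F M) (sVec k) =
      jetQP F M (n + 1) (Fin.cons k b) := by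
  rw [jetQP, map_univ_cons, jet_cons, jetVec_apply]

section

variable {m : ℕ} {F : ℕ → Poly}

theorem jetQP_string (hm : 1 ≤ m) (hF : IsFreeEnergy corr (potV m) F) {a : ℕ} (ha : a ≤ 2) (k : ℕ)
    {n : ℕ} (b : Fin n → ℤ) :
    ((m : ℂ) + a) * jetQP F (k + 2) (n + 1) (Fin.cons ((m : ℤ) + a) b) +
      ((m : ℂ) - a) * jetQP F (k + 2) (n + 1) (Fin.cons ((m : ℤ) - a) b) =
    m * ∑ t, jetVec ((Finset.univ.erase t).val.map fun t => sVec (b t)) (F (k + 1))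
      (hypRes (b t + a) + hypRes (b t - a)) := by
  have h := string_equation hm hF ha k b Finset.univ
  rwa [jetVec_map_univ, jetVec_map_univ] at h

theorem jetQP_first (hm : 1 ≤ m) (hF : IsFreeEnergy corr (potV m) F) (k : ℕ) {n : ℕ}
    (b : Fin n → ℤ) (hb : ∀ t, 0 ≤ b t) :
    jetQP F (k + 2) (n + 1) (Fin.cons (m : ℤ) b) =
      ∑ t, ∑ l ∈ (Finset.Icc 1 (b t)).filter (fun l => ¬ l ≡ b t [ZMOD 2]),
        (l : ℂ) * jetQP F (k + 1) n (Function.update b t l) := by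
  have h := jetQP_string hm hF (Nat.zero_le 2) k b
  have hm' : (m : ℂ) ≠ 0 := Nat.cast_ne_zero.mpr (by omega)
  have e : ∀ t, jetVec ((Finset.univ.erase t).val.map fun t => sVec (b t)) (F (k + 1))
      (hypRes (b t + (0 : ℕ)) + hypRes (b t - (0 : ℕ))) =
      2 * ∑ l ∈ (Finset.Icc 1 (b t)).filter (fun l => ¬ l ≡ b t [ZMOD 2]),
        (l : ℂ) * jetQP F (k + 1) n (Function.update b t l) := fun t => by
    rw [Nat.cast_zero, add_zero, sub_zero, map_add, hypRes_of_nonneg (hb t), map_sum, ← two_mul]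
    simp only [map_smul, smul_eq_mul, jetVec_map_erase]
  rw [Finset.sum_congr rfl fun t _ => e t, ← Finset.mul_sum] at h
  simp only [Nat.cast_zero, add_zero, sub_zero] at h
  refine mul_left_cancel₀ hm' ?_
  linear_combination (1 / 2 : ℂ) * h

/-- The case `a = 1`. In `hypRes (b + 1) + hypRes (b - 1)` the top term `k = b` occurs only once,
which accounts for the correction with `b`. -/
theorem jetQP_second (hm : 1 ≤ m) (hF : IsFreeEnergy corr (potV m) F) (k : ℕ) {n : ℕ}
    (b : Fin n → ℤ) (hb : ∀ t, 0 ≤ b t) :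
    ((m : ℂ) + 1) * jetQP F (k + 2) (n + 1) (Fin.cons ((m : ℤ) + 1) b) +
        ((m : ℂ) - 1) * jetQP F (k + 2) (n + 1) (Fin.cons ((m : ℤ) - 1) b) =
      2 * (m : ℂ) * (∑ t, ∑ l ∈ (Finset.Icc 1 (b t)).filter (fun l => l ≡ b t [ZMOD 2]),
        (l : ℂ) * jetQP F (k + 1) n (Function.update b t l)) -
      (m : ℂ) * ∑ t, (b t : ℂ) * jetQP F (k + 1) n b := by
  have h := jetQP_string hm hF one_le_two k b
  have e : ∀ t, jetVec ((Finset.univ.erase t).val.map fun t => sVec (b t)) (F (k + 1))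
      (hypRes (b t + (1 : ℕ)) + hypRes (b t - (1 : ℕ))) =
      2 * ∑ l ∈ (Finset.Icc 1 (b t)).filter (fun l => l ≡ b t [ZMOD 2]),
        (l : ℂ) * jetQP F (k + 1) n (Function.update b t l) - (b t : ℂ) * jetQP F (k + 1) n b := fun t => by
    rw [Nat.cast_one, hypRes_add_hypRes (hb t), map_sub, map_nsmul, map_smul, map_sum,
      jetVec_map_erase, Function.update_eq_self, nsmul_eq_mul, smul_eq_mul]
    simp only [map_smul, smul_eq_mul, jetVec_map_erase, Nat.cast_ofNat]
  rw [Finset.sum_congr rfl fun t _ => e t, Finset.sum_sub_distrib, ← Finset.mul_sum] at h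
  simp only [Nat.cast_one] at h
  linear_combination h

/-- The case `a = 2` minus the case `a = 0`. The difference of the right sides is `(b + 1) sVec (b +
1) - (b - 1) sVec (b - 1)`, and evenness of `sVec` rewrites the last term at `1 - b`; no sign of `b`
is used. -/
theorem jetQP_third (hm : 1 ≤ m) (hF : IsFreeEnergy corr (potV m) F) (k : ℕ) {n : ℕ}
    (b : Fin n → ℤ) :
    ((m : ℂ) - 2) * jetQP F (k + 2) (n + 1) (Fin.cons ((m : ℤ) - 2) b) -
        2 * (m : ℂ) * jetQP F (k + 2) (n + 1) (Fin.cons (m : ℤ) b) +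
        ((m : ℂ) + 2) * jetQP F (k + 2) (n + 1) (Fin.cons ((m : ℤ) + 2) b) =
      (m : ℂ) * ∑ t, (((1 + b t : ℤ) : ℂ) * jetQP F (k + 1) n (Function.update b t (1 + b t)) +
        ((1 - b t : ℤ) : ℂ) * jetQP F (k + 1) n (Function.update b t (1 - b t))) := by
  have h0 := jetQP_string hm hF (Nat.zero_le 2) k b
  have h2 := jetQP_string hm hF le_rfl k b
  have e : ∀ t, jetVec ((Finset.univ.erase t).val.map fun t => sVec (b t)) (F (k + 1))
      (hypRes (b t + (2 : ℕ)) + hypRes (b t - (2 : ℕ))) =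
      jetVec ((Finset.univ.erase t).val.map fun t => sVec (b t)) (F (k + 1))
        (hypRes (b t + (0 : ℕ)) + hypRes (b t - (0 : ℕ))) +
      (((1 + b t : ℤ) : ℂ) * jetQP F (k + 1) n (Function.update b t (1 + b t)) +
        ((1 - b t : ℤ) : ℂ) * jetQP F (k + 1) n (Function.update b t (1 - b t))) := fun t => by
    rw [← jetVec_map_erase, ← jetVec_map_erase, ← smul_eq_mul, ← smul_eq_mul, ← map_smul, ← map_smul,
      ← map_add, ← map_add, ← sVec_neg (1 - b t)]
    refine congrArg _ ?_
    have h3 := hypRes_add_one_sub (b t + 1)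
    have h4 := hypRes_add_one_sub (b t - 1)
    rw [add_sub_cancel_right, show b t + 1 + 1 = b t + (2 : ℕ) by push_cast; ring] at h3
    rw [sub_add_cancel, show b t - 1 - 1 = b t - (2 : ℕ) by push_cast; ring] at h4
    have h5 : ((1 - b t : ℤ) : ℂ) • sVec (-(1 - b t)) = -(((b t - 1 : ℤ) : ℂ) • sVec (b t - 1)) := by
      rw [neg_sub, ← neg_smul]
      congr 1
      push_cast
      ring
    rw [h5, ← h4, add_comm 1 (b t), ← h3, Nat.cast_zero, add_zero, sub_zero]
    abel
  rw [Finset.sum_congr rfl fun t _ => e t, Finset.sum_add_distrib] at h2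
  simp only [Nat.cast_zero, add_zero, sub_zero, Nat.cast_ofNat] at h0 h2
  linear_combination h2 - h0

/-- At least one derivative is taken, so the undetermined constant of the dilaton equation drops
out. -/
theorem jetQP_dilaton (hm : 1 ≤ m) (hF : IsFreeEnergy corr (potV m) F) (k : ℕ) {n : ℕ} (hn : 1 ≤ n)
    (b : Fin n → ℤ) :
    jetQP F (k + 1) (n + 1) (Fin.cons ((m : ℤ) + 1) b) -
      jetQP F (k + 1) (n + 1) (Fin.cons ((m : ℤ) - 1) b) = (m : ℂ) * k * jetQP F k n b := by
  obtain ⟨κ, hκ⟩ := dilaton corr_symm (isConvInv_pot hm) hF k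
  have h := congrArg (jet ((Finset.univ : Finset (Fin n)).val.map fun t => sVec (b t))) hκ
  have hne : ((Finset.univ : Finset (Fin n)).val.map fun t => sVec (b t)) ≠ 0 := by
    rw [← Multiset.card_pos, Multiset.card_map, Finset.card_val, Finset.card_univ, Fintype.card_fin]
    exact hn
  have e : dilVec (potV m) = (1 / (m : ℂ)) • (sVec (m + 1) - sVec (m - 1)) :=
    funext fun i => dilVec_potV i
  rw [jet_add, jet_C_mul, jet_C _ _ hne, add_zero, ← jetVec_apply, e, map_smul, map_sub, jetVec_map_univ,
    jetVec_map_univ, smul_eq_mul] at h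
  have hm' : (m : ℂ) ≠ 0 := Nat.cast_ne_zero.mpr (by omega)
  rw [mul_assoc, show (k : ℂ) * jetQP F k n b = _ from h.symm]
  field_simp

end

end EynardOrantin

end

theorem theorem3 (m : ℕ) (hm : 1 ≤ m) :
    -- the quasi-polynomials exist and are unique
    (∀ g n : ℕ, 1 ≤ n → 2 < 2 * g + n →
      ∃! N : (Fin n → ℤ) → ℂ,
        EynardOrantin.IsInvariantQuasiPolynomial (EynardOrantin.ymon m) g n N) ∧
    -- they satisfy the recursions; `N` is of type (g, n) and `N'` of type (g, n + 1)
    (∀ g n : ℕ, 1 ≤ n → 2 < 2 * g + n →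
      ∀ (N : (Fin n → ℤ) → ℂ) (N' : (Fin (n + 1) → ℤ) → ℂ),
        EynardOrantin.IsInvariantQuasiPolynomial (EynardOrantin.ymon m) g n N →
        EynardOrantin.IsInvariantQuasiPolynomial (EynardOrantin.ymon m) g (n + 1) N' →
        ∀ b : Fin n → ℤ, (∀ i, 0 ≤ b i) →
          (N' (Fin.cons (m : ℤ) b) =
            ∑ j : Fin n, ∑ k ∈ (Finset.Icc 1 (b j)).filter (fun k => ¬ k ≡ b j [ZMOD 2]),
              (k : ℂ) * N (Function.update b j k)) ∧
          (((m : ℂ) + 1) * N' (Fin.cons ((m : ℤ) + 1) b) +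
              ((m : ℂ) - 1) * N' (Fin.cons ((m : ℤ) - 1) b) =
            2 * (m : ℂ) *
                (∑ j : Fin n, ∑ k ∈ (Finset.Icc 1 (b j)).filter (fun k => k ≡ b j [ZMOD 2]),
                  (k : ℂ) * N (Function.update b j k)) -
              (m : ℂ) * ∑ j : Fin n, (b j : ℂ) * N b) ∧
          (((m : ℂ) - 2) * N' (Fin.cons ((m : ℤ) - 2) b) -
              2 * (m : ℂ) * N' (Fin.cons (m : ℤ) b) +
              ((m : ℂ) + 2) * N' (Fin.cons ((m : ℤ) + 2) b) =
            (m : ℂ) * ∑ j : Fin n,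
              (((1 + b j : ℤ) : ℂ) * N (Function.update b j (1 + b j)) +
                ((1 - b j : ℤ) : ℂ) * N (Function.update b j (1 - b j)))) ∧
          (N' (Fin.cons ((m : ℤ) + 1) b) - N' (Fin.cons ((m : ℤ) - 1) b) =
            (m : ℂ) * (2 * (g : ℂ) - 2 + (n : ℂ)) * N b)) := by
  obtain ⟨F, hF⟩ := EynardOrantin.exists_isFreeEnergy EynardOrantin.corr_symm
    (EynardOrantin.isConvInv_pot hm)
  refine ⟨fun g n hn hg => ⟨_, EynardOrantin.isInvariantQuasiPolynomial_jetQP hm hF g n hn hg,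
    fun N hN => hN.unique (EynardOrantin.isInvariantQuasiPolynomial_jetQP hm hF g n hn hg)⟩,
    fun g n hn hg N N' hN hN' b hb => ?_⟩
  -- By uniqueness `N` and `N'` are the jets of `F (k + 1)` and `F (k + 2)`; stability makes both
  -- indices positive, as the string equations require.
  obtain ⟨k, hk⟩ : ∃ k, 2 * g + n = k + 3 := ⟨2 * g + n - 3, by omega⟩
  have h1 := hN.unique (EynardOrantin.isInvariantQuasiPolynomial_jetQP hm hF g n hn hg)
  have h2 := hN'.unique
    (EynardOrantin.isInvariantQuasiPolynomial_jetQP hm hF g (n + 1) (by omega) (by omega))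
  rw [show 2 * g + n - 2 = k + 1 by omega] at h1
  rw [show 2 * g + (n + 1) - 2 = k + 2 by omega] at h2
  subst h1 h2
  refine ⟨EynardOrantin.jetQP_first hm hF k b hb, EynardOrantin.jetQP_second hm hF k b hb,
    EynardOrantin.jetQP_third hm hF k b, ?_⟩
  rw [EynardOrantin.jetQP_dilaton hm hF (k + 1) hn b]
  have hk' : (2 * (g : ℂ) + n) = k + 3 := by exact_mod_cast hk
  push_cast
  linear_combination (-(m : ℂ) * EynardOrantin.jetQP F (k + 1) n b) * hk'
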